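/- Let $d\ge 1$, let $H$ be a complex Hilbert space, and let $X=\{X_k\}_{k\ge1}$ be an admissible sequence: $X_k\in B((\mathbb C^d)^{\otimes k})$, $X_k\ge 0$, $X_1$ is invertible and $\limsup_k\|X_k\|^{1/k}<\infty$. Inner products are linear in the second variable. Let $R_0=I_{\mathbb C}$ and, for $k\ge1$, $R_k=\big(\sum_{l=1}^{k}\sum_{k_1+\cdots+k_l=k,\,k_j\ge1}X_{k_1}\otimes\cdots\otimes X_{k_l}\big)^{1/2}$. For a tuple $T=(T_1,\dots,T_d)$ in $B(H)$ let $T^{(k)}=(T_\alpha)_{|\alpha|=k}:(\mathbb C^d)^{\otimes k}\otimes H\to H$ be the row of all products $T_\alpha=T_{\alpha(1)}\cdots T_{\alpha(k)}$, and let $D_c(X,H)$ be the set of commuting tuples for which $\Phi_T(I)=\sum_{k\ge1}T^{(k)}(X_k\otimes I_H)T^{(k)*}$ is w*-convergent with $\|\Phi_T(I)\|<1$. Let $\mathcal F(\mathcal R)=\bigoplus_{k\ge0}R_k\big((\mathbb C^d)^{\circledS k}\big)$, where $(\mathbb C^d)^{\circledS k}$ is the symmetric tensor power, a closed subspace of the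 full Fock space $\mathcal F(\mathbb C^d)=\bigoplus_{k\ge0}(\mathbb C^d)^{\otimes k}$. Let $\tilde W_i$ be the weighted shift on $\mathcal F(\mathbb C^d)$ given by $\tilde W_i\theta=Z_{k+1}(e_i\otimes\theta)$ for $\theta\in(\mathbb C^d)^{\otimes k}$, where $Z_{k+1}=R_{k+1}^{-1}(I_{\mathbb C^d}\otimes R_k)$, and let $W_i=P_{\mathcal F(\mathcal R)}\tilde W_i|_{\mathcal F(\mathcal R)}$. For a completely positive kernel $K$ on $D_c(X,H)$ whose values are normal bounded linear maps on $B(H)$, let $E_K$ be the reproducing kernel W*-correspondence over $B(H)$. It consists of functions $f$ on $D_c(X,H)$ whose values are maps on $B(H)$, and it is generated as a W*-module over $B(H)$ by the functions $k_{(a,w)}(z)(b)=K(z,w)(ba^*)$, with inner product $\langle k_{(b,z)}c,k_{(a,w)}e\rangle=c^*K(z,w)(ba^*)e$ and left action $(\varphi_{E_K}(b)f)(z)(c)=f(z)(cb)$. A function $\phi:D_c(X,H)\to B(H)$ is a multiplier of $E_K$ if for every $f\in E_K$ the function $M_\phi f:z\mapsto\big(b\mapsto\phi(z)f(z)(b)\big)$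 lies in $E_K$. Then the operators $\tilde W_i$ are bounded; the series $$K^R_c(V,U)(a)=\sum_{k\ge0}V^{(k)}(R_k^2\otimes a)U^{(k)*}\qquad(V,U\in D_c(X,H),\ a\in B(H))$$ is w*-convergent and defines a completely positive kernel $K^R_c$ with values in the normal maps on $B(H)$; and the following hold. 1. For every $1\le i\le d$ the coordinate function $S_i(T)=T_i$ is a multiplier of $E_{K^R_c}$. 2. There is a unitary $\Lambda:E_{K^R_c}\otimes_{B(H)}H\to\mathcal F(\mathcal R)\otimes H$ such that (a) $\Lambda^*(W_i\otimes I_H)\Lambda=M_{S_i}\otimes I_H$ for every $1\le i\le d$, and (b) $\Lambda(\varphi_{E_{K^R_c}}(b)\otimes I_H)=(I_{\mathcal F(\mathcal R)}\otimes b)\Lambda$ for every $b\in B(H)$. 3. $E_{K^R_c}$ is $(X,H)$-contractive: the $M_{S_i}$ are bounded adjointable operators on $E_{K^R_c}$ and, with $M_S=(M_{S_1},\dots,M_{S_d})$, the series $\sum_{k\ge1}M_S^{(k)}(X_k\otimes I)M_S^{(k)*}$ is w*-convergent in the algebra $\mathcal L(E_{K^R_c})$ of adjointable operators, with sum $\le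 I$. -/

import Mathlib

open scoped ComplexOrder ENNReal TensorProduct

/-
Conventions.  Inner products are linear in the second variable.  `B(H)` is `H →L[ℂ] H`, with its
Loewner order.  Words of length `k` in the letters `Fin d` are functions `Fin k → Fin d`.
-/

namespace RKC

noncomputable section

/-! ### Tensor powers of `ℂ^d` and admissible sequences -/

/-- The Hilbert space `(ℂ^d)^{⊗k}`, in coordinates with respect to its orthonormal basis
`e_α = e_{α(1)} ⊗ ⋯ ⊗ e_{α(k)}` indexed by the words `α` of length `k`. -/
abbrev Tens (d k : ℕ) := EuclideanSpace ℂ (Fin k → Fin d)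

/-- A sequence of operators `X_k` on `(ℂ^d)^{⊗k}`, each given by its matrix `(x_{α,β})` indexed by
words of length `k`.  (The entry at `k = 0` is never used.) -/
abbrev WeightSeq (d : ℕ) := ∀ k : ℕ, Matrix (Fin k → Fin d) (Fin k → Fin d) ℂ

/-- The operator on `(ℂ^d)^{⊗k}` with a given matrix. -/
def wop {d k : ℕ} (M : Matrix (Fin k → Fin d) (Fin k → Fin d) ℂ) : Tens d k →L[ℂ] Tens d k :=
  Matrix.toEuclideanCLM (n := Fin k → Fin d) (𝕜 := ℂ) M

/-- Admissible sequences: `X_1` is invertible, `X_k ≥ 0` for all `k ≥ 1`, and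
`limsup ‖X_k‖^{1/k} < ∞` (operator norms, the limsup taken in `[0,∞]`). -/
structure Admissible {d : ℕ} (X : WeightSeq d) : Prop where
  isUnit_one : IsUnit (X 1)
  posSemidef : ∀ k, 1 ≤ k → (X k).PosSemidef
  limsup_lt : Filter.limsup (fun k : ℕ => ‖wop (X k)‖ₑ ^ (1 / (k : ℝ))) Filter.atTop < ⊤

/-- The matrix of `R_k² = ∑_{l} ∑_{k_1+⋯+k_l = k, k_i ≥ 1} X_{k_1} ⊗ ⋯ ⊗ X_{k_l}`.  The sum runs over
all compositions `c` of `k`; the `(α, β)` entry of `X_{k_1} ⊗ ⋯ ⊗ X_{k_l}` is the product of the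
entries of the `X_{k_i}` at the `i`-th blocks of `α` and `β`.  For `k = 0` this is the identity
of `ℂ` (the empty composition). -/
def Rsq {d : ℕ} (X : WeightSeq d) (k : ℕ) : Matrix (Fin k → Fin d) (Fin k → Fin d) ℂ :=
  Matrix.of fun α β => ∑ c : Composition k, ∏ i : Fin c.length,
    X (c.blocksFun i) (α ∘ c.embedding i) (β ∘ c.embedding i)

/-- The positive square root `R_k`. -/
def R {d : ℕ} (X : WeightSeq d) (k : ℕ) : Tens d k →L[ℂ] Tens d k := CFC.sqrt (wop (Rsq X k))

/-- The symmetric tensors `(ℂ^d)^{Ⓢk}`. -/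
def symTens (d k : ℕ) : Submodule ℂ (Tens d k) where
  carrier := {v | ∀ (σ : Equiv.Perm (Fin k)) (α : Fin k → Fin d), v (α ∘ σ) = v α}
  add_mem' hv hw σ α := by simp [hv σ α, hw σ α]
  zero_mem' σ α := rfl
  smul_mem' c v hv σ α := by simp [hv σ α]

/-! ### The weighted Drury-Arveson space and its weighted shifts -/

/-- The full Fock space `⊕_{k ≥ 0} (ℂ^d)^{⊗k}` (Hilbert space direct sum). -/
abbrev Fock (d : ℕ) := lp (fun k => Tens d k) 2

/-- The weighted Drury-Arveson space `F(R) = ⊕_{k ≥ 0} R_k (ℂ^d)^{Ⓢk}`, a closed subspace of the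
full Fock space. -/
def FR {d : ℕ} (X : WeightSeq d) : Submodule ℂ (Fock d) where
  carrier := {ξ | ∀ k, ξ k ∈ (symTens d k).map (R X k).toLinearMap}
  add_mem' hv hw k := Submodule.add_mem _ (hv k) (hw k)
  zero_mem' _ := Submodule.zero_mem _
  smul_mem' c _ hv k := Submodule.smul_mem _ c (hv k)

theorem isClosed_FR {d : ℕ} (X : WeightSeq d) : IsClosed (FR X : Set (Fock d)) := by
  have : (FR X : Set (Fock d)) =
      ⋂ k, (fun ξ : Fock d => ξ k) ⁻¹' ((symTens d k).map (R X k).toLinearMap : Set (Tens d k)) := by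
    ext ξ; simp [FR]
  rw [this]
  refine isClosed_iInter fun k => IsClosed.preimage ?_ (Submodule.closed_of_finiteDimensional _)
  exact (lp.evalCLM ℂ (fun k => Tens d k) 2 k).continuous

instance {d : ℕ} (X : WeightSeq d) : CompleteSpace (FR X) := (isClosed_FR X).completeSpace_coe

/-- `θ ↦ e_i ⊗ θ`. -/
def creation {d k : ℕ} (i : Fin d) (θ : Tens d k) : Tens d (k + 1) :=
  WithLp.toLp 2 fun α => if α 0 = i then θ (Fin.tail α) else 0

/-- `I_{ℂ^d} ⊗ A` on `(ℂ^d)^{⊗(k+1)} = ℂ^d ⊗ (ℂ^d)^{⊗k}`. -/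
def idTensor {d k : ℕ} (A : Tens d k →L[ℂ] Tens d k) : Tens d (k + 1) →L[ℂ] Tens d (k + 1) :=
  LinearMap.toContinuousLinearMap
    { toFun := fun v => WithLp.toLp 2 fun α =>
        A (WithLp.toLp 2 fun β => v (Fin.cons (α 0) β)) (Fin.tail α)
      map_add' := fun v w => by
        ext α
        exact congrArg (fun u : Tens d k => u (Fin.tail α)) (A.map_add
          (WithLp.toLp 2 fun β => v (Fin.cons (α 0) β)) (WithLp.toLp 2 fun β => w (Fin.cons (α 0) β)))
      map_smul' := fun c v => by
        ext α
        exact congrArg (fun u : Tens d k => u (Fin.tail α)) (A.map_smul c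
          (WithLp.toLp 2 fun β => v (Fin.cons (α 0) β))) }

/-- The weight `Z_{k+1} = R_{k+1}⁻¹ (I_{ℂ^d} ⊗ R_k)`. -/
def weightZ {d : ℕ} (X : WeightSeq d) (k : ℕ) : Tens d (k + 1) →L[ℂ] Tens d (k + 1) :=
  Ring.inverse (R X (k + 1)) * idTensor (R X k)

/-- `V` is the weighted shift on the full Fock space with `V θ = Z_{k+1} (e_i ⊗ θ)` for
`θ ∈ (ℂ^d)^{⊗k}`. -/
def IsShift {d : ℕ} (X : WeightSeq d) (i : Fin d) (V : Fock d →L[ℂ] Fock d) : Prop :=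
  ∀ ξ : Fock d, V ξ 0 = 0 ∧ ∀ k, V ξ (k + 1) = weightZ X k (creation i (ξ k))

open Classical in
/-- The weighted shift on the full Fock space as a bounded operator (there is at most one operator
satisfying `IsShift X i`). -/
def shift {d : ℕ} (X : WeightSeq d) (i : Fin d) : Fock d →L[ℂ] Fock d :=
  if h : ∃ V, IsShift X i V then h.choose else 0

/-- The weighted shift `W_i` on `F(R)`: the compression of the weighted shift on the full Fock space
to `F(R)`. -/
def W {d : ℕ} (X : WeightSeq d) (i : Fin d) : FR X →L[ℂ] FR X :=
  (FR X).orthogonalProjectionOnto ∘L shift X i ∘L (FR X).subtypeL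

/-- The Hilbert space tensor product `F ⊗ H`. -/
abbrev HTensor (F H : Type*) [NormedAddCommGroup F] [InnerProductSpace ℂ F]
    [NormedAddCommGroup H] [InnerProductSpace ℂ H] := UniformSpace.Completion (F ⊗[ℂ] H)

/-- The operator `A ⊗ B` on the Hilbert space tensor product. -/
def hmap {F H : Type*} [NormedAddCommGroup F] [InnerProductSpace ℂ F]
    [NormedAddCommGroup H] [InnerProductSpace ℂ H] (A : F →L[ℂ] F) (B : H →L[ℂ] H) :
    HTensor F H →L[ℂ] HTensor F H := (TensorProduct.mapL A B).completion

variable {H : Type*} [NormedAddCommGroup H] [InnerProductSpace ℂ H] [CompleteSpace H]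

/-! ### Commuting tuples and the domain -/

/-- `T_α = T_{α(1)} T_{α(2)} ⋯ T_{α(k)}`. -/
def wordProd {A : Type*} [Monoid A] {d k : ℕ} (T : Fin d → A) (α : Fin k → Fin d) : A :=
  (List.ofFn fun i => T (α i)).prod

/-- `V^{(k)} (M ⊗ a) U^{(k)*} = ∑_{|α| = |β| = k} m_{α,β} V_α a U_β^*`, where `V^{(k)}` is the row
`(V_α)_{|α| = k}`, an operator from `(ℂ^d)^{⊗k} ⊗ H` to `H`. -/
def sandwich {d : ℕ} (k : ℕ) (M : Matrix (Fin k → Fin d) (Fin k → Fin d) ℂ)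
    (V : Fin d → H →L[ℂ] H) (a : H →L[ℂ] H) (U : Fin d → H →L[ℂ] H) : H →L[ℂ] H :=
  ∑ α, ∑ β, M α β • (wordProd V α * a * star (wordProd U β))

/-- `∑_k A_k = P` in `B(H)`, with convergence of all matrix coefficients.  On bounded sets the weak
operator topology is the w*-topology, so for series with bounded partial sums (such as a series
of positive operators that converges in this sense) this is w*-convergence. -/
def HasWeakSum (A : ℕ → H →L[ℂ] H) (P : H →L[ℂ] H) : Prop :=
  ∀ x y : H, HasSum (fun k => inner ℂ x (A k y)) (inner ℂ x (P y))

variable (H) in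
/-- `D(X,H)`: the tuples `T` in `B(H)` for which `Φ_T(I) = ∑_{k ≥ 1} T^{(k)} (X_k ⊗ I) T^{(k)*}` is
w*-convergent with `‖Φ_T(I)‖ < 1`. -/
def D {d : ℕ} (X : WeightSeq d) : Set (Fin d → H →L[ℂ] H) :=
  {T | ∃ P : H →L[ℂ] H,
    HasWeakSum (fun k => sandwich (k + 1) (X (k + 1)) T 1 T) P ∧ ‖P‖ < 1}

variable (H) in
/-- `D_c(X,H)`: the commuting tuples in `D(X,H)`. -/
def Dc {d : ℕ} (X : WeightSeq d) : Set (Fin d → H →L[ℂ] H) :=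
  {T | T ∈ D H X ∧ ∀ i j, T i * T j = T j * T i}

/-! ### Completely positive map-valued kernels -/

theorem posSemidef_of_fin {R X : Type*} [Ring R] [PartialOrder R] [StarRing R]
    (M : Matrix X X R)
    (h : ∀ (n : ℕ) (e : Fin n → X), (M.submatrix e e).PosSemidef) : M.PosSemidef := by
  refine ⟨?_, fun f => ?_⟩
  · ext p q
    exact (h 2 ![p, q]).1.apply 0 1
  · classical
    set e : Fin f.support.card → X := fun i => (f.support.equivFin.symm i : X) with he
    have key := (h _ e).2 (Finsupp.equivFunOnFinite.symm fun i => f (e i))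
    simp only [Finsupp.sum_fintype, Matrix.submatrix_apply, star_zero, zero_mul, mul_zero,
      implies_true, Finsupp.equivFunOnFinite_symm_apply_apply, Finset.sum_const_zero] at key
    refine key.trans_eq ?_
    simp only [Finsupp.sum]
    have hs : ∀ g : X → R, ∑ i, g (e i) = ∑ x ∈ f.support, g x := fun g => by
      rw [← Finset.sum_coe_sort f.support]
      exact Fintype.sum_equiv f.support.equivFin.symm _ _ (fun i => rfl)
    rw [← hs]
    refine Finset.sum_congr rfl fun i _ => ?_
    rw [← hs]

theorem posSemidef_iff {X : Type*} {M : Matrix X X (H →L[ℂ] H)} :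
    M.PosSemidef ↔ M.IsHermitian ∧ ∀ v : X →₀ H,
      0 ≤ RCLike.re (v.sum fun x w => v.sum fun x' w' => inner ℂ (M x' x w) w') :=
  RKHS.posSemidef_tfae.out 0 2

/-- Normality (w*-continuity) of a bounded linear map `φ` on `B(H)`: the composition of `φ` with every
vector functional `⟨x, · y⟩` is a normal functional, that is, of the form
`a ↦ ∑_n ⟨ξ_n, a η_n⟩` with square summable `ξ`, `η`. -/
def IsNormalMap (φ : (H →L[ℂ] H) →L[ℂ] (H →L[ℂ] H)) : Prop :=
  ∀ x y : H, ∃ ξ η : ℕ → H, Summable (fun n => ‖ξ n‖ ^ 2) ∧ Summable (fun n => ‖η n‖ ^ 2) ∧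
    ∀ a : H →L[ℂ] H, HasSum (fun n => inner ℂ (ξ n) (a (η n))) (inner ℂ x (φ a y))

/-- A completely positive kernel `K : S × S → B_*(B(H), B(H))` with values in the normal bounded linear
maps: for all points `z_1, …, z_n` the map `(a_{ij}) ↦ (K(z_i, z_j)(a_{ij}))` on `M_n(B(H))` is
completely positive, that is, its amplifications to `M_m(M_n(B(H)))` preserve positivity.  (A matrix
over `B(H)` is positive if `∑ b_p^* A_{pq} b_q ≥ 0` for all `b_p ∈ B(H)`.) -/
structure CPKernel (S H : Type*) [NormedAddCommGroup H] [InnerProductSpace ℂ H]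
    [CompleteSpace H] where
  toFun : S → S → (H →L[ℂ] H) →L[ℂ] (H →L[ℂ] H)
  normal : ∀ z w, IsNormalMap (toFun z w)
  cp : ∀ (n : ℕ) (z : Fin n → S) (m : ℕ)
    (A : Matrix (Fin m × Fin n) (Fin m × Fin n) (H →L[ℂ] H)), A.PosSemidef →
    (Matrix.of fun p q => toFun (z p.2) (z q.2) (A p q)).PosSemidef

namespace CPKernel
variable {S : Type*} (K : CPKernel S H)

/-! ### The reproducing kernel correspondence

The kernel functions `k_{(a,w)}(z)(b) = K(z,w)(b a^*)` and the inner products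
`⟨k_{(b,z)} c, k_{(a,w)} d⟩ = c^* K(z,w)(b a^*) d` define a pre-Hilbert module `E_0` over `B(H)`, and
`E_K` is the W*-module that it generates (its self-dual completion).  The Hilbert space
`G = E_0 ⊗_{B(H)} H` is the reproducing kernel Hilbert space of `H`-valued functions on `S × B(H)` with
kernel `((z,b),(w,a)) ↦ K(z,w)(b a^*)`; the kernel function `k_{(a,w)}` acts as an operator
`H → G`, and the W*-module over `B(H)` generated by these operators, that is the strongly closed
`B(H)`-submodule of `B(H,G)` generated by them, is all of `B(H,G)`, because their ranges span a dense
subspace of `G`.  An element `x` of it is identified with the function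
`z ↦ (b ↦ ⟨k_{(b,z)}, x⟩ = k_{(b,z)}^* x)` on `S`. -/

/-- The `B(H)`-valued scalar kernel `((z,b),(w,a)) ↦ K(z,w)(b a^*)`. -/
def gram : Matrix (S × (H →L[ℂ] H)) (S × (H →L[ℂ] H)) (H →L[ℂ] H) :=
  Matrix.of fun p q => K.toFun p.1 q.1 (p.2 * star q.2)

theorem posSemidef_mid (D : H →L[ℂ] H) (hD : 0 ≤ D) :
    (Matrix.of fun p q : S × (H →L[ℂ] H) =>
      K.toFun p.1 q.1 (p.2 * D * star q.2)).PosSemidef := by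
  refine posSemidef_of_fin _ fun n e => ?_
  let C : Matrix (Fin 1 × Fin n) Unit (H →L[ℂ] H) := Matrix.of fun p _ => (e p.2).2
  have hA : (C * (Matrix.of fun _ _ : Unit => D) * C.conjTranspose).PosSemidef := by
    refine Matrix.PosSemidef.mul_mul_conjTranspose_same ?_ C
    have : (Matrix.of fun _ _ : Unit => D) = Matrix.diagonal fun _ => D := by
      ext i j; simp
    rw [this]
    exact Matrix.PosSemidef.diagonal (fun _ => hD)
  have := (K.cp n (fun i => (e i).1) 1 _ hA).submatrix (fun i : Fin n => ((0 : Fin 1), i))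
  convert this using 1
  ext i j : 2
  simp [C, Matrix.mul_apply]

theorem gram_posSemidef : K.gram.PosSemidef := by
  simpa [gram] using K.posSemidef_mid 1 zero_le_one

instance : Fact K.gram.PosSemidef := ⟨K.gram_posSemidef⟩

/-- The reproducing kernel Hilbert space `G` of `H`-valued functions on `S × B(H)`. -/
abbrev Space := RKHS.OfKernel K.gram


theorem kerFun_adjoint_comp (p q : S × (H →L[ℂ] H)) :
    (RKHS.kerFun K.Space p).adjoint ∘L RKHS.kerFun K.Space q = K.toFun p.1 q.1 (p.2 * star q.2) := by
  rw [← RKHS.kernel_apply, RKHS.OfKernel.kernel_ofKernel]; rfl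

/-- The function `f(z)(b) = k_{(b,z)}^* x` represented by `x ∈ B(H,G)`. -/
def evalLM : (H →L[ℂ] K.Space) →ₗ[ℂ] (S → (H →L[ℂ] H) → (H →L[ℂ] H)) where
  toFun x := fun z b => (RKHS.kerFun K.Space (z, b)).adjoint ∘L x
  map_add' x y := by ext; simp
  map_smul' c x := by ext; simp

theorem evalLM_apply (x : H →L[ℂ] K.Space) (z : S) (b : H →L[ℂ] H) (h : H) :
    K.evalLM x z b h = (x h : K.Space) (z, b) := by simp [evalLM]

theorem evalLM_injective : Function.Injective K.evalLM := fun x y hxy => by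
  refine ContinuousLinearMap.ext fun h => RKHS.ext (H := K.Space) fun p => ?_
  rw [← evalLM_apply, ← evalLM_apply, hxy]

/-- The reproducing kernel W*-correspondence `E_K`, a space of functions `f : S → (B(H) → B(H))`. -/
def Corr : Submodule ℂ (S → (H →L[ℂ] H) → (H →L[ℂ] H)) := LinearMap.range K.evalLM

/-- The operator `H → G` that represents an element of `E_K`. -/
def toOp : K.Corr ≃ₗ[ℂ] (H →L[ℂ] K.Space) :=
  (LinearEquiv.ofInjective K.evalLM K.evalLM_injective).symm

theorem evalLM_toOp (f : K.Corr) : K.evalLM (K.toOp f) = (f : S → (H →L[ℂ] H) → (H →L[ℂ] H)) :=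
  congrArg Subtype.val ((LinearEquiv.ofInjective K.evalLM K.evalLM_injective).apply_symm_apply f)

/-- The `B(H)`-valued inner product of `E_K`. -/
def corrInner (f g : K.Corr) : H →L[ℂ] H := (K.toOp f).adjoint ∘L K.toOp g

/-- The right action of `B(H)` on `E_K`, `(f · c)(z)(b) = f(z)(b) c`. -/
def rsmul (f : K.Corr) (c : H →L[ℂ] H) : K.Corr :=
  ⟨fun z b => f.1 z b * c, by
    refine ⟨K.toOp f ∘L c, ?_⟩
    have := K.evalLM_toOp f
    rw [← this]; ext z b h; simp [evalLM_apply]⟩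

/-- The kernel function `k_{(a,w)} ∈ E_K`, `k_{(a,w)}(z)(b) = K(z,w)(b a^*)`. -/
def kerElt (a : H →L[ℂ] H) (w : S) : K.Corr :=
  ⟨fun z b => K.toFun z w (b * star a), RKHS.kerFun K.Space (w, a), by
    funext z b
    exact K.kerFun_adjoint_comp (z, b) (w, a)⟩

theorem toOp_kerElt (a : H →L[ℂ] H) (w : S) : K.toOp (K.kerElt a w) = RKHS.kerFun K.Space (w, a) := by
  apply K.evalLM_injective
  rw [evalLM_toOp]
  funext z b
  exact (K.kerFun_adjoint_comp (z, b) (w, a)).symm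

/-- The reproducing property `⟨k_{(a,z)}, f⟩ = f(z)(a)`. -/
theorem reproducing (a : H →L[ℂ] H) (z : S) (f : K.Corr) :
    K.corrInner (K.kerElt a z) f = f.1 z a := by
  rw [corrInner, toOp_kerElt, ← evalLM_toOp]; rfl

theorem exists_leftOp (b : H →L[ℂ] H) : ∃ L : K.Space →L[ℂ] K.Space,
    ∀ (ξ : K.Space) (z : S) (c : H →L[ℂ] H), L ξ (z, c) = ξ (z, c * b) := by
  classical
  let e : (S × (H →L[ℂ] H) →₀ H) →ₗ[ℂ] K.Space :=
    Finsupp.lsum ℂ fun p => (RKHS.kerFun K.Space p).toLinearMap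
  let f : (S × (H →L[ℂ] H) →₀ H) →ₗ[ℂ] K.Space :=
    Finsupp.lsum ℂ fun p => (RKHS.kerFun K.Space (p.1, p.2 * b)).toLinearMap
  have hker' : ∀ (p q : S × (H →L[ℂ] H)) (u v : H),
      inner ℂ (RKHS.kerFun K.Space p u) (RKHS.kerFun K.Space q v) =
        inner ℂ (K.toFun q.1 p.1 (q.2 * star p.2) u) v := fun p q u v => by
    rw [← K.kerFun_adjoint_comp, ContinuousLinearMap.comp_apply,
      ContinuousLinearMap.adjoint_inner_left]
  have hdense : DenseRange e := by
    have h := RKHS.kerFun_dense (H := K.Space)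
    have hsub : Submodule.span ℂ {RKHS.kerFun K.Space x v | (x) (v)} ≤ LinearMap.range e := by
      rw [Submodule.span_le]
      rintro _ ⟨x, v, rfl⟩
      exact ⟨Finsupp.single x v, by simp [e]⟩
    intro ξ
    have : ξ ∈ (Submodule.span ℂ {RKHS.kerFun K.Space x v | (x) (v)}).topologicalClosure := by
      rw [h]; trivial
    exact closure_mono hsub this
  have hnorm : ∃ C, ∀ v, ‖f v‖ ≤ C * ‖e v‖ := by
    refine ⟨‖b‖, fun v => ?_⟩
    have hD : 0 ≤ algebraMap ℝ (H →L[ℂ] H) (‖b‖ ^ 2) - b * star b := by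
      rw [sub_nonneg, ← CStarRing.norm_self_mul_star (x := b) |>.trans (pow_two _).symm]
      exact IsSelfAdjoint.le_algebraMap_norm_self (IsSelfAdjoint.mul_star_self b)
    have hpos := (posSemidef_iff.mp (K.posSemidef_mid _ hD)).2 v
    have he : ‖e v‖ ^ 2 = RCLike.re (v.sum fun x w => v.sum fun x' w' =>
        inner ℂ (K.toFun x'.1 x.1 (x'.2 * star x.2) w) w') := by
      rw [← inner_self_eq_norm_sq (𝕜 := ℂ)]
      simp only [e, Finsupp.lsum_apply, Finsupp.sum_inner, Finsupp.inner_sum]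
      simp only [ContinuousLinearMap.coe_coe, ← hker']
      rw [Finsupp.sum_comm]
    have hf : ‖f v‖ ^ 2 = RCLike.re (v.sum fun x w => v.sum fun x' w' =>
        inner ℂ (K.toFun x'.1 x.1 (x'.2 * (b * star b) * star x.2) w) w') := by
      rw [← inner_self_eq_norm_sq (𝕜 := ℂ)]
      simp only [f, Finsupp.lsum_apply, Finsupp.sum_inner, Finsupp.inner_sum]
      simp only [ContinuousLinearMap.coe_coe, hker', star_mul, mul_assoc]
      rw [Finsupp.sum_comm]
    have hsum : RCLike.re (v.sum fun x w => v.sum fun x' w' => inner ℂ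
        (K.toFun x'.1 x.1 (x'.2 * (algebraMap ℝ (H →L[ℂ] H) (‖b‖ ^ 2) - b * star b) *
          star x.2) w) w') = ‖b‖ ^ 2 * ‖e v‖ ^ 2 - ‖f v‖ ^ 2 := by
      rw [he, hf]
      have hexp : ∀ (x x' : S × (H →L[ℂ] H)) (w w' : H), inner ℂ
          (K.toFun x'.1 x.1 (x'.2 * (algebraMap ℝ (H →L[ℂ] H) (‖b‖ ^ 2) - b * star b) *
            star x.2) w) w' = ((‖b‖ ^ 2 : ℝ) : ℂ) *
            inner ℂ (K.toFun x'.1 x.1 (x'.2 * star x.2) w) w' -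
            inner ℂ (K.toFun x'.1 x.1 (x'.2 * (b * star b) * star x.2) w) w' := by
        intro x x' w w'
        have : x'.2 * (algebraMap ℝ (H →L[ℂ] H) (‖b‖ ^ 2) - b * star b) * star x.2 =
            ((‖b‖ ^ 2 : ℝ) : ℂ) • (x'.2 * star x.2) - x'.2 * (b * star b) * star x.2 := by
          ext u
          simp [Algebra.algebraMap_eq_smul_one, mul_sub, sub_mul, ← Complex.coe_smul]
        rw [this, map_sub, map_smul, _root_.sub_apply, inner_sub_left,
          _root_.smul_apply, inner_smul_left, Complex.conj_ofReal]
      simp only [hexp, Finsupp.sum, Finset.sum_sub_distrib, ← Finset.mul_sum, map_sub]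
      congr 1
      exact Complex.re_ofReal_mul _ _
    have : ‖f v‖ ^ 2 ≤ (‖b‖ * ‖e v‖) ^ 2 := by
      rw [mul_pow, ← sub_nonneg, ← hsum]; exact hpos
    exact le_of_sq_le_sq this (by positivity)
  let M := f.extendOfNorm e
  have hM : ∀ v, M (e v) = f v := fun v => LinearMap.extendOfNorm_eq hdense hnorm v
  refine ⟨M.adjoint, fun ξ z c => ?_⟩
  refine ext_inner_left ℂ fun u => ?_
  rw [← RKHS.kerFun_inner, ContinuousLinearMap.adjoint_inner_right]
  have : RKHS.kerFun K.Space (z, c) u = e (Finsupp.single (z, c) u) := by simp [e]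
  rw [this, hM]
  simp [f]

/-- The left action `φ(b)` of `B(H)` on `E_K`, `(b · f)(z)(c) = f(z)(c b)`. -/
def leftMul (b : H →L[ℂ] H) : K.Corr →ₗ[ℂ] K.Corr where
  toFun f := ⟨fun z c => f.1 z (c * b), by
    obtain ⟨L, hL⟩ := K.exists_leftOp b
    refine ⟨L ∘L K.toOp f, ?_⟩
    rw [← K.evalLM_toOp f]
    ext z c h
    simp [evalLM_apply, hL]⟩
  map_add' f g := rfl
  map_smul' c f := rfl

/-! ### The interior tensor product with `H` -/

/-- The matrix of all inner products `⟨f, g⟩`, `f, g ∈ E_K`. -/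
def corrGram : Matrix K.Corr K.Corr (H →L[ℂ] H) := Matrix.of K.corrInner

theorem corrGram_posSemidef : K.corrGram.PosSemidef := by
  refine posSemidef_iff.mpr ⟨?_, fun v => ?_⟩
  · ext i j : 2
    simp [corrGram, corrInner, Matrix.conjTranspose_apply, ContinuousLinearMap.star_eq_adjoint,
      ContinuousLinearMap.adjoint_comp]
  · have : RCLike.re (inner ℂ (v.sum fun x w => K.toOp x w) (v.sum fun x w => K.toOp x w)) =
        RCLike.re (v.sum fun x w => v.sum fun x' w' => inner ℂ (K.corrGram x' x w) w') := by
      simp only [Finsupp.sum_inner, Finsupp.inner_sum]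
      rw [Finsupp.sum_comm]
      simp [corrGram, corrInner, ContinuousLinearMap.adjoint_inner_left]
    rw [← this]
    exact inner_self_nonneg

instance : Fact K.corrGram.PosSemidef := ⟨K.corrGram_posSemidef⟩

/-- The interior tensor product `E_K ⊗_{B(H)} H`: the Hausdorff completion of the vector space on the
symbols `f ⊗ h` for the semi-inner product `⟨f ⊗ h, g ⊗ k⟩ = ⟨h, ⟨f, g⟩ k⟩`.  (The relations of
bilinearity and `f c ⊗ h = f ⊗ c h` hold because their two sides differ by null vectors.) -/
abbrev Interior := RKHS.OfKernel K.corrGram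

/-- The elementary tensor `f ⊗ h`. -/
def tmul (f : K.Corr) (h : H) : K.Interior := RKHS.kerFun K.Interior f h

theorem inner_tmul (f g : K.Corr) (h k : H) :
    inner ℂ (K.tmul f h) (K.tmul g k) = inner ℂ h (K.corrInner f g k) := by
  rw [tmul, tmul, ← ContinuousLinearMap.adjoint_inner_right, ← ContinuousLinearMap.comp_apply,
    ← RKHS.kernel_apply, RKHS.OfKernel.kernel_ofKernel]; rfl

/-- The operator `A` on `E_K ⊗_{B(H)} H` is `T ⊗ I_H`.  (As the elementary tensors span a dense
subspace, there is at most one such `A`.) -/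
def IsAmplification (T : K.Corr →ₗ[ℂ] K.Corr) (A : K.Interior →L[ℂ] K.Interior) : Prop :=
  ∀ f h, A (K.tmul f h) = K.tmul (T f) h

/-! ### Adjointable operators and multipliers -/

/-- The algebra `L(E_K)` of adjointable operators on `E_K`; an operator is recorded with its
(unique) adjoint. -/
structure AdjOp where
  toLM : K.Corr →ₗ[ℂ] K.Corr
  adj : K.Corr →ₗ[ℂ] K.Corr
  adjoint_eq : ∀ f g, K.corrInner (toLM f) g = K.corrInner f (adj g)

theorem star_corrInner (f g : K.Corr) : star (K.corrInner f g) = K.corrInner g f := by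
  simp [corrInner, ContinuousLinearMap.star_eq_adjoint, ContinuousLinearMap.adjoint_comp]

instance : Monoid K.AdjOp where
  mul S T := ⟨S.toLM ∘ₗ T.toLM, T.adj ∘ₗ S.adj, fun f g => by
    simp [S.adjoint_eq, T.adjoint_eq]⟩
  one := ⟨LinearMap.id, LinearMap.id, fun _ _ => rfl⟩
  mul_assoc _ _ _ := rfl
  one_mul _ := rfl
  mul_one _ := rfl

instance : Star K.AdjOp where
  star T := ⟨T.adj, T.toLM, fun f g => by
    rw [← K.star_corrInner, ← T.adjoint_eq, K.star_corrInner]⟩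

/-- `φ : S → B(H)` is a multiplier of `E_K`: for each `f ∈ E_K` the function `φ f`,
`(φ f)(z)(b) = φ(z) f(z)(b)`, lies in `E_K`. -/
def IsMultiplier (φ : S → H →L[ℂ] H) : Prop :=
  ∀ f ∈ K.Corr, (fun z b => φ z * f z b) ∈ K.Corr

/-- The multiplication operator `M_φ f = φ f` on `E_K` of a multiplier `φ`. -/
def multOp {φ : S → H →L[ℂ] H} (hφ : K.IsMultiplier φ) : K.Corr →ₗ[ℂ] K.Corr where
  toFun f := ⟨fun z b => φ z * f.1 z b, hφ f.1 f.2⟩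
  map_add' f g := by
    ext z b : 3
    exact mul_add _ _ _
  map_smul' c f := by
    ext z b : 3
    exact mul_smul_comm c (φ z) (f.1 z b)

end CPKernel
/-! ### The kernel `K^R_c` and contractivity -/

/-- `K` is the kernel `K^R_c` on `D_c(X,H)`:
`K(V,U)(a) = ∑_{k ≥ 0} V^{(k)} (R_k² ⊗ a) U^{(k)*}`. -/
def IsKRc {d : ℕ} (X : WeightSeq d) (K : CPKernel (Dc H X) H) : Prop :=
  ∀ (V U : Dc H X) (a : H →L[ℂ] H),
    HasWeakSum (fun k => sandwich k (Rsq X k) V.1 a U.1) (K.toFun V U a)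

/-- The coordinate function `S_i(T) = T_i` on `D_c(X,H)`. -/
def coord {d : ℕ} (X : WeightSeq d) (i : Fin d) : Dc H X → H →L[ℂ] H := fun T => T.1 i

/-- `E_K` is an `(X,H)`-contractive reproducing kernel correspondence: the coordinate functions `S_i`
are bounded (that is, adjointable) multipliers and `∑_{k ≥ 1} M_S^{(k)} (X_k ⊗ I) M_S^{(k)*} ≤ I`.
The sum of the positive operators `∑_{|α| = |β| = k} x_{α,β} M_α M_β^*` converges to `P` in the
w*-topology of `L(E_K)`, and `P ≤ I` in `L(E_K)`. -/
def IsXHContractive {d : ℕ} (X : WeightSeq d) (K : CPKernel (Dc H X) H) : Prop :=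
  ∃ hS : ∀ i, K.IsMultiplier (coord X i), ∃ M : Fin d → K.AdjOp,
    (∀ i, (M i).toLM = K.multOp (hS i)) ∧
    ∃ P : K.AdjOp,
      (∀ (f g : K.Corr) (h h' : H),
        HasSum (fun k : ℕ => ∑ α, ∑ β, X (k + 1) α β *
            inner ℂ h (K.corrInner f ((wordProd M α * star (wordProd M β)).toLM g) h'))
          (inner ℂ h (K.corrInner f (P.toLM g) h'))) ∧
      ∀ f : K.Corr, K.corrInner f (P.toLM f) ≤ K.corrInner f f

end

end RKC

open RKC

namespace RKC

noncomputable section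

/-! Everything rests on one recursion. Splitting off the first block of a composition gives
$R_{k+1}^2=\sum_{j+m=k}X_{j+1}\otimes R_m^2$ (`sum_Rsq_succ_smul`). It is used four times. By
induction it makes $R_k^2$ positive. Its $j=0$ term, with $X_1$ invertible, makes $R_k$ invertible
and the weighted shifts bounded (`exists_norm_annihilate_le`). Read on a tuple $T$ it is the renewal
equation behind $\sum_k T^{(k)}(R_k^2\otimes I)T^{(k)*}\le(1-\|\Phi_T(I)\|)^{-1}I$
(`exists_sum_sandwich_le`). Read on $F(R)$ it gives $\sum_k W^{(k)}(X_k\otimes I)W^{(k)*}=I-P_0$,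
with $P_0$ the vacuum projection (`hasSum_inner_rowOp`).

The bound produces column operators $L_U:H\to F(R)\otimes H$ (`colOp`), $L_Uh=\bigoplus_k\sum_\alpha
R_ke_\alpha\otimes U_\alpha^*h$ with $e_\alpha$ symmetrized. Symmetrizing loses nothing because $U$
commutes. Then $K(V,U)(a)=L_V^*(I\otimes a)L_U$ is a Kolmogorov decomposition of the kernel:
convergence and complete positivity follow, and factoring each $R_k^2$ into rank one pieces gives
normality.

Consequently $k_{(b,z)}h\mapsto(I\otimes b^*)L_zh$ preserves inner products from the reproducing
kernel Hilbert space $G$ to $F(R)\otimes H$. It is onto because the ranges of the $L_U$ are total,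
already for small scalar tuples (`eq_zero_of_inner_colOp`). Since $E_K$ is $B(H,G)$, the interior
tensor product with $H$ is $G$, and $\Lambda$ is the composite unitary.

The adjoint of $W_i$ sends $R_{n+1}\theta$ to $R_n$ of $\theta$ with a leading letter $i$ removed,
so $(W_i^*\otimes I)L_U=L_UU_i^*$ (`hmap_star_colOp`). This says that $W_i\otimes I$ becomes
multiplication by the coordinate $S_i$. Contractivity is then transported from $I-P_0$.

The arguments after the recursion use $F(R)$ only through its homogeneous components and $W$ only
through the removal of letters. `HomogSystem` and `IsShiftTuple` isolate these properties. -/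

/-! ### The recursion for `R_k²` -/

/-- The word of the first `j` letters of an infinite word. -/
def wordTake {d : ℕ} (j : ℕ) (ω : ℕ → Fin d) : Fin j → Fin d := fun i => ω i

/-- The infinite word without its first `j` letters. -/
def wordDrop {d : ℕ} (j : ℕ) (ω : ℕ → Fin d) : ℕ → Fin d := fun i => ω (j + i)

/-- The entry of `X_{k_1} ⊗ ⋯ ⊗ X_{k_l}` at the initial segments of two infinite words. -/
def blockProd {d : ℕ} (X : WeightSeq d) : List ℕ → (ℕ → Fin d) → (ℕ → Fin d) → ℂ
  | [], _, _ => 1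
  | b :: bs, ω, ω' =>
    X b (wordTake b ω) (wordTake b ω') * blockProd X bs (wordDrop b ω) (wordDrop b ω')

theorem blockProd_eq_prod {d : ℕ} (X : WeightSeq d) (bs : List ℕ) (ω ω' : ℕ → Fin d) :
    blockProd X bs ω ω' = ∏ i : Fin bs.length, X (bs.get i)
      (wordTake _ (wordDrop (bs.take i).sum ω)) (wordTake _ (wordDrop (bs.take i).sum ω')) := by
  induction bs generalizing ω ω' with
  | nil => simp [blockProd]
  | cons b bs ih =>
    rw [blockProd, ih]
    refine Eq.symm ((Fin.prod_univ_succ _).trans ?_)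
    congr 1
    · simp only [Fin.val_zero, List.take_zero, List.sum_nil]
      rw [show ∀ ω : ℕ → Fin d, wordDrop 0 ω = ω from fun ω => by funext i; simp [wordDrop]]
      rw [show ∀ ω : ℕ → Fin d, wordDrop 0 ω = ω from fun ω => by funext i; simp [wordDrop]]
      rfl
    · refine Finset.prod_congr rfl fun i _ => ?_
      have h : ∀ (a : ℕ) (ω : ℕ → Fin d), wordDrop a (wordDrop b ω) = wordDrop (b + a) ω :=
        fun a ω => by funext i; simp [wordDrop, add_assoc]
      simp [h]

/-- In an infinite word each block is read off after dropping the letters before it, so blocks can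
be peeled off without casts between word lengths. -/
theorem Rsq_wordTake {d : ℕ} (X : WeightSeq d) (k : ℕ) (ω ω' : ℕ → Fin d) :
    Rsq X k (wordTake k ω) (wordTake k ω') = ∑ c : Composition k, blockProd X c.blocks ω ω' := by
  rw [Rsq, Matrix.of_apply]
  refine Finset.sum_congr rfl fun c _ => ?_
  rw [blockProd_eq_prod]
  -- The $i$-th block of a composition starts at `sizeUpTo i`, which is by definition the sum of the
  -- first $i$ entries of `blocks`.
  rfl

/-- A composition of $k+1$ is a first block followed by a composition of the rest. The first block
is written $p_1+1$ because blocks are positive, which leaves pairs with $p_1+p_2=k$. -/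
theorem sum_composition_succ {M : Type*} [AddCommMonoid M] (k : ℕ) (f : List ℕ → M) :
    ∑ c : Composition (k + 1), f c.blocks =
      ∑ p ∈ Finset.HasAntidiagonal.antidiagonal k, ∑ c : Composition p.2, f ((p.1 + 1) :: c.blocks) := by
  rw [Finset.sum_sigma']
  symm
  refine Finset.sum_bij (fun q hq => ⟨(q.1.1 + 1) :: q.2.blocks, ?_, ?_⟩) ?_ ?_ ?_ ?_
  · intro i hi
    rcases List.mem_cons.1 hi with rfl | hi
    · exact Nat.succ_pos _
    · exact q.2.blocks_pos hi
  · have := Finset.HasAntidiagonal.mem_antidiagonal.1 (Finset.mem_sigma.1 hq).1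
    simp only [List.sum_cons, q.2.blocks_sum]
    omega
  · intro q hq
    exact Finset.mem_univ _
  · rintro ⟨⟨a, m⟩, c⟩ _ ⟨⟨a', m'⟩, c'⟩ _ h
    have h1 : (a + 1) :: c.blocks = (a' + 1) :: c'.blocks := congrArg Composition.blocks h
    obtain ⟨h2, h3⟩ := List.cons.inj h1
    obtain rfl : a = a' := by omega
    have hm : m = m' := c.blocks_sum.symm.trans ((congrArg List.sum h3).trans c'.blocks_sum)
    subst hm
    obtain rfl : c = c' := Composition.ext h3
    rfl
  · rintro ⟨bs, hpos, hsum⟩ _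
    rcases bs with _ | ⟨b, bs⟩
    · simp at hsum
    · have hb : 0 < b := hpos (by simp)
      refine ⟨⟨⟨b - 1, bs.sum⟩, ⟨bs, fun hi => hpos (List.mem_cons_of_mem _ hi), rfl⟩⟩, ?_, ?_⟩
      · simp only [List.sum_cons] at hsum
        simp only [Finset.mem_sigma, Finset.HasAntidiagonal.mem_antidiagonal, Finset.mem_univ, and_true]
        omega
      · ext1
        simp only [List.cons.injEq, and_true]
        omega
  · intro q hq
    rfl

theorem Rsq_succ_wordTake {d : ℕ} (X : WeightSeq d) (k : ℕ) (ω ω' : ℕ → Fin d) :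
    Rsq X (k + 1) (wordTake _ ω) (wordTake _ ω') = ∑ p ∈ Finset.HasAntidiagonal.antidiagonal k,
      X (p.1 + 1) (wordTake _ ω) (wordTake _ ω') *
        Rsq X p.2 (wordTake _ (wordDrop (p.1 + 1) ω)) (wordTake _ (wordDrop (p.1 + 1) ω')) := by
  rw [Rsq_wordTake, sum_composition_succ k fun l => blockProd X l ω ω']
  simp only [Rsq_wordTake, Finset.mul_sum]
  rfl

/-- An infinite word with a given nonempty initial segment. -/
def wordExt {d n : ℕ} (hn : 0 < n) (α : Fin n → Fin d) : ℕ → Fin d := fun i =>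
  if h : i < n then α ⟨i, h⟩ else α ⟨0, hn⟩

theorem wordTake_wordExt {d n : ℕ} (hn : 0 < n) (α : Fin n → Fin d) :
    wordTake n (wordExt hn α) = α := by
  funext i
  simp [wordTake, wordExt]

theorem wordTake_wordExt_append {d j m : ℕ} (hn : 0 < j + m) (α : Fin j → Fin d)
    (β : Fin m → Fin d) : wordTake j (wordExt hn (Fin.append α β)) = α := by
  funext i
  have h : (i : ℕ) < j + m := by omega
  simp only [wordTake, wordExt, h, dif_pos]
  exact Fin.append_left α β i

theorem wordTake_wordDrop_wordExt_append {d j m : ℕ} (hn : 0 < j + m) (α : Fin j → Fin d)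
    (β : Fin m → Fin d) : wordTake m (wordDrop j (wordExt hn (Fin.append α β))) = β := by
  funext i
  have h : j + (i : ℕ) < j + m := by omega
  simp only [wordTake, wordDrop, wordExt, h, dif_pos]
  exact Fin.append_right α β i

/-- Concatenation is a bijection from pairs of words onto words of the total length. The whole word
is also passed as a list, whose type does not remember how the length was split. -/
theorem sum_words_split {d j m n : ℕ} (h : j + m = n) (hn : 0 < n) {M : Type*} [AddCommMonoid M]
    (f : (Fin j → Fin d) → (Fin m → Fin d) → List (Fin d) → M) :
    ∑ α : Fin n → Fin d, f (wordTake j (wordExt hn α)) (wordTake m (wordDrop j (wordExt hn α)))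
      (List.ofFn α) = ∑ α, ∑ γ, f α γ (List.ofFn α ++ List.ofFn γ) := by
  subst h
  rw [← Fintype.sum_prod_type']
  refine (Fintype.sum_equiv (Fin.appendEquiv j m) _ _ fun p => ?_).symm
  rw [show Fin.appendEquiv j m p = Fin.append p.1 p.2 from rfl, wordTake_wordExt_append, wordTake_wordDrop_wordExt_append,
    List.ofFn_fin_append]

/-- The recursion `R_{k+1}² = ∑_{j + m = k} X_{j+1} ⊗ R_m²`, tested on words. -/
theorem sum_Rsq_succ_smul {d : ℕ} (X : WeightSeq d) (k : ℕ) {M : Type*} [AddCommGroup M]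
    [Module ℂ M] (F : List (Fin d) → List (Fin d) → M) :
    ∑ α, ∑ β, Rsq X (k + 1) α β • F (List.ofFn α) (List.ofFn β) =
      ∑ p ∈ Finset.HasAntidiagonal.antidiagonal k, ∑ α, ∑ β, X (p.1 + 1) α β • ∑ γ, ∑ δ, Rsq X p.2 γ δ •
        F (List.ofFn α ++ List.ofFn γ) (List.ofFn β ++ List.ofFn δ) := by
  have key : ∀ α β : Fin (k + 1) → Fin d, Rsq X (k + 1) α β • F (List.ofFn α) (List.ofFn β) =
      ∑ p ∈ Finset.HasAntidiagonal.antidiagonal k, (X (p.1 + 1) (wordTake _ (wordExt k.succ_pos α))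
        (wordTake _ (wordExt k.succ_pos β)) *
        Rsq X p.2 (wordTake _ (wordDrop (p.1 + 1) (wordExt k.succ_pos α)))
          (wordTake _ (wordDrop (p.1 + 1) (wordExt k.succ_pos β)))) •
          F (List.ofFn α) (List.ofFn β) := fun α β => by
    rw [← Finset.sum_smul, ← Rsq_succ_wordTake, wordTake_wordExt, wordTake_wordExt]
  simp only [key]
  have hc : ∀ g : (Fin (k + 1) → Fin d) → (Fin (k + 1) → Fin d) → ℕ × ℕ → M,
      ∑ α, ∑ β, ∑ p ∈ Finset.HasAntidiagonal.antidiagonal k, g α β p =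
        ∑ p ∈ Finset.HasAntidiagonal.antidiagonal k, ∑ α, ∑ β, g α β p := fun g => by
    rw [Finset.sum_comm]
    simp_rw [Finset.sum_comm (s := Finset.univ) (t := Finset.HasAntidiagonal.antidiagonal k)]
    exact Finset.sum_congr rfl fun _ _ => Finset.sum_comm
  rw [hc]
  refine Finset.sum_congr rfl fun p hp => ?_
  have hp' : p.1 + 1 + p.2 = k + 1 := by
    have := Finset.HasAntidiagonal.mem_antidiagonal.1 hp
    omega
  rw [sum_words_split hp' k.succ_pos fun α γ l => ∑ β : Fin (k + 1) → Fin d,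
    (X (p.1 + 1) α (wordTake _ (wordExt k.succ_pos β)) * Rsq X p.2 γ
      (wordTake _ (wordDrop (p.1 + 1) (wordExt k.succ_pos β)))) • F l (List.ofFn β)]
  refine Finset.sum_congr rfl fun α _ => ?_
  have h2 : ∀ γ : Fin p.2 → Fin d, ∑ β : Fin (k + 1) → Fin d,
      (X (p.1 + 1) α (wordTake _ (wordExt k.succ_pos β)) * Rsq X p.2 γ
      (wordTake _ (wordDrop (p.1 + 1) (wordExt k.succ_pos β)))) •
        F (List.ofFn α ++ List.ofFn γ) (List.ofFn β) =
      ∑ β, ∑ δ, (X (p.1 + 1) α β * Rsq X p.2 γ δ) •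
        F (List.ofFn α ++ List.ofFn γ) (List.ofFn β ++ List.ofFn δ) := fun γ =>
    sum_words_split hp' k.succ_pos fun β δ l => (X (p.1 + 1) α β * Rsq X p.2 γ δ) •
        F (List.ofFn α ++ List.ofFn γ) l
  simp only [h2]
  rw [Finset.sum_comm]
  simp only [mul_smul, Finset.smul_sum]

/-! ### Removing initial letters from tensors -/

/-- The coordinate of a tensor at a word given as a list (zero if the length is wrong). -/
def coeff {d n : ℕ} (θ : Tens d n) (l : List (Fin d)) : ℂ :=
  if h : l.length = n then θ fun i => l.get (i.cast h.symm) else 0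

theorem coeff_ofFn {d n : ℕ} (θ : Tens d n) (α : Fin n → Fin d) : coeff θ (List.ofFn α) = θ α := by
  simp [coeff]

/-- The operator that removes the initial letters `l`, the adjoint of `θ ↦ e_l ⊗ θ`. -/
def annihilate {d n : ℕ} (m : ℕ) (l : List (Fin d)) : Tens d n →ₗ[ℂ] Tens d m where
  toFun θ := WithLp.toLp 2 fun γ => coeff θ (l ++ List.ofFn γ)
  map_add' θ θ' := by
    ext γ
    simp only [coeff, PiLp.add_apply]
    split_ifs <;> simp
  map_smul' c θ := by
    ext γ
    simp only [coeff, PiLp.smul_apply]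
    split_ifs <;> simp

theorem annihilate_apply {d n : ℕ} (m : ℕ) (l : List (Fin d)) (θ : Tens d n) (γ : Fin m → Fin d) :
    annihilate m l θ γ = coeff θ (l ++ List.ofFn γ) := rfl

/-- The length hypothesis makes both sides take the default value zero for exactly the same lists
$l'$, so no condition on $l'$ is needed. -/
theorem coeff_annihilate {d n m : ℕ} (l l' : List (Fin d)) (h : l.length + m = n) (θ : Tens d n) :
    coeff (annihilate m l θ) l' = coeff θ (l ++ l') := by
  by_cases hl : l'.length = m
  · obtain ⟨α, rfl⟩ : ∃ α : Fin m → Fin d, List.ofFn α = l' := by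
      subst hl
      exact ⟨l'.get, List.ofFn_get l'⟩
    rw [coeff_ofFn, annihilate_apply]
  · rw [coeff, dif_neg hl, coeff, dif_neg]
    simp only [List.length_append]
    omega

theorem annihilate_annihilate {d n m j : ℕ} (l l' : List (Fin d)) (h : l.length + m = n)
    (θ : Tens d n) : annihilate j l' (annihilate m l θ) = annihilate j (l ++ l') θ := by
  ext γ
  rw [annihilate_apply, coeff_annihilate _ _ h, annihilate_apply, List.append_assoc]

theorem wop_apply {d k : ℕ} (M : Matrix (Fin k → Fin d) (Fin k → Fin d) ℂ) (θ : Tens d k)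
    (α : Fin k → Fin d) : wop M θ α = ∑ β, M α β * θ β := rfl

theorem inner_wop {d k : ℕ} (M : Matrix (Fin k → Fin d) (Fin k → Fin d) ℂ) (θ θ' : Tens d k) :
    inner ℂ θ (wop M θ') = ∑ α, ∑ β, M α β • (star (θ α) * θ' β) := by
  simp only [PiLp.inner_apply, wop_apply, RCLike.inner_apply, Finset.sum_mul, smul_eq_mul]
  refine Finset.sum_congr rfl fun α _ => Finset.sum_congr rfl fun β _ => ?_
  rw [starRingEnd_apply]
  ring

/-- The recursion for the sesquilinear form of $R_{k+1}^2$: tensoring with $X_{j+1}$ on the left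
means pairing the tensors that remain after removal of $j+1$ letters. -/
theorem inner_wop_Rsq_succ {d : ℕ} (X : WeightSeq d) (k : ℕ) (θ θ' : Tens d (k + 1)) :
    inner ℂ θ (wop (Rsq X (k + 1)) θ') = ∑ p ∈ Finset.HasAntidiagonal.antidiagonal k, ∑ α, ∑ β,
      X (p.1 + 1) α β * inner ℂ (annihilate p.2 (List.ofFn α) θ)
        (wop (Rsq X p.2) (annihilate p.2 (List.ofFn β) θ')) := by
  have := sum_Rsq_succ_smul X k fun l l' => star (coeff θ l) * coeff θ' l'
  simp only [coeff_ofFn] at this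
  rw [inner_wop, this]
  simp only [inner_wop, annihilate_apply, smul_eq_mul]

end

end RKC

namespace RKC

noncomputable section

/-! ### Positive semidefinite coefficient matrices -/

section PSD

theorem inner_self_eq_ofReal {E : Type*} [NormedAddCommGroup E] [InnerProductSpace ℂ E] (x : E) :
    inner ℂ x x = ((‖x‖ ^ 2 : ℝ) : ℂ) := by
  rw [inner_self_eq_norm_sq_to_K, Complex.ofReal_pow]
  rfl

variable {ι : Type*} [Fintype ι] {M : Matrix ι ι ℂ}

/-- A positive semidefinite matrix is a sum of rank one matrices $v_iv_i^*$. The vectors depend on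
$M$ alone, so one factorization serves every inner product space and all families $x$, $y$. -/
theorem exists_sum_smul_inner_eq (hM : M.PosSemidef) : ∃ (m : ℕ) (v : Fin m → ι → ℂ),
    (∀ α β, M α β = ∑ i, v i α * star (v i β)) ∧
    ∀ {E : Type*} [NormedAddCommGroup E] [InnerProductSpace ℂ E] (x y : ι → E),
      ∑ α, ∑ β, M α β * inner ℂ (x α) (y β) =
        ∑ i, inner ℂ (∑ α, star (v i α) • x α) (∑ β, star (v i β) • y β) := by
  obtain ⟨m, v, hv⟩ := Matrix.posSemidef_iff_eq_sum_vecMulVec.1 hM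
  have hv' : ∀ α β, M α β = ∑ i, v i α * star (v i β) := fun α β => by
    rw [hv, Matrix.sum_apply]
    rfl
  refine ⟨m, v, hv', fun x y => ?_⟩
  simp_rw [hv', Finset.sum_mul, sum_inner, inner_sum, inner_smul_left, inner_smul_right]
  rw [Finset.sum_congr rfl fun α _ => Finset.sum_comm, Finset.sum_comm]
  refine Finset.sum_congr rfl fun i _ => Finset.sum_congr rfl fun α _ =>
    Finset.sum_congr rfl fun β _ => ?_
  simp only [starRingEnd_apply, star_star]
  ring

theorem sum_mul_inner_nonneg (hM : M.PosSemidef) {E : Type*} [NormedAddCommGroup E]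
    [InnerProductSpace ℂ E] (x : ι → E) : 0 ≤ ∑ α, ∑ β, M α β * inner ℂ (x α) (x β) := by
  obtain ⟨m, v, -, h⟩ := exists_sum_smul_inner_eq hM
  rw [h]
  refine Finset.sum_nonneg fun i _ => ?_
  rw [inner_self_eq_ofReal]
  exact Complex.zero_le_real.2 (sq_nonneg _)

/-- Coercivity of an invertible positive matrix, for vector-valued families. The form equals
$\sum_i\|w_i\|^2$ with $w_i=\sum_\beta\overline{v_i(\beta)}x_\beta$, and $M^{-1}$ recovers each
$x_\alpha$ from the $w_i$. -/
theorem exists_sum_norm_sq_le [DecidableEq ι] (hM : M.PosSemidef) (hu : IsUnit M) :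
    ∃ C : ℝ, 0 ≤ C ∧
      ∀ {E : Type*} [NormedAddCommGroup E] [InnerProductSpace ℂ E] (x : ι → E),
        ∑ α, ‖x α‖ ^ 2 ≤ C * (∑ α, ∑ β, M α β * inner ℂ (x α) (x β)).re := by
  obtain ⟨m, v, hv, h⟩ := exists_sum_smul_inner_eq hM
  -- The squared Hilbert-Schmidt norm of the matrix that expresses $x$ through $w$; Cauchy-Schwarz
  -- produces it.
  refine ⟨∑ α, ∑ i, ‖∑ β, M⁻¹ α β * v i β‖ ^ 2, by positivity, fun x => ?_⟩
  set w := fun i => ∑ β, star (v i β) • x β with hw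
  have hx : ∀ α, x α = ∑ i, (∑ β, M⁻¹ α β * v i β) • w i := fun α => by
    have h1 : ∀ β, ∑ i, v i β • w i = ∑ γ, M β γ • x γ := fun β => by
      simp only [hw, Finset.smul_sum, smul_smul, hv, Finset.sum_smul]
      exact Finset.sum_comm
    have h2 : ∑ i, (∑ β, M⁻¹ α β * v i β) • w i = ∑ β, M⁻¹ α β • ∑ i, v i β • w i := by
      simp only [Finset.sum_smul, Finset.smul_sum, smul_smul]
      exact Finset.sum_comm
    have h3 : ∑ β, M⁻¹ α β • ∑ γ, M β γ • x γ = ∑ γ, (M⁻¹ * M) α γ • x γ := by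
      simp only [Matrix.mul_apply, Finset.sum_smul, Finset.smul_sum, smul_smul]
      exact Finset.sum_comm
    rw [h2]
    simp only [h1]
    rw [h3, Matrix.nonsing_inv_mul _ ((Matrix.isUnit_iff_isUnit_det _).1 hu)]
    simp [Matrix.one_apply]
  have hre : (∑ α, ∑ β, M α β * inner ℂ (x α) (x β)).re = ∑ i, ‖w i‖ ^ 2 := by
    rw [h, Complex.re_sum]
    refine Finset.sum_congr rfl fun i _ => ?_
    rw [inner_self_eq_ofReal, Complex.ofReal_re]
  rw [hre, Finset.sum_mul]
  refine Finset.sum_le_sum fun α _ => ?_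
  refine le_trans ?_ (Finset.sum_mul_sq_le_sq_mul_sq Finset.univ
    (fun i => ‖∑ β, M⁻¹ α β * v i β‖) fun i => ‖w i‖)
  refine pow_le_pow_left₀ (norm_nonneg _) ?_ 2
  nth_rewrite 1 [hx α]
  refine (norm_sum_le _ _).trans_eq (Finset.sum_congr rfl fun i _ => norm_smul _ _)

end PSD

/-! ### The square roots `R_k` -/

/-- Positivity is a hypothesis for two reasons: `CFC.sqrt` squares back only for nonnegative
operators, and the lemma is needed at lower levels inside the induction that proves positivity. -/
theorem inner_R_eq {d k : ℕ} (X : WeightSeq d) (h : (wop (Rsq X k)).IsPositive) (θ θ' : Tens d k) :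
    inner ℂ (R X k θ) (R X k θ') = inner ℂ θ (wop (Rsq X k) θ') := by
  have h0 : 0 ≤ wop (Rsq X k) := (ContinuousLinearMap.nonneg_iff_isPositive _).2 h
  have h1 : (R X k).IsPositive := (ContinuousLinearMap.nonneg_iff_isPositive _).1
    (CFC.sqrt_nonneg _)
  have h2 : R X k * R X k = wop (Rsq X k) := CFC.sqrt_mul_sqrt_self _ h0
  rw [← h2, mul_apply_eq_comp, ← ContinuousLinearMap.adjoint_inner_right,
    h1.isSelfAdjoint.adjoint_eq]

theorem Rsq_zero {d : ℕ} (X : WeightSeq d) : Rsq X 0 = 1 := by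
  ext α β
  rw [Subsingleton.elim β α]
  have : Subsingleton (Composition 0) :=
    Fintype.card_le_one_iff_subsingleton.1 (by simp [composition_card])
  have h0 : IsEmpty (Fin (Composition.ones 0).length) := by
    rw [Composition.ones_length]
    infer_instance
  simp only [Rsq, Matrix.of_apply, Matrix.one_apply_eq]
  rw [Fintype.sum_subsingleton _ (Composition.ones 0)]
  exact Fintype.prod_empty _

/-- By strong induction the lower $R_m^2$ have square roots, so each term of the recursion is a Gram
form: the positive matrix $X_{j+1}$ tested on the vectors $R_m$ of truncated tensors. -/
theorem isPositive_wop_Rsq {d : ℕ} {X : WeightSeq d} (hX : Admissible X) (k : ℕ) :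
    (wop (Rsq X k)).IsPositive := by
  induction k using Nat.strong_induction_on with
  | _ k ih =>
  rw [ContinuousLinearMap.isPositive_iff_complex]
  have key : ∀ θ : Tens d k, 0 ≤ inner ℂ θ (wop (Rsq X k) θ) := fun θ => by
    rcases k with _ | k
    · rw [Rsq_zero, show wop (1 : Matrix (Fin 0 → Fin d) (Fin 0 → Fin d) ℂ) = 1 from map_one _]
      simp only [one_apply_eq_self]
      rw [inner_self_eq_ofReal]
      exact Complex.zero_le_real.2 (sq_nonneg _)
    · rw [inner_wop_Rsq_succ]
      refine Finset.sum_nonneg fun p hp => ?_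
      have hp' : p.2 < k + 1 := by
        have := Finset.HasAntidiagonal.mem_antidiagonal.1 hp
        omega
      simp only [← inner_R_eq X (ih _ hp')]
      exact sum_mul_inner_nonneg (hX.posSemidef _ (Nat.succ_pos _))
        fun α => R X p.2 (annihilate p.2 (List.ofFn α) θ)
  intro θ
  have h := key θ
  rw [← inner_conj_symm, starRingEnd_apply, star_nonneg_iff] at h
  rw [RCLike.nonneg_iff (K := ℂ)] at h
  refine ⟨?_, h.1⟩
  exact RCLike.ext (by simp) (by simpa using h.2.symm)

section

variable {d : ℕ} {X : WeightSeq d}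

theorem inner_R (hX : Admissible X) (k : ℕ) (θ θ' : Tens d k) :
    inner ℂ (R X k θ) (R X k θ') = inner ℂ θ (wop (Rsq X k) θ') :=
  inner_R_eq X (isPositive_wop_Rsq hX k) θ θ'

theorem inner_R_left (k : ℕ) (θ θ' : Tens d k) :
    inner ℂ (R X k θ) θ' = inner ℂ θ (R X k θ') := by
  have h1 : (R X k).IsPositive := (ContinuousLinearMap.nonneg_iff_isPositive _).1
    (CFC.sqrt_nonneg _)
  rw [← ContinuousLinearMap.adjoint_inner_right, h1.isSelfAdjoint.adjoint_eq]

theorem inner_R_succ (hX : Admissible X) (k : ℕ) (θ θ' : Tens d (k + 1)) :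
    inner ℂ (R X (k + 1) θ) (R X (k + 1) θ') = ∑ p ∈ Finset.HasAntidiagonal.antidiagonal k,
      ∑ α, ∑ β, X (p.1 + 1) α β * inner ℂ (R X p.2 (annihilate p.2 (List.ofFn α) θ))
        (R X p.2 (annihilate p.2 (List.ofFn β) θ')) := by
  simp only [inner_R hX, inner_wop_Rsq_succ]

/-- The recursion has nonnegative terms, so its $j=0$ term gives $X_1\otimes R_k^2\le R_{k+1}^2$.
Invertibility of $X_1$ bounds $I\otimes R_k^2$ by a multiple of this term, uniformly in $k$. This is
the only use of that hypothesis. -/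
theorem exists_norm_annihilate_le (hX : Admissible X) : ∃ C : ℝ, 0 ≤ C ∧ ∀ (k : ℕ) (i : Fin d) (θ : Tens d (k + 1)),
    ‖R X k (annihilate k [i] θ)‖ ≤ C * ‖R X (k + 1) θ‖ := by
  obtain ⟨C, hC, h⟩ := exists_sum_norm_sq_le (hX.posSemidef 1 le_rfl) hX.isUnit_one
  refine ⟨√C, Real.sqrt_nonneg _, fun k i θ => ?_⟩
  refine le_of_sq_le_sq ?_ (by positivity)
  rw [mul_pow, Real.sq_sqrt hC]
  have h1 := h fun α : Fin 1 → Fin d => R X k (annihilate k (List.ofFn α) θ)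
  have h2 : ‖R X k (annihilate k [i] θ)‖ ^ 2 ≤
      ∑ α : Fin 1 → Fin d, ‖R X k (annihilate k (List.ofFn α) θ)‖ ^ 2 := by
    have := Finset.single_le_sum (f := fun α : Fin 1 → Fin d =>
      ‖R X k (annihilate k (List.ofFn α) θ)‖ ^ 2) (fun _ _ => sq_nonneg _)
      (Finset.mem_univ fun _ : Fin 1 => i)
    simpa using this
  refine (h2.trans h1).trans (mul_le_mul_of_nonneg_left ?_ hC)
  have h3 := inner_R_succ hX k θ θ
  rw [inner_self_eq_ofReal] at h3
  have h4 : ∑ α, ∑ β, X 1 α β * inner ℂ (R X k (annihilate k (List.ofFn α) θ))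
      (R X k (annihilate k (List.ofFn β) θ)) ≤ ((‖R X (k + 1) θ‖ ^ 2 : ℝ) : ℂ) := by
    rw [h3]
    exact Finset.single_le_sum (f := fun p : ℕ × ℕ => ∑ α, ∑ β, X (p.1 + 1) α β *
      inner ℂ (R X p.2 (annihilate p.2 (List.ofFn α) θ))
        (R X p.2 (annihilate p.2 (List.ofFn β) θ)))
      (fun p _ => sum_mul_inner_nonneg (hX.posSemidef _ (Nat.succ_pos _))
        fun α => R X p.2 (annihilate p.2 (List.ofFn α) θ))
      (Finset.HasAntidiagonal.mem_antidiagonal.2 (by simp) : ((0, k) : ℕ × ℕ) ∈ _)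
  exact (Complex.le_def.1 h4).1.trans_eq (Complex.ofReal_re _)

theorem annihilate_singleton_apply {k : ℕ} (i : Fin d) (θ : Tens d (k + 1)) (γ : Fin k → Fin d) :
    annihilate k [i] θ γ = θ (Fin.cons i γ) := by
  rw [annihilate_apply, ← coeff_ofFn, List.ofFn_cons]
  rfl

/-- If $R_{k+1}\theta=0$, the previous bound puts every one-letter truncation of $\theta$ in the
kernel of $R_k$, hence makes it zero; the truncations contain all coordinates of $\theta$. -/
theorem R_injective (hX : Admissible X) (k : ℕ) : Function.Injective (R X k) := by
  obtain ⟨C, hC, h⟩ := exists_norm_annihilate_le hX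
  rw [injective_iff_map_eq_zero]
  induction k with
  | zero =>
    intro θ hθ
    have h1 := inner_R hX 0 θ θ
    rw [hθ, Rsq_zero, show wop (1 : Matrix (Fin 0 → Fin d) (Fin 0 → Fin d) ℂ) = 1 from map_one _] at h1
    simpa using h1.symm
  | succ k ih =>
    intro θ hθ
    ext α
    have h1 := h k (α 0) θ
    rw [hθ, norm_zero, mul_zero] at h1
    have h2 := ih _ (norm_le_zero_iff.1 h1)
    have h3 := annihilate_singleton_apply (α 0) θ (Fin.tail α)
    rw [h2, Fin.cons_self_tail] at h3
    exact h3.symm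

theorem isUnit_R (hX : Admissible X) (k : ℕ) : IsUnit (R X k) := by
  have h := (LinearMap.injective_iff_surjective (f := (R X k).toLinearMap)).1 (R_injective hX k)
  exact ContinuousLinearMap.isUnit_iff_bijective.2 ⟨R_injective hX k, h⟩

/-! ### The weights $Z_{k+1}$ and their adjoint action -/

theorem sum_words_succ {k : ℕ} {M : Type*} [AddCommMonoid M] (f : (Fin (k + 1) → Fin d) → M) :
    ∑ α, f α = ∑ i, ∑ γ : Fin k → Fin d, f (Fin.cons i γ) := by
  rw [← Fintype.sum_prod_type']
  exact (Fintype.sum_equiv (Fin.consEquiv fun _ => Fin d) _ _ fun p => rfl).symm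

theorem inner_creation {k : ℕ} (i : Fin d) (θ : Tens d k) (v : Tens d (k + 1)) :
    inner ℂ (creation i θ) v = inner ℂ θ (annihilate k [i] v) := by
  simp only [PiLp.inner_apply, sum_words_succ, annihilate_singleton_apply, creation, Fin.cons_zero,
    Fin.tail_cons]
  rw [Finset.sum_eq_single i]
  · simp
  · intro j _ hj
    simp [hj]
  · simp

theorem idTensor_creation {k : ℕ} (A : Tens d k →L[ℂ] Tens d k) (i : Fin d) (θ : Tens d k) :
    idTensor A (creation i θ) = creation i (A θ) := by
  ext α
  change A (WithLp.toLp 2 fun β => creation i θ (Fin.cons (α 0) β)) (Fin.tail α) =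
    if α 0 = i then A θ (Fin.tail α) else 0
  split_ifs with h
  · refine congrArg (fun u : Tens d k => A u (Fin.tail α)) ?_
    ext β
    simp [creation, h]
  · have : (WithLp.toLp 2 fun β => creation i θ (Fin.cons (α 0) β) : Tens d k) = 0 := by
      ext β
      simp [creation, h]
    rw [this, map_zero]
    rfl

theorem R_weightZ_creation (hX : Admissible X) (k : ℕ) (i : Fin d) (θ : Tens d k) :
    R X (k + 1) (weightZ X k (creation i θ)) = creation i (R X k θ) := by
  rw [weightZ, ← mul_apply_eq_comp, ← mul_assoc,
    Ring.mul_inverse_cancel _ (isUnit_R hX _), one_mul, idTensor_creation]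

/-- The self-adjoint $R_{k+1}$ cancels the inverse in $Z_{k+1}$, so on the range of $R_{k+1}$ the
adjoint shift just removes a letter. Both the boundedness of the shifts and the intertwining with
the tuples come from this form. -/
theorem inner_weightZ_creation (hX : Admissible X) (k : ℕ) (i : Fin d) (θ : Tens d k) (v : Tens d (k + 1)) :
    inner ℂ (weightZ X k (creation i θ)) (R X (k + 1) v) =
      inner ℂ θ (R X k (annihilate k [i] v)) := by
  rw [← inner_R_left, R_weightZ_creation hX, inner_creation, inner_R_left]

theorem exists_norm_weightZ_creation_le (hX : Admissible X) : ∃ C : ℝ, 0 ≤ C ∧ ∀ (k : ℕ) (i : Fin d) (θ : Tens d k),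
    ‖weightZ X k (creation i θ)‖ ≤ C * ‖θ‖ := by
  obtain ⟨C, hC, h⟩ := exists_norm_annihilate_le hX
  refine ⟨C, hC, fun k i θ => ?_⟩
  -- By surjectivity of $R_{k+1}$ the image vector $u$ is itself some $R_{k+1}v$; pairing $u$ with
  -- itself turns the bound on letter removal into a bound on its adjoint.
  obtain ⟨v, hv⟩ := (LinearMap.injective_iff_surjective (f := (R X (k + 1)).toLinearMap)).1
    (R_injective hX _) (weightZ X k (creation i θ))
  replace hv : R X (k + 1) v = weightZ X k (creation i θ) := hv
  set u := weightZ X k (creation i θ) with hu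
  have h1 : ‖u‖ * ‖u‖ ≤ ‖θ‖ * (C * ‖u‖) := by
    have h2 := inner_weightZ_creation hX k i θ v
    rw [hv, ← hu] at h2
    calc ‖u‖ * ‖u‖ = ‖inner ℂ u u‖ := by
          rw [inner_self_eq_ofReal, Complex.norm_of_nonneg (sq_nonneg _), pow_two]
      _ = ‖inner ℂ θ (R X k (annihilate k [i] v))‖ := by rw [h2]
      _ ≤ ‖θ‖ * ‖R X k (annihilate k [i] v)‖ := norm_inner_le_norm _ _
      _ ≤ ‖θ‖ * (C * ‖R X (k + 1) v‖) := mul_le_mul_of_nonneg_left (h _ _ _) (norm_nonneg _)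
      _ = ‖θ‖ * (C * ‖u‖) := by rw [hv]
  rcases (norm_nonneg u).eq_or_lt with h0 | h0
  · rw [← h0]
    positivity
  · refine le_of_mul_le_mul_right ?_ h0
    linarith

/-! ### The weighted shifts -/

theorem exists_isShift (hX : Admissible X) (i : Fin d) : ∃ V, IsShift X i V := by
  obtain ⟨C, hC, h⟩ := exists_norm_weightZ_creation_le hX
  let f : Fock d → ∀ k, Tens d k := fun ξ k => match k with
    | 0 => 0
    | k + 1 => weightZ X k (creation i (ξ k))
  have hlin : ∀ (k : ℕ) (c : ℂ) (v w : Tens d k),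
      creation i (c • v + w) = c • creation i v + creation i w := fun k c v w => by
    ext α
    simp only [creation, PiLp.add_apply, PiLp.smul_apply]
    split_ifs <;> simp
  have hs : ∀ ξ : Fock d, Summable fun k => ‖ξ k‖ ^ 2 := fun ξ => by
    simpa using (lp.memℓp ξ).summable (by simp)
  have hn : ∀ ξ : Fock d, ‖ξ‖ ^ 2 = ∑' k, ‖ξ k‖ ^ 2 := fun ξ => by
    simpa using lp.norm_rpow_eq_tsum (by simp) ξ
  have hbd : ∀ (ξ : Fock d) (k : ℕ), ‖f ξ (k + 1)‖ ^ 2 ≤ C ^ 2 * ‖ξ k‖ ^ 2 := fun ξ k => by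
    rw [← mul_pow]
    exact pow_le_pow_left₀ (norm_nonneg _) (h _ _ _) 2
  have hfs : ∀ ξ : Fock d, Summable fun k => ‖f ξ k‖ ^ 2 := fun ξ =>
    (summable_nat_add_iff 1).1 (Summable.of_nonneg_of_le (fun _ => sq_nonneg _) (hbd ξ)
      ((hs ξ).mul_left _))
  let L : Fock d →ₗ[ℂ] Fock d :=
    { toFun := fun ξ => ⟨f ξ, memℓp_gen (by simpa using hfs ξ)⟩
      map_add' := fun ξ η => by
        ext k : 2
        rcases k with _ | k
        · exact (add_zero 0).symm
        · have := hlin k 1 (ξ k) (η k)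
          rw [one_smul, one_smul] at this
          change weightZ X k (creation i (ξ k + η k)) = _
          rw [this, map_add]
          rfl
      map_smul' := fun c ξ => by
        ext k : 2
        rcases k with _ | k
        · exact (smul_zero c).symm
        · have h0 : creation i (0 : Tens d k) = 0 := by
            ext α
            simp [creation]
          have := hlin k c (ξ k) 0
          rw [add_zero, h0, add_zero] at this
          change weightZ X k (creation i (c • ξ k)) = _
          rw [this, map_smul]
          rfl }
  refine ⟨L.mkContinuous C fun ξ => ?_, fun ξ => ⟨rfl, fun k => rfl⟩⟩
  refine lp.norm_le_of_tsum_le (by simp) (by positivity) ?_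
  have h1 : ∑' k, ‖f ξ k‖ ^ 2 ≤ (C * ‖ξ‖) ^ 2 := by
    rw [(hfs ξ).tsum_eq_zero_add, mul_pow, hn, ← tsum_mul_left]
    simp only [f, norm_zero, ne_eq, OfNat.ofNat_ne_zero, not_false_eq_true, zero_pow, zero_add]
    exact Summable.tsum_le_tsum (hbd ξ) ((summable_nat_add_iff 1).2 (hfs ξ)) ((hs ξ).mul_left _)
  simpa [L] using h1

theorem isShift_shift (hX : Admissible X) (i : Fin d) : IsShift X i (shift X i) := by
  have h := exists_isShift hX i
  rw [shift, dif_pos h]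
  exact h.choose_spec

end

end

end RKC

namespace RKC

noncomputable section

/-! ### Hilbert space tensor products -/

section HTensor

variable {F H : Type*} [NormedAddCommGroup F] [InnerProductSpace ℂ F]
  [NormedAddCommGroup H] [InnerProductSpace ℂ H]

variable (F H) in
/-- The elementary tensors as a continuous bilinear map `F → H → F ⊗ H`. -/
def htmul : F →L[ℂ] H →L[ℂ] HTensor F H :=
  (ContinuousLinearMap.compL ℂ H (F ⊗[ℂ] H) (HTensor F H) UniformSpace.Completion.toComplL) ∘L
    TensorProduct.mkL ℂ F H

theorem htmul_apply (ξ : F) (h : H) : htmul F H ξ h = ((ξ ⊗ₜ[ℂ] h : F ⊗[ℂ] H) : HTensor F H) := rfl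

theorem inner_htmul (ξ η : F) (h k : H) :
    inner ℂ (htmul F H ξ h) (htmul F H η k) = inner ℂ ξ η * inner ℂ h k := by
  rw [htmul_apply, htmul_apply, UniformSpace.Completion.inner_coe, TensorProduct.inner_tmul]

theorem hmap_htmul (A : F →L[ℂ] F) (B : H →L[ℂ] H) (ξ : F) (h : H) :
    hmap A B (htmul F H ξ h) = htmul F H (A ξ) (B h) := by
  rw [htmul_apply, hmap, ContinuousLinearMap.completion_apply_coe, TensorProduct.mapL_tmul]
  rfl

theorem htmul_induction {p : HTensor F H → Prop} (x : HTensor F H) (hc : IsClosed {x | p x})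
    (h0 : p 0) (hadd : ∀ x y, p x → p y → p (x + y)) (ht : ∀ ξ h, p (htmul F H ξ h)) : p x := by
  induction x using UniformSpace.Completion.induction_on with
  | hp => exact hc
  | ih x =>
    induction x using TensorProduct.induction_on with
    | zero => exact h0
    | tmul ξ h => exact ht ξ h
    | add x y hx hy =>
      rw [UniformSpace.Completion.coe_add]
      exact hadd _ _ hx hy

theorem htensor_clm_ext {G : Type*} [NormedAddCommGroup G] [NormedSpace ℂ G]
    {S T : HTensor F H →L[ℂ] G} (h : ∀ ξ k, S (htmul F H ξ k) = T (htmul F H ξ k)) : S = T := by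
  ext x
  refine htmul_induction (p := fun x => S x = T x) x (isClosed_eq S.continuous T.continuous)
    (by simp) (fun x y hx hy => by simp [hx, hy]) h

theorem eq_zero_of_inner_htmul {x : HTensor F H} (h : ∀ ξ k, inner ℂ (htmul F H ξ k) x = 0) :
    x = 0 := by
  have : innerSL ℂ x = 0 := by
    refine htensor_clm_ext fun ξ k => ?_
    rw [innerSL_apply_apply, ← inner_conj_symm, h]
    simp
  simpa using congrArg (fun f => f x) this

theorem hmap_mul (A A' : F →L[ℂ] F) (B B' : H →L[ℂ] H) :
    hmap A B * hmap A' B' = hmap (A * A') (B * B') :=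
  htensor_clm_ext fun ξ k => by simp [hmap_htmul]

theorem hmap_one : hmap (1 : F →L[ℂ] F) (1 : H →L[ℂ] H) = 1 :=
  htensor_clm_ext fun ξ k => by simp [hmap_htmul]

theorem hmap_one_add (a b : H →L[ℂ] H) :
    hmap (1 : F →L[ℂ] F) (a + b) = hmap 1 a + hmap 1 b :=
  htensor_clm_ext fun ξ k => by simp [hmap_htmul]

theorem hmap_one_smul (c : ℂ) (a : H →L[ℂ] H) :
    hmap (1 : F →L[ℂ] F) (c • a) = c • hmap 1 a :=
  htensor_clm_ext fun ξ k => by simp [hmap_htmul]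

variable (F H) in
/-- The amplification `A ↦ A ⊗ I`. -/
def ampl : (F →L[ℂ] F) →ₐ[ℂ] (HTensor F H →L[ℂ] HTensor F H) where
  toFun A := hmap A 1
  map_one' := hmap_one
  map_mul' A B := by rw [hmap_mul, one_mul]
  map_zero' := htensor_clm_ext fun ξ k => by simp [hmap_htmul]
  map_add' A B := htensor_clm_ext fun ξ k => by simp [hmap_htmul]
  commutes' c := htensor_clm_ext fun ξ k => by simp [hmap_htmul, Algebra.algebraMap_eq_smul_one]

theorem norm_hmap_le (A : F →L[ℂ] F) (B : H →L[ℂ] H) : ‖hmap A B‖ ≤ ‖A‖ * ‖B‖ := by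
  refine ContinuousLinearMap.opNorm_le_bound _ (by positivity) fun x => ?_
  induction x using UniformSpace.Completion.induction_on with
  | hp => exact isClosed_le (by fun_prop) (by fun_prop)
  | ih x =>
    rw [hmap, ContinuousLinearMap.completion_apply_coe, UniformSpace.Completion.norm_coe,
      UniformSpace.Completion.norm_coe]
    exact ContinuousLinearMap.le_of_opNorm_le _ (TensorProduct.norm_mapL_le A B) x

theorem star_hmap [CompleteSpace F] [CompleteSpace H] (A : F →L[ℂ] F) (B : H →L[ℂ] H) :
    star (hmap A B) = hmap (star A) (star B) := by
  refine htensor_clm_ext fun ξ k => ?_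
  rw [← sub_eq_zero]
  refine eq_zero_of_inner_htmul fun η l => ?_
  rw [inner_sub_right, hmap_htmul, inner_htmul]
  simp only [ContinuousLinearMap.star_eq_adjoint, ContinuousLinearMap.adjoint_inner_right,
    hmap_htmul, inner_htmul, sub_self]

end HTensor

/-! ### Symmetric tensors -/

/-- The symmetrization of the basis vector `e_α`. -/
def symBasis {d k : ℕ} (α : Fin k → Fin d) : symTens d k :=
  ⟨((Nat.factorial k : ℂ))⁻¹ • ∑ σ : Equiv.Perm (Fin k), EuclideanSpace.single (α ∘ σ) 1, by
    intro τ γ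
    simp only [PiLp.smul_apply, WithLp.ofLp_sum, Finset.sum_apply]
    congr 1
    refine Fintype.sum_equiv (Equiv.mulRight τ⁻¹) _ _ fun σ => ?_
    have : (γ ∘ τ = α ∘ σ) ↔ γ = α ∘ (σ * τ⁻¹ : Equiv.Perm (Fin k)) := by
      constructor
      · intro h
        funext i
        have := congrFun h (τ⁻¹ i)
        simpa using this
      · rintro rfl
        funext i
        simp
    simp only [PiLp.single_apply, this, Equiv.coe_mulRight]⟩

theorem coe_symBasis {d k : ℕ} (α : Fin k → Fin d) : (symBasis α : Tens d k) =
    ((Nat.factorial k : ℂ))⁻¹ • ∑ σ : Equiv.Perm (Fin k), EuclideanSpace.single (α ∘ σ) 1 := rfl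

theorem symBasis_comp_perm {d k : ℕ} (α : Fin k → Fin d) (τ : Equiv.Perm (Fin k)) :
    symBasis (α ∘ τ) = symBasis α := by
  ext1
  rw [coe_symBasis, coe_symBasis]
  congr 1
  exact Fintype.sum_equiv (Equiv.mulLeft τ) _ _ fun σ => rfl

/-- Symmetry of the coordinates makes the expansion along the permuted basis $e_{\alpha\circ\sigma}$
equal to $\theta$ for each $\sigma$; the left side is the average of these $k!$ expansions. -/
theorem sum_smul_symBasis {d k : ℕ} (θ : symTens d k) : ∑ α, θ.1 α • symBasis α = θ := by
  ext1
  have h1 : ∀ σ : Equiv.Perm (Fin k),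
      ∑ α, θ.1 α • (EuclideanSpace.single (α ∘ σ) 1 : Tens d k) = θ.1 := fun σ => by
    rw [show ∑ α, θ.1 α • (EuclideanSpace.single (α ∘ σ) 1 : Tens d k) =
      ∑ α, θ.1 α • (EuclideanSpace.single α 1 : Tens d k) from
        Fintype.sum_equiv (σ.arrowCongr (Equiv.refl (Fin d))).symm _ _ fun α => by
          change θ.1 α • _ = θ.1 (α ∘ σ) • _
          rw [θ.2 σ α]
          rfl]
    ext γ
    simp [Pi.single_apply]
  rw [AddSubmonoidClass.coe_finsetSum]
  have h2 : ∑ α, ((θ.1 α • symBasis α : symTens d k) : Tens d k) = ((Nat.factorial k : ℂ))⁻¹ •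
      ∑ σ : Equiv.Perm (Fin k), ∑ α, θ.1 α • (EuclideanSpace.single (α ∘ σ) 1 : Tens d k) := by
    simp only [Submodule.coe_smul, coe_symBasis, Finset.smul_sum]
    rw [Finset.sum_comm]
    exact Finset.sum_congr rfl fun _ _ => Finset.sum_congr rfl fun _ _ => smul_comm _ _ _
  rw [h2]
  simp only [h1, Finset.sum_const, Finset.card_univ, Fintype.card_perm, Fintype.card_fin]
  rw [← Nat.cast_smul_eq_nsmul ℂ, smul_smul, inv_mul_cancel₀, one_smul]
  exact_mod_cast Nat.factorial_ne_zero k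

/-- A symmetric family of coordinates as a symmetric tensor. -/
def symOf {d k : ℕ} (x : (Fin k → Fin d) → ℂ)
    (hx : ∀ (σ : Equiv.Perm (Fin k)) α, x (α ∘ σ) = x α) : symTens d k := ⟨WithLp.toLp 2 x, hx⟩

/-- Coefficients invariant under permutations of each word do not see the difference between $M$ and
its compression to symmetric tensors. This is why a commuting tuple needs only $F(R)$ and not the
full Fock space. -/
theorem sum_inner_wop_symBasis {d k : ℕ} (M : Matrix (Fin k → Fin d) (Fin k → Fin d) ℂ)
    (y : (Fin k → Fin d) → (Fin k → Fin d) → ℂ)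
    (hy : ∀ (σ : Equiv.Perm (Fin k)) α β, y (α ∘ σ) β = y α β)
    (hy' : ∀ (σ : Equiv.Perm (Fin k)) α β, y α (β ∘ σ) = y α β) :
    ∑ α, ∑ β, inner ℂ (symBasis α : Tens d k) (wop M (symBasis β)) * y α β =
      ∑ α, ∑ β, M α β * y α β := by
  have h1 : ∀ α : Fin k → Fin d, ∑ β, inner ℂ (symBasis α : Tens d k) (wop M (symBasis β)) * y α β =
      ∑ β, inner ℂ (symBasis α : Tens d k) (wop M (EuclideanSpace.single β 1)) * y α β :=
    fun α => by
    have h2 := congrArg (fun θ : symTens d k => inner ℂ (symBasis α : Tens d k) (wop M θ))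
      (sum_smul_symBasis (symOf (y α) fun σ β => hy' σ α β))
    have h3 : ((symOf (y α) fun σ β => hy' σ α β : symTens d k) : Tens d k) =
        ∑ β, y α β • EuclideanSpace.single β 1 := by
      ext γ
      simp [symOf, Pi.single_apply]
    simp only [show ∀ β, (symOf (y α) fun σ β => hy' σ α β : symTens d k).1 β = y α β from
      fun _ => rfl] at h2
    simp only [h3, AddSubmonoidClass.coe_finsetSum, Submodule.coe_smul, map_sum, map_smul,
      inner_sum, inner_smul_right] at h2
    simpa only [mul_comm] using h2
  simp only [h1]
  rw [Finset.sum_comm, Finset.sum_comm (f := fun α β => M α β * y α β)]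
  refine Finset.sum_congr rfl fun β _ => ?_
  have h2 := congrArg (fun θ : symTens d k => inner ℂ (θ : Tens d k)
    (wop M (EuclideanSpace.single β 1)))
      (sum_smul_symBasis (symOf (fun α => star (y α β)) fun σ α => by rw [hy]))
  simp only [symOf, AddSubmonoidClass.coe_finsetSum, Submodule.coe_smul, sum_inner,
    inner_smul_left, starRingEnd_apply, star_star] at h2
  simp only [mul_comm _ (y _ β)]
  rw [h2, PiLp.inner_apply]
  refine Finset.sum_congr rfl fun α _ => ?_
  simp [wop_apply, mul_comm]

theorem annihilate_singleton_mem {d k : ℕ} (i : Fin d) {θ : Tens d (k + 1)}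
    (hθ : θ ∈ symTens d (k + 1)) : annihilate k [i] θ ∈ symTens d k := by
  intro σ γ
  rw [annihilate_singleton_apply, annihilate_singleton_apply,
    -- This permutation fixes the first letter and lets $\sigma$ act on the others.
    ← hθ (Equiv.Perm.decomposeFin.symm (0, σ)) (Fin.cons i γ)]
  refine congrArg (fun α => θ α) (funext fun j => ?_)
  refine Fin.cases ?_ (fun j => ?_) j <;> simp

theorem annihilate_mem {d m n : ℕ} (l : List (Fin d)) (h : l.length + m = n) {θ : Tens d n}
    (hθ : θ ∈ symTens d n) : annihilate m l θ ∈ symTens d m := by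
  induction l generalizing n with
  | nil =>
    obtain rfl : m = n := by simpa using h
    intro σ γ
    rw [annihilate_apply, annihilate_apply, List.nil_append, List.nil_append, coeff_ofFn,
      coeff_ofFn, hθ]
  | cons a l ih =>
    obtain rfl : n = (l.length + m) + 1 := by
      rw [← h, List.length_cons]
      omega
    have := annihilate_annihilate (m := l.length + m) (j := m) [a] l (by simp [add_comm]) θ
    rw [List.singleton_append] at this
    rw [← this]
    exact ih rfl (annihilate_singleton_mem a hθ)

/-! ### Homogeneous elements of `F(R)` -/

/-- The map `θ ↦ R_n θ` from symmetric tensors to the homogeneous elements of `F(R)`. -/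
def homog {d : ℕ} (X : WeightSeq d) (n : ℕ) : symTens d n →ₗ[ℂ] FR X where
  toFun θ := ⟨lp.single 2 n (R X n θ), fun k => by
    by_cases h : k = n
    · subst h
      rw [lp.single_apply_self]
      exact ⟨θ, θ.2, rfl⟩
    · rw [lp.single_apply_ne _ _ _ h]
      exact Submodule.zero_mem _⟩
  map_add' θ θ' := by
    ext1
    simp only [Submodule.coe_add, map_add, lp.single_add]
  map_smul' c θ := by
    ext1
    simp only [Submodule.coe_smul, map_smul, lp.single_smul, RingHom.id_apply]

theorem coe_homog {d : ℕ} (X : WeightSeq d) (n : ℕ) (θ : symTens d n) :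
    (homog X n θ : Fock d) = lp.single 2 n (R X n θ) := rfl

theorem inner_homog_left {d : ℕ} (X : WeightSeq d) (n : ℕ) (θ : symTens d n) (ξ : FR X) :
    inner ℂ (homog X n θ) ξ = inner ℂ (R X n θ) ((ξ : Fock d) n) :=
  lp.inner_single_left n _ _

theorem inner_homog_homog_of_ne {d : ℕ} (X : WeightSeq d) {n m : ℕ} (h : n ≠ m)
    (θ : symTens d n) (θ' : symTens d m) : inner ℂ (homog X n θ) (homog X m θ') = 0 := by
  rw [inner_homog_left, coe_homog, lp.single_apply_ne _ _ _ h, inner_zero_right]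

theorem inner_homog_homog {d : ℕ} (X : WeightSeq d) (n : ℕ) (θ θ' : symTens d n) :
    inner ℂ (homog X n θ) (homog X n θ') = inner ℂ (R X n θ) (R X n θ') := by
  rw [inner_homog_left, coe_homog, lp.single_apply_self]

theorem exists_homog_eq {d : ℕ} {X : WeightSeq d} (ξ : FR X) (n : ℕ) :
    ∃ θ : symTens d n, R X n θ = (ξ : Fock d) n := by
  obtain ⟨θ, hθ, h⟩ := ξ.2 n
  exact ⟨⟨θ, hθ⟩, h⟩

theorem hasSum_homog {d : ℕ} {X : WeightSeq d} (ξ : FR X) (θ : ∀ n, symTens d n)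
    (hθ : ∀ n, R X n (θ n) = (ξ : Fock d) n) : HasSum (fun n => homog X n (θ n)) ξ := by
  have h := lp.hasSum_single (by simp) (ξ : Fock d)
  refine (Topology.IsInducing.subtypeVal.hasSum_iff (g := (FR X).subtype) _ _).1 ?_
  convert h using 2 with n
  · rw [← hθ]
    rfl
  · rfl

end

end RKC

namespace RKC

noncomputable section

variable {H : Type*} [NormedAddCommGroup H] [InnerProductSpace ℂ H] [CompleteSpace H]
variable {d : ℕ} {X : WeightSeq d}

/-! ### The maps `a ↦ V^{(k)} (M ⊗ a) U^{(k)*}` -/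

theorem wordProd_eq {A : Type*} [Monoid A] {k : ℕ} (T : Fin d → A) (α : Fin k → Fin d) :
    wordProd T α = ((List.ofFn α).map T).prod := by
  rw [wordProd, List.map_ofFn]
  rfl

theorem inner_sandwich (k : ℕ) (M : Matrix (Fin k → Fin d) (Fin k → Fin d) ℂ)
    (V : Fin d → H →L[ℂ] H) (a : H →L[ℂ] H) (U : Fin d → H →L[ℂ] H) (x y : H) :
    inner ℂ x (sandwich k M V a U y) = ∑ α, ∑ β, M α β *
      inner ℂ (star (wordProd V α) x) (a (star (wordProd U β) y)) := by
  simp only [sandwich, _root_.sum_apply, inner_sum, _root_.smul_apply,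
    inner_smul_right, mul_apply_eq_comp, ContinuousLinearMap.star_eq_adjoint,
    ContinuousLinearMap.adjoint_inner_left]

theorem sandwich_sub (k : ℕ) (M : Matrix (Fin k → Fin d) (Fin k → Fin d) ℂ)
    (V : Fin d → H →L[ℂ] H) (a b : H →L[ℂ] H) (U : Fin d → H →L[ℂ] H) :
    sandwich k M V (a - b) U = sandwich k M V a U - sandwich k M V b U := by
  simp only [sandwich, mul_sub, sub_mul, smul_sub, Finset.sum_sub_distrib]

theorem sandwich_smul (k : ℕ) (M : Matrix (Fin k → Fin d) (Fin k → Fin d) ℂ)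
    (V : Fin d → H →L[ℂ] H) (c : ℂ) (a : H →L[ℂ] H) (U : Fin d → H →L[ℂ] H) :
    sandwich k M V (c • a) U = c • sandwich k M V a U := by
  simp only [sandwich, mul_smul_comm, smul_mul_assoc, Finset.smul_sum, smul_comm c]

theorem sandwich_sum {ι : Type*} (s : Finset ι) (k : ℕ)
    (M : Matrix (Fin k → Fin d) (Fin k → Fin d) ℂ)
    (V : Fin d → H →L[ℂ] H) (a : ι → H →L[ℂ] H) (U : Fin d → H →L[ℂ] H) :
    sandwich k M V (∑ i ∈ s, a i) U = ∑ i ∈ s, sandwich k M V (a i) U := by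
  simp only [sandwich, Finset.mul_sum, Finset.sum_mul, Finset.smul_sum]
  rw [Finset.sum_comm' (s := s) (t' := Finset.univ) (s' := fun _ => s) (by simp)]
  exact Finset.sum_congr rfl fun α _ => by rw [Finset.sum_comm]

theorem clm_nonneg_iff {E : Type*} [NormedAddCommGroup E] [InnerProductSpace ℂ E]
    [CompleteSpace E] (D : E →L[ℂ] E) : 0 ≤ D ↔ ∀ x, 0 ≤ inner ℂ x (D x) := by
  rw [ContinuousLinearMap.nonneg_iff_isPositive, ContinuousLinearMap.isPositive_iff_complex]
  refine forall_congr' fun x => ?_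
  rw [← inner_conj_symm x, starRingEnd_apply, star_nonneg_iff, RCLike.nonneg_iff (K := ℂ)]
  constructor
  · rintro ⟨h1, h2⟩
    refine ⟨h2, ?_⟩
    rw [← h1]
    simp
  · rintro ⟨h1, h2⟩
    exact ⟨RCLike.ext (by simp) (by simpa using h2.symm), h1⟩

theorem sandwich_nonneg {k : ℕ} {M : Matrix (Fin k → Fin d) (Fin k → Fin d) ℂ} (hM : M.PosSemidef)
    (T : Fin d → H →L[ℂ] H) {a : H →L[ℂ] H} (ha : 0 ≤ a) : 0 ≤ sandwich k M T a T := by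
  rw [clm_nonneg_iff]
  intro x
  obtain ⟨b, rfl⟩ := CStarAlgebra.nonneg_iff_eq_star_mul_self.1 ha
  rw [inner_sandwich]
  simp only [mul_apply_eq_comp, ContinuousLinearMap.star_eq_adjoint b,
    ContinuousLinearMap.adjoint_inner_right]
  exact sum_mul_inner_nonneg hM fun α => b (star (wordProd T α) x)

theorem sandwich_zero (V : Fin d → H →L[ℂ] H) (a : H →L[ℂ] H) (U : Fin d → H →L[ℂ] H) :
    sandwich 0 (Rsq X 0) V a U = a := by
  simp [sandwich, Rsq_zero, wordProd]

/-- Products along words are multiplicative under concatenation, so the recursion for $R_{k+1}^2$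
becomes a recursion for maps on $B(H)$. -/
theorem sandwich_Rsq_succ (X : WeightSeq d) (k : ℕ) (V : Fin d → H →L[ℂ] H) (a : H →L[ℂ] H)
    (U : Fin d → H →L[ℂ] H) : sandwich (k + 1) (Rsq X (k + 1)) V a U =
      ∑ p ∈ Finset.HasAntidiagonal.antidiagonal k, sandwich (p.1 + 1) (X (p.1 + 1)) V
        (sandwich p.2 (Rsq X p.2) V a U) U := by
  have h := sum_Rsq_succ_smul X k fun l l' => (l.map V).prod * a * star (l'.map U).prod
  simp only [← wordProd_eq] at h
  rw [sandwich, h]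
  refine Finset.sum_congr rfl fun p _ => ?_
  simp only [sandwich, Finset.mul_sum, Finset.sum_mul, List.map_append, List.prod_append,
    ← wordProd_eq, star_mul, mul_smul_comm, smul_mul_assoc, mul_assoc]

/-- A truncated form of $\sum_nΦ^n=1+Φ\sum_nΦ^n$: the partial sums of the $R_k^2$ series satisfy a
renewal equation driven by the $X_j$. -/
theorem sum_range_sandwich_succ (X : WeightSeq d) (N : ℕ) (T : Fin d → H →L[ℂ] H) :
    ∑ k ∈ Finset.range (N + 1), sandwich k (Rsq X k) T 1 T = 1 + ∑ j ∈ Finset.range N,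
      sandwich (j + 1) (X (j + 1)) T
        (∑ k ∈ Finset.range (N - j), sandwich k (Rsq X k) T 1 T) T := by
  rw [Finset.sum_range_succ', sandwich_zero, add_comm]
  simp only [sandwich_Rsq_succ, sandwich_sum]
  rw [← Finset.sum_range_diag_flip N fun j k =>
    sandwich (j + 1) (X (j + 1)) T (sandwich k (Rsq X k) T 1 T) T]
  congr 1
  exact Finset.sum_congr rfl fun k _ => Finset.Nat.sum_antidiagonal_eq_sum_range_succ
    (fun j k => sandwich (j + 1) (X (j + 1)) T (sandwich k (Rsq X k) T 1 T) T) k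

theorem clm_smul_nonneg {E : Type*} [NormedAddCommGroup E] [InnerProductSpace ℂ E]
    [CompleteSpace E] {D : E →L[ℂ] E} (hD : 0 ≤ D) {c : ℝ} (hc : 0 ≤ c) : 0 ≤ (c : ℂ) • D := by
  rw [clm_nonneg_iff] at hD ⊢
  intro x
  rw [_root_.smul_apply, inner_smul_right]
  exact mul_nonneg (Complex.zero_le_real.2 hc) (hD x)

/-- Write $S_N$ for the partial sums and $r=\|\Phi_T(I)\|<1$. If $S_m\le C$ for all $m\le N$, the
renewal equation gives $S_{N+1}\le 1+C\sum_jT^{(j)}(X_j\otimes I)T^{(j)*}\le 1+Cr$, and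
$C=(1-r)^{-1}$ is the constant with $1+Cr=C$. -/
theorem exists_sum_sandwich_le (hX : Admissible X) {T : Fin d → H →L[ℂ] H} (hT : T ∈ D H X) :
    ∃ C : ℝ, 0 ≤ C ∧ ∀ N, 0 ≤ (C : ℂ) • (1 : H →L[ℂ] H) -
      ∑ k ∈ Finset.range N, sandwich k (Rsq X k) T 1 T := by
  obtain ⟨P, hP, hlt⟩ := hT
  set r := ‖P‖ with hr
  have hpos : ∀ k, 0 ≤ sandwich (k + 1) (X (k + 1)) T 1 T := fun k =>
    sandwich_nonneg (hX.posSemidef _ (Nat.succ_pos _)) T zero_le_one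
  have hN : ∀ N, 0 ≤ (r : ℂ) • (1 : H →L[ℂ] H) -
      ∑ j ∈ Finset.range N, sandwich (j + 1) (X (j + 1)) T 1 T := fun N => by
    rw [clm_nonneg_iff]
    intro x
    have h1 := sum_le_hasSum (Finset.range N) (fun k _ => (clm_nonneg_iff _).1 (hpos k) x) (hP x x)
    have h2 : inner ℂ x (P x) ≤ ((r * ‖x‖ ^ 2 : ℝ) : ℂ) := by
      have h3 : 0 ≤ inner ℂ x (P x) := (hP x x).nonneg fun k => (clm_nonneg_iff _).1 (hpos k) x
      rw [← Complex.re_add_im (inner ℂ x (P x)), ← (Complex.nonneg_iff.1 h3).2, Complex.ofReal_zero,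
        zero_mul, add_zero, Complex.real_le_real]
      refine (Complex.re_le_norm _).trans ((norm_inner_le_norm _ _).trans ?_)
      nlinarith [P.le_opNorm x, norm_nonneg x]
    have h4 : inner ℂ x (((r : ℂ) • (1 : H →L[ℂ] H)) x) = ((r * ‖x‖ ^ 2 : ℝ) : ℂ) := by
      rw [_root_.smul_apply, one_apply_eq_self, inner_smul_right, inner_self_eq_ofReal]
      push_cast
      ring
    rw [_root_.sub_apply, inner_sub_right, h4, sub_nonneg, _root_.sum_apply, inner_sum]
    exact h1.trans h2
  have hr1 : 0 < 1 - r := by linarith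
  refine ⟨(1 - r)⁻¹, by positivity, fun N => ?_⟩
  set C := (1 - r)⁻¹ with hC
  have hC0 : 0 ≤ C := by positivity
  have hCr : C - 1 = C * r := by
    rw [hC]
    field_simp
    ring
  induction N using Nat.strong_induction_on with
  | _ N ih =>
  rcases N with _ | N
  · rw [Finset.sum_range_zero, sub_zero]
    exact clm_smul_nonneg zero_le_one hC0
  · have key : (C : ℂ) • (1 : H →L[ℂ] H) - ∑ k ∈ Finset.range (N + 1), sandwich k (Rsq X k) T 1 T =
        (C : ℂ) • ((r : ℂ) • (1 : H →L[ℂ] H) -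
          ∑ j ∈ Finset.range N, sandwich (j + 1) (X (j + 1)) T 1 T) +
        ∑ j ∈ Finset.range N, sandwich (j + 1) (X (j + 1)) T ((C : ℂ) • (1 : H →L[ℂ] H) -
          ∑ k ∈ Finset.range (N - j), sandwich k (Rsq X k) T 1 T) T := by
      have h1 : (C : ℂ) • (r : ℂ) • (1 : H →L[ℂ] H) = (C : ℂ) • (1 : H →L[ℂ] H) - 1 := by
        rw [smul_smul, ← Complex.ofReal_mul, ← hCr]
        push_cast
        rw [sub_smul, one_smul]
      rw [sum_range_sandwich_succ, smul_sub, h1]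
      simp only [sandwich_sub, sandwich_smul, Finset.sum_sub_distrib, Finset.smul_sum]
      abel
    rw [key]
    refine add_nonneg (clm_smul_nonneg (hN N) hC0) (Finset.sum_nonneg fun j hj => ?_)
    have := Finset.mem_range.1 hj
    exact sandwich_nonneg (hX.posSemidef _ (Nat.succ_pos _)) T (ih (N - j) (by omega))

/-! ### The column operators `U^{(k)*}` with values in `F(R) ⊗ H` -/

theorem wordProd_comp_perm {A : Type*} [Monoid A] {k : ℕ} {T : Fin d → A}
    (hT : ∀ i j, T i * T j = T j * T i) (α : Fin k → Fin d) (σ : Equiv.Perm (Fin k)) :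
    wordProd T (α ∘ σ) = wordProd T α := by
  refine List.Perm.prod_eq' (Equiv.Perm.ofFn_comp_perm σ fun i => T (α i)) ?_
  rw [List.pairwise_ofFn]
  exact fun i j _ => hT _ _

/-- By Pythagoras the quadratic bound gives summability at every vector, and the same bound on
partial sums passes to the limit as $\|Tx\|\le\sqrt C\|x\|$. -/
theorem exists_hasSum_of_orthogonal {E F : Type*} [NormedAddCommGroup E] [InnerProductSpace ℂ E]
    [NormedAddCommGroup F] [InnerProductSpace ℂ F] [CompleteSpace F] (L : ℕ → E →L[ℂ] F)
    (horth : ∀ i j, i ≠ j → ∀ x y, inner ℂ (L i x) (L j y) = 0) {C : ℝ} (hC : 0 ≤ C)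
    (hL : ∀ N x, ∑ k ∈ Finset.range N, ‖L k x‖ ^ 2 ≤ C * ‖x‖ ^ 2) :
    ∃ T : E →L[ℂ] F, ∀ x, HasSum (fun k => L k x) (T x) := by
  -- For fixed $x$ the lines spanned by the $L_kx$ are pairwise orthogonal, which puts the terms
  -- into an orthogonal family.
  have hfam : ∀ x, OrthogonalFamily ℂ (fun k => (ℂ ∙ L k x : Submodule ℂ F))
      fun k => (ℂ ∙ L k x).subtypeₗᵢ := fun x i j hij v w => by
    obtain ⟨a, ha⟩ := Submodule.mem_span_singleton.1 v.2
    obtain ⟨b, hb⟩ := Submodule.mem_span_singleton.1 w.2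
    change inner ℂ (v : F) (w : F) = 0
    rw [← ha, ← hb, inner_smul_left, inner_smul_right, horth i j hij, mul_zero, mul_zero]
  let f : ∀ x k, (ℂ ∙ L k x : Submodule ℂ F) := fun x k =>
    ⟨L k x, Submodule.mem_span_singleton_self _⟩
  have hsum : ∀ x, Summable fun k => L k x := fun x => by
    refine ((hfam x).summable_iff_norm_sq_summable (f x)).2 ?_
    exact summable_of_sum_range_le (fun _ => sq_nonneg _) fun N => hL N x
  let T : E →ₗ[ℂ] F :=
    { toFun := fun x => ∑' k, L k x
      map_add' := fun x y => by
        simp only [map_add]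
        exact (hsum x).tsum_add (hsum y)
      map_smul' := fun c x => by
        simp only [map_smul, RingHom.id_apply]
        exact (hsum x).tsum_const_smul c }
  refine ⟨T.mkContinuous √C fun x => ?_, fun x => (hsum x).hasSum⟩
  refine le_of_tendsto ((hsum x).hasSum.tendsto_sum_nat.norm) (Filter.Eventually.of_forall fun N => ?_)
  refine le_of_sq_le_sq ?_ (by positivity)
  rw [mul_pow, Real.sq_sqrt hC]
  refine le_trans (le_of_eq ?_) (hL N x)
  exact (hfam x).norm_sum (f x) (Finset.range N)

/-- A realization of the homogeneous components `R_n (ℂ^d)^{Ⓢn}` as mutually orthogonal subspaces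
that span a dense subspace of a Hilbert space `F`. -/
structure HomogSystem (X : WeightSeq d) (F : Type*) [NormedAddCommGroup F]
    [InnerProductSpace ℂ F] where
  toFun : ∀ n, symTens d n →ₗ[ℂ] F
  inner_of_ne : ∀ {n m : ℕ}, n ≠ m → ∀ (θ : symTens d n) (θ' : symTens d m),
    inner ℂ (toFun n θ) (toFun m θ') = 0
  inner_self : ∀ (n : ℕ) (θ θ' : symTens d n),
    inner ℂ (toFun n θ) (toFun n θ') = inner ℂ (R X n θ) (R X n θ')
  exists_hasSum : ∀ ξ : F, ∃ θ : ∀ n, symTens d n, HasSum (fun n => toFun n (θ n)) ξ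

variable {F : Type*} [NormedAddCommGroup F] [InnerProductSpace ℂ F] (E : HomogSystem X F)

theorem HomogSystem.dense (x : F) (h : ∀ n θ, inner ℂ (E.toFun n θ) x = 0) : x = 0 := by
  obtain ⟨θ, hθ⟩ := E.exists_hasSum x
  have h1 := hθ.mapL (innerSL ℂ x)
  have h2 : ∀ n, innerSL ℂ x (E.toFun n (θ n)) = 0 := fun n => by
    rw [innerSL_apply_apply, ← inner_conj_symm, h, map_zero]
  simp only [h2] at h1
  exact inner_self_eq_zero.1 (h1.unique hasSum_zero)

/-- The operator `h ↦ ∑_α R_k e_α ⊗ U_α^* h`, with the basis vectors symmetrized. -/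
def levelOp (U : Fin d → H →L[ℂ] H) (k : ℕ) : H →L[ℂ] HTensor F H :=
  ∑ α : Fin k → Fin d, htmul F H (E.toFun k (symBasis α)) ∘L star (wordProd U α)

theorem levelOp_apply (U : Fin d → H →L[ℂ] H) (k : ℕ) (h : H) :
    levelOp E U k h = ∑ α : Fin k → Fin d,
      htmul F H (E.toFun k (symBasis α)) (star (wordProd U α) h) := by
  simp [levelOp]

theorem inner_levelOp_of_ne (V U : Fin d → H →L[ℂ] H) (a : H →L[ℂ] H) {j k : ℕ} (hjk : j ≠ k)
    (x y : H) : inner ℂ (levelOp E V j x) (hmap 1 a (levelOp E U k y)) = 0 := by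
  simp only [levelOp_apply, map_sum, hmap_htmul, sum_inner, inner_sum, inner_htmul]
  simp [E.inner_of_ne hjk]

/-- Commutativity of both tuples enters here: the coefficients are symmetric in each word, so the
Gram matrix of the symmetrized basis vectors may be replaced by $R_k^2$. -/
theorem inner_levelOp (hX : Admissible X) {V U : Fin d → H →L[ℂ] H}
    (hV : ∀ i j, V i * V j = V j * V i) (hU : ∀ i j, U i * U j = U j * U i)
    (a : H →L[ℂ] H) (k : ℕ) (x y : H) :
    inner ℂ (levelOp E V k x) (hmap 1 a (levelOp E U k y)) =
      inner ℂ x (sandwich k (Rsq X k) V a U y) := by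
  rw [inner_sandwich, ← sum_inner_wop_symBasis (Rsq X k)
    (fun α β => inner ℂ (star (wordProd V α) x) (a (star (wordProd U β) y)))
    (fun σ α β => by rw [wordProd_comp_perm hV]) (fun σ α β => by rw [wordProd_comp_perm hU])]
  simp only [levelOp_apply, map_sum, hmap_htmul, sum_inner, inner_sum, inner_htmul,
    one_apply_eq_self, E.inner_self, inner_R hX]
  rw [Finset.sum_comm]

/-- Pairing against $g$ collapses the sum to one symmetric tensor with coordinates $\langle
g,U_\alpha^*h\rangle$, so identities for level operators reduce to identities in $F$. -/
theorem inner_htmul_levelOp {U : Fin d → H →L[ℂ] H}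
    (hU : ∀ i j, U i * U j = U j * U i) (k : ℕ) (ψ : F) (g h : H) :
    inner ℂ (htmul F H ψ g) (levelOp E U k h) = inner ℂ ψ (E.toFun k
      (symOf (fun α => inner ℂ g (star (wordProd U α) h))
        fun σ α => by rw [wordProd_comp_perm hU])) := by
  rw [← sum_smul_symBasis (symOf (fun α => inner ℂ g (star (wordProd U α) h))
        fun σ α => by rw [wordProd_comp_perm hU])]
  simp only [levelOp_apply, map_sum, map_smul, inner_sum, inner_htmul, inner_smul_right]
  exact Finset.sum_congr rfl fun α _ => mul_comm _ _

theorem norm_levelOp_sq (hX : Admissible X) {U : Fin d → H →L[ℂ] H}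
    (hU : ∀ i j, U i * U j = U j * U i) (k : ℕ) (x : H) :
    ((‖levelOp E U k x‖ ^ 2 : ℝ) : ℂ) = inner ℂ x (sandwich k (Rsq X k) U 1 U x) := by
  rw [← inner_levelOp E hX hU hU, hmap_one, one_apply_eq_self, inner_self_eq_ofReal]

theorem exists_sum_norm_levelOp_le (hX : Admissible X) {U : Fin d → H →L[ℂ] H} (hU : U ∈ Dc H X) :
    ∃ C : ℝ, 0 ≤ C ∧ ∀ N x, ∑ k ∈ Finset.range N, ‖levelOp E U k x‖ ^ 2 ≤ C * ‖x‖ ^ 2 := by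
  obtain ⟨C, hC, h⟩ := exists_sum_sandwich_le hX hU.1
  refine ⟨C, hC, fun N x => ?_⟩
  have h1 := (clm_nonneg_iff _).1 (h N) x
  rw [_root_.sub_apply, inner_sub_right, sub_nonneg, _root_.sum_apply, inner_sum,
    _root_.smul_apply, one_apply_eq_self, inner_smul_right, inner_self_eq_ofReal] at h1
  simp only [← norm_levelOp_sq E hX hU.2] at h1
  exact_mod_cast h1

theorem exists_colOp (hX : Admissible X) {U : Fin d → H →L[ℂ] H} (hU : U ∈ Dc H X) :
    ∃ L : H →L[ℂ] HTensor F H, ∀ x, HasSum (fun k => levelOp E U k x) (L x) := by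
  obtain ⟨C, hC, h⟩ := exists_sum_norm_levelOp_le E hX hU
  refine exists_hasSum_of_orthogonal _ (fun i j hij x y => ?_) hC h
  simpa [hmap_one] using inner_levelOp_of_ne E U U 1 hij x y

/-- The operator `h ↦ ⊕_k (R_k ⊗ I) U^{(k)*} h` from `H` to `F(R) ⊗ H`. -/
def colOp (hX : Admissible X) (U : Dc H X) : H →L[ℂ] HTensor F H :=
  (exists_colOp E hX U.2).choose

theorem hasSum_colOp (hX : Admissible X) (U : Dc H X) (x : H) :
    HasSum (fun k => levelOp E U.1 k x) (colOp E hX U x) :=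
  (exists_colOp E hX U.2).choose_spec x

/-- The operator $I\otimes a$ keeps the degree, so only equal levels of the two columns pair
nontrivially and the double series is diagonal. -/
theorem hasSum_inner_colOp (hX : Admissible X) (V U : Dc H X) (a : H →L[ℂ] H) (x y : H) :
    HasSum (fun k => inner ℂ x (sandwich k (Rsq X k) V.1 a U.1 y))
      (inner ℂ (colOp E hX V x) (hmap 1 a (colOp E hX U y))) := by
  have h1 : HasSum (fun k => inner ℂ (colOp E hX V x) (hmap 1 a (levelOp E U.1 k y)))
      (inner ℂ (colOp E hX V x) (hmap 1 a (colOp E hX U y))) :=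
    (hasSum_colOp E hX U y).mapL (innerSL ℂ (colOp E hX V x) ∘L hmap 1 a)
  convert h1 using 2 with k
  have h2 : HasSum (fun j => inner ℂ (hmap 1 a (levelOp E U.1 k y)) (levelOp E V.1 j x))
      (inner ℂ (hmap 1 a (levelOp E U.1 k y)) (colOp E hX V x)) :=
    (hasSum_colOp E hX V x).mapL (innerSL ℂ (hmap 1 a (levelOp E U.1 k y)))
  have h3 := h2.unique (hasSum_single k fun j hj => by
    rw [← inner_conj_symm, inner_levelOp_of_ne E V.1 U.1 a hj, map_zero])
  rw [← inner_levelOp E hX V.2.2 U.2.2, ← inner_conj_symm, ← h3, inner_conj_symm]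

end

end RKC

namespace RKC

noncomputable section

/-- Normality asks for sequences indexed by `ℕ`, whereas the natural index here is a level together
with a rank one summand; an injection into `ℕ` and padding by zeros make the change. -/
theorem exists_nat_family {G : Type*} [NormedAddCommGroup G]
    [InnerProductSpace ℂ G] {ι : Type*} [Countable ι] (ξ η : ι → G)
    (hξ : Summable fun i => ‖ξ i‖ ^ 2) (hη : Summable fun i => ‖η i‖ ^ 2) :
    ∃ ξ' η' : ℕ → G, Summable (fun n => ‖ξ' n‖ ^ 2) ∧ Summable (fun n => ‖η' n‖ ^ 2) ∧
      ∀ (a : G →L[ℂ] G) (c : ℂ), HasSum (fun i => inner ℂ (ξ i) (a (η i))) c →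
        HasSum (fun n => inner ℂ (ξ' n) (a (η' n))) c := by
  obtain ⟨e, he⟩ := Countable.exists_injective_nat ι
  have hout : ∀ (ζ : ι → G), ∀ n ∉ Set.range e, Function.extend e ζ 0 n = 0 := fun ζ n hn =>
    Function.extend_apply' _ _ _ hn
  refine ⟨Function.extend e ξ 0, Function.extend e η 0, ?_, ?_, fun a c h => ?_⟩
  · refine (he.summable_iff fun n hn => by simp [hout ξ n hn]).1 ?_
    simpa [Function.comp_def, he.extend_apply] using hξ
  · refine (he.summable_iff fun n hn => by simp [hout η n hn]).1 ?_
    simpa [Function.comp_def, he.extend_apply] using hη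
  · refine (he.hasSum_iff fun n hn => by simp [hout ξ n hn]).1 ?_
    simpa [Function.comp_def, he.extend_apply] using h

variable {H : Type*} [NormedAddCommGroup H] [InnerProductSpace ℂ H] [CompleteSpace H]
variable {d : ℕ} {X : WeightSeq d}
variable {F : Type*} [NormedAddCommGroup F] [InnerProductSpace ℂ F] (E : HomogSystem X F)

/-! ### The kernel `K^R_c` -/

theorem posSemidef_Rsq (hX : Admissible X) (k : ℕ) : (Rsq X k).PosSemidef := by
  have h := isPositive_wop_Rsq hX k
  rw [← ContinuousLinearMap.isPositive_toLinearMap_iff, wop,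
    Matrix.coe_toEuclideanCLM_eq_toEuclideanLin, Matrix.isPositive_toEuclideanLin_iff] at h
  exact h

/-- The map `a ↦ L_V^* (I ⊗ a) L_U` on `B(H)`. -/
def kerMap (hX : Admissible X) (V U : Dc H X) : (H →L[ℂ] H) →L[ℂ] (H →L[ℂ] H) :=
  LinearMap.mkContinuous
    { toFun := fun a => (colOp E hX V).adjoint ∘L hmap 1 a ∘L colOp E hX U
      map_add' := fun a b => by
        rw [hmap_one_add, ContinuousLinearMap.add_comp, ContinuousLinearMap.comp_add]
      map_smul' := fun c a => by
        rw [hmap_one_smul, ContinuousLinearMap.smul_comp, ContinuousLinearMap.comp_smul,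
          RingHom.id_apply] }
    (‖(colOp E hX V).adjoint‖ * (‖(1 : F →L[ℂ] F)‖ * ‖colOp E hX U‖)) fun a => by
      refine (ContinuousLinearMap.opNorm_comp_le _ _).trans ?_
      rw [mul_assoc]
      refine mul_le_mul_of_nonneg_left ?_ (norm_nonneg _)
      refine (ContinuousLinearMap.opNorm_comp_le _ _).trans ?_
      refine (mul_le_mul_of_nonneg_right (norm_hmap_le 1 a) (norm_nonneg _)).trans_eq ?_
      ring

theorem kerMap_apply (hX : Admissible X) (V U : Dc H X) (a : H →L[ℂ] H) :
    kerMap E hX V U a = (colOp E hX V).adjoint ∘L hmap 1 a ∘L colOp E hX U := rfl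

theorem inner_kerMap (hX : Admissible X) (V U : Dc H X) (a : H →L[ℂ] H) (x y : H) :
    inner ℂ x (kerMap E hX V U a y) = inner ℂ (colOp E hX V x) (hmap 1 a (colOp E hX U y)) := by
  rw [kerMap_apply, ContinuousLinearMap.comp_apply, ContinuousLinearMap.adjoint_inner_right]
  rfl

theorem hasWeakSum_kerMap (hX : Admissible X) (V U : Dc H X) (a : H →L[ℂ] H) :
    HasWeakSum (fun k => sandwich k (Rsq X k) V.1 a U.1) (kerMap E hX V U a) := fun x y => by
  rw [inner_kerMap]
  exact hasSum_inner_colOp E hX V U a x y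

theorem star_kerMap [CompleteSpace F] (hX : Admissible X) (V U : Dc H X) (a : H →L[ℂ] H) :
    star (kerMap E hX V U a) = kerMap E hX U V (star a) := by
  have h := star_hmap (1 : F →L[ℂ] F) a
  rw [star_one, ContinuousLinearMap.star_eq_adjoint] at h
  rw [kerMap_apply, kerMap_apply, ContinuousLinearMap.star_eq_adjoint,
    ContinuousLinearMap.adjoint_comp, ContinuousLinearMap.adjoint_comp,
    ContinuousLinearMap.adjoint_adjoint, h]
  rfl

/-- Factoring $R_k^2$ into rank one pieces turns each level into a finite sum of vector functionals
of $a$. The vectors $v_i$ do not depend on the tuples, so both normality and complete positivity can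
use them. -/
theorem exists_level_factorization (hX : Admissible X) (k : ℕ) : ∃ (m : ℕ)
    (v : Fin m → (Fin k → Fin d) → ℂ), ∀ (V U : Fin d → H →L[ℂ] H) (a : H →L[ℂ] H) (x y : H),
      inner ℂ x (sandwich k (Rsq X k) V a U y) = ∑ i,
        inner ℂ (∑ α, star (v i α) • star (wordProd V α) x)
          (a (∑ β, star (v i β) • star (wordProd U β) y)) := by
  obtain ⟨m, v, -, h⟩ := exists_sum_smul_inner_eq (posSemidef_Rsq hX k)
  refine ⟨m, v, fun V U a x y => ?_⟩
  rw [inner_sandwich, h]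
  simp only [map_sum, map_smul]

/-- Within one level the squared norms of the factor vectors add up to the squared norm of the level
of $L_Ux$, so the boundedness of the columns gives square summability over all levels. -/
theorem isNormalMap_kerMap (hX : Admissible X) (V U : Dc H X) :
    IsNormalMap (kerMap E hX V U) := by
  intro x y
  choose m v hv using exists_level_factorization (H := H) hX
  have hs : ∀ (T : Dc H X) (z : H), Summable fun p : Σ k, Fin (m k) =>
      ‖∑ α, star (v p.1 p.2 α) • star (wordProd T.1 α) z‖ ^ 2 := fun T z => by
    refine (summable_sigma_of_nonneg fun p => sq_nonneg _).2
      ⟨fun k => (hasSum_fintype _).summable, ?_⟩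
    obtain ⟨C, -, hC⟩ := exists_sum_norm_levelOp_le E hX T.2
    refine Summable.congr (summable_of_sum_range_le (fun _ => sq_nonneg _) fun N => hC N z)
      fun k => ?_
    rw [tsum_fintype]
    have h1 := norm_levelOp_sq E hX T.2.2 k z
    rw [hv] at h1
    simp only [one_apply_eq_self, inner_self_eq_ofReal] at h1
    exact_mod_cast h1
  obtain ⟨ξ, η, hξ, hη, h⟩ := exists_nat_family _ _ (hs V x) (hs U y)
  refine ⟨ξ, η, hξ, hη, fun a => h a _ ?_⟩
  have hsum : Summable fun p : Σ k, Fin (m k) =>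
      inner ℂ (∑ α, star (v p.1 p.2 α) • star (wordProd V.1 α) x)
        (a (∑ α, star (v p.1 p.2 α) • star (wordProd U.1 α) y)) := by
    refine Summable.of_norm_bounded (((hs V x).add (hs U y)).mul_left ‖a‖) fun p => ?_
    set u := ∑ α, star (v p.1 p.2 α) • star (wordProd V.1 α) x
    set w := ∑ α, star (v p.1 p.2 α) • star (wordProd U.1 α) y
    calc ‖inner ℂ u (a w)‖ ≤ ‖u‖ * (‖a‖ * ‖w‖) := (norm_inner_le_norm _ _).trans
          (mul_le_mul_of_nonneg_left (a.le_opNorm w) (norm_nonneg _))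
      _ = ‖a‖ * (‖u‖ * ‖w‖) := by ring
      _ ≤ ‖a‖ * (‖u‖ ^ 2 + ‖w‖ ^ 2) := mul_le_mul_of_nonneg_left
          (by nlinarith [sq_nonneg (‖u‖ - ‖w‖), sq_nonneg ‖u‖, sq_nonneg ‖w‖]) (norm_nonneg _)
  have h1 := hsum.hasSum.sigma fun k => hasSum_fintype _
  simp only [← hv] at h1
  rw [← (h1.unique (hasWeakSum_kerMap E hX V U a x y))]
  exact hsum.hasSum

/-- For each level and each rank one piece, the quadratic form is that of $A$ at the vectors
$\sum_\beta\overline{v_i(\beta)}U_\beta^*w_p$, with $U=z_p$. Allowing any finite index set covers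
the matrix amplifications as well. -/
theorem posSemidef_kerMap [CompleteSpace F] (hX : Admissible X) {ι : Type*} [Fintype ι]
    (z : ι → Dc H X) {A : Matrix ι ι (H →L[ℂ] H)} (hA : A.PosSemidef) :
    (Matrix.of fun p q => kerMap E hX (z p) (z q) (A p q)).PosSemidef := by
  rw [posSemidef_iff]
  refine ⟨?_, fun w => ?_⟩
  · ext p q : 2
    rw [Matrix.conjTranspose_apply, Matrix.of_apply, Matrix.of_apply, star_kerMap, hA.1.apply]
  · choose m v hv using exists_level_factorization (H := H) hX
    have h0 : ∀ p q, HasSum (fun k => inner ℂ (sandwich k (Rsq X k) (z p).1 (A p q) (z q).1 (w q))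
        (w p)) (inner ℂ (kerMap E hX (z p) (z q) (A p q) (w q)) (w p)) := fun p q => by
      have := (hasWeakSum_kerMap E hX (z p) (z q) (A p q) (w p) (w q)).mapL
        (Complex.conjCLE : ℂ →L[ℝ] ℂ)
      simpa using this
    have h1 := (hasSum_sum (s := Finset.univ) fun q _ =>
      hasSum_sum (s := Finset.univ) fun p _ => h0 p q).mapL Complex.reCLM
    rw [Finsupp.sum_fintype _ _ fun p => by simp]
    simp_rw [Finsupp.sum_fintype (N := ℂ) w _ fun p => inner_zero_right _]
    refine h1.nonneg fun k => ?_
    have h2 : ∀ p q, inner ℂ (sandwich k (Rsq X k) (z p).1 (A p q) (z q).1 (w q)) (w p) =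
        ∑ i, inner ℂ (A p q (∑ β, star (v k i β) • star (wordProd (z q).1 β) (w q)))
          (∑ β, star (v k i β) • star (wordProd (z p).1 β) (w p)) := fun p q => by
      rw [← inner_conj_symm, hv, map_sum]
      simp only [inner_conj_symm]
    simp only [h2]
    rw [Finset.sum_congr rfl fun q _ => Finset.sum_comm, Finset.sum_comm, map_sum]
    refine Finset.sum_nonneg fun i _ => ?_
    have h3 := (posSemidef_iff.1 hA).2 (Finsupp.equivFunOnFinite.symm fun p =>
      ∑ β, star (v k i β) • star (wordProd (z p).1 β) (w p))
    rw [Finsupp.sum_fintype _ _ fun p => by simp] at h3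
    simp_rw [Finsupp.sum_fintype (N := ℂ) _ _ fun p => inner_zero_right _] at h3
    exact h3

/-- The kernel `K^R_c`. -/
def kerKRc [CompleteSpace F] (hX : Admissible X) : CPKernel (Dc H X) H where
  toFun := kerMap E hX
  normal := isNormalMap_kerMap E hX
  cp n z m _ hA := posSemidef_kerMap E hX (fun p : Fin m × Fin n => z p.2) hA

theorem isKRc_kerKRc [CompleteSpace F] (hX : Admissible X) :
    IsKRc X (kerKRc (H := H) E hX) := hasWeakSum_kerMap E hX

end

end RKC

namespace RKC

noncomputable section

/-! ### Scalar tuples and density of the ranges of the column operators -/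

theorem exists_perm_of_card_fiber_eq {ι κ : Type*} [Fintype ι] [DecidableEq κ] (α β : ι → κ)
    (h : ∀ j, Fintype.card {i // β i = j} = Fintype.card {i // α i = j}) :
    ∃ σ : Equiv.Perm ι, β = α ∘ σ := by
  refine ⟨(Equiv.sigmaFiberEquiv β).symm.trans ((Equiv.sigmaCongrRight fun j =>
    Fintype.equivOfCardEq (h j)).trans (Equiv.sigmaFiberEquiv α)), funext fun i => ?_⟩
  exact (Fintype.equivOfCardEq (h (β i)) ⟨i, rfl⟩).2.symm

/-- A polynomial over $\mathbb C$ vanishing at every point has zero coefficients. The coefficient at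
the monomial of $\alpha$ is $c(\alpha)$ times the number of rearrangements of $\alpha$, because
words with equal letter counts differ by a permutation. -/
theorem eq_zero_of_forall_sum_prod_eq_zero {d k : ℕ} (c : (Fin k → Fin d) → ℂ)
    (hc : ∀ (σ : Equiv.Perm (Fin k)) α, c (α ∘ σ) = c α)
    (h : ∀ ζ : Fin d → ℂ, ∑ α, c α * ∏ i, ζ (α i) = 0) (α : Fin k → Fin d) : c α = 0 := by
  classical
  let m : (Fin k → Fin d) → Fin d →₀ ℕ := fun β => ∑ i, Finsupp.single (β i) 1
  have hP : ∑ β, MvPolynomial.monomial (m β) (c β) = 0 := by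
    refine MvPolynomial.funext fun ζ => ?_
    rw [map_sum, map_zero, ← h ζ]
    refine Finset.sum_congr rfl fun β _ => ?_
    rw [MvPolynomial.eval_monomial]
    congr 1
    rw [← Finsupp.prod_finsetSum_index (fun _ => pow_zero _) fun _ _ _ => pow_add _ _ _]
    simp
  have h1 := congrArg (MvPolynomial.coeff (m α)) hP
  rw [MvPolynomial.coeff_sum, MvPolynomial.coeff_zero] at h1
  simp only [MvPolynomial.coeff_monomial] at h1
  have hm : ∀ β, m β = m α → c β = c α := fun β hβ => by
    obtain ⟨σ, rfl⟩ := exists_perm_of_card_fiber_eq α β fun j => by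
      have := DFunLike.congr_fun hβ j
      simp only [m, Finsupp.finsetSum_apply, Finsupp.single_apply] at this
      rw [Finset.sum_boole, Finset.sum_boole] at this
      rw [Fintype.card_subtype, Fintype.card_subtype]
      exact_mod_cast this
    exact hc σ α
  rw [← Finset.sum_filter, Finset.sum_congr rfl fun β hβ => hm β (Finset.mem_filter.1 hβ).2,
    Finset.sum_const, smul_eq_zero] at h1
  refine h1.resolve_left (Finset.card_ne_zero_of_mem (a := α) ?_)
  simp

theorem eq_zero_of_hasSum_pow_mul (a : ℕ → ℂ)
    (h : ∀ᶠ t : ℂ in nhds 0, HasSum (fun k => t ^ k * a k) 0) (k : ℕ) : a k = 0 := by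
  let p : FormalMultilinearSeries ℂ ℂ ℂ := fun n => ContinuousMultilinearMap.mkPiRing ℂ (Fin n) (a n)
  have hp : ∀ n, p.coeff n = a n := fun n => by
    simp [FormalMultilinearSeries.coeff, p]
  have h1 : HasFPowerSeriesAt (0 : ℂ → ℂ) p 0 := by
    rw [hasFPowerSeriesAt_iff]
    filter_upwards [h] with t ht
    simpa [hp] using ht
  rw [← hp, h1.eq_zero]
  simp [FormalMultilinearSeries.coeff]

/-! ### Small scalar tuples lie in the domain -/

theorem Admissible.exists_norm_le_pow {d : ℕ} {X : WeightSeq d} (hX : Admissible X) :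
    ∃ M : ℝ, 0 ≤ M ∧ ∀ k, 1 ≤ k → ‖wop (X k)‖ ≤ M ^ k := by
  obtain ⟨b, hb, hbt⟩ := exists_between hX.limsup_lt
  have h1 := Filter.eventually_lt_of_limsup_lt hb
  obtain ⟨N, hN⟩ := Filter.eventually_atTop.1 h1
  have hS : 0 ≤ ∑ k ∈ Finset.range N, ‖wop (X k)‖ := Finset.sum_nonneg fun _ _ => norm_nonneg _
  set M := 1 + b.toReal + ∑ k ∈ Finset.range N, ‖wop (X k)‖ with hM
  have hb0 : 0 ≤ b.toReal := ENNReal.toReal_nonneg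
  have hM1 : 1 ≤ M := by linarith
  refine ⟨M, by linarith, fun k hk => ?_⟩
  rcases lt_or_ge k N with hkN | hkN
  · have h2 : ‖wop (X k)‖ ≤ ∑ k ∈ Finset.range N, ‖wop (X k)‖ :=
      Finset.single_le_sum (f := fun k => ‖wop (X k)‖) (fun _ _ => norm_nonneg _)
        (Finset.mem_range.2 hkN)
    exact (h2.trans (by linarith)).trans (le_self_pow₀ hM1 (by omega))
  · have h2 := (hN k hkN).le
    have hk0 : (0 : ℝ) < k := by exact_mod_cast hk
    have h3 : ‖wop (X k)‖ₑ ≤ b ^ k := by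
      have := ENNReal.rpow_le_rpow h2 hk0.le
      rwa [← ENNReal.rpow_mul, one_div, inv_mul_cancel₀ hk0.ne', ENNReal.rpow_one,
        ENNReal.rpow_natCast] at this
    have h4 := ENNReal.toReal_mono (ENNReal.pow_ne_top hbt.ne) h3
    rw [toReal_enorm, ENNReal.toReal_pow] at h4
    exact h4.trans (pow_le_pow_left₀ hb0 (by linarith) k)

variable {H : Type*} [NormedAddCommGroup H] [InnerProductSpace ℂ H] [CompleteSpace H]

variable (H) in
/-- The tuple of the scalar operators `conj ζ_i`. -/
def scalarTuple {d : ℕ} (ζ : Fin d → ℂ) : Fin d → H →L[ℂ] H := fun i => star (ζ i) • 1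

/-- The conjugate in `scalarTuple` makes the adjoint products holomorphic in $\zeta$, as the power
series argument for density requires. -/
theorem star_wordProd_scalarTuple {d k : ℕ} (ζ : Fin d → ℂ) (α : Fin k → Fin d) (h : H) :
    star (wordProd (scalarTuple H ζ) α) h = (∏ i, ζ (α i)) • h := by
  have : wordProd (scalarTuple H ζ) α = star (∏ i, ζ (α i)) • 1 := by
    rw [wordProd]
    induction k with
    | zero => simp
    | succ k ih =>
      rw [List.ofFn_succ, List.prod_cons, ih (fun i => α i.succ), Fin.prod_univ_succ, scalarTuple,
        smul_mul_smul_comm, one_mul, star_mul']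
  rw [this, star_smul, star_star, star_one]
  simp

theorem eventually_scalarTuple_mem {d : ℕ} {X : WeightSeq d} (hX : Admissible X)
    (ζ : Fin d → ℂ) : ∀ᶠ t : ℂ in nhds 0, scalarTuple H (fun i => t * ζ i) ∈ Dc H X := by
  obtain ⟨M, hM, hXM⟩ := hX.exists_norm_le_pow
  -- With this bound the $k$-th term of $\Phi(I)$ is at most $3^{-k}$ for $k\ge1$, and these sum to
  -- $1/2<1$.
  have hev : ∀ᶠ t : ℂ in nhds 0, M * ∑ i, ‖t * ζ i‖ ^ 2 < 1 / 3 := by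
    have hcont : Continuous fun t : ℂ => M * ∑ i, ‖t * ζ i‖ ^ 2 := by fun_prop
    refine hcont.continuousAt.eventually_lt continuousAt_const ?_
    norm_num
  filter_upwards [hev] with t ht
  set η : Fin d → ℂ := fun i => t * ζ i with hη
  set s := ∑ i, ‖η i‖ ^ 2 with hs
  have hs0 : 0 ≤ s := Finset.sum_nonneg fun _ _ => sq_nonneg _
  let θ : ∀ k, Tens d k := fun k => WithLp.toLp 2 fun α => ∏ i, η (α i)
  have hθ : ∀ k, ‖θ k‖ ^ 2 = s ^ k := fun k => by
    rw [EuclideanSpace.norm_sq_eq, hs, Fintype.sum_pow]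
    refine Finset.sum_congr rfl fun α _ => ?_
    rw [Finset.prod_pow, ← norm_prod]
  let c : ℕ → ℂ := fun k => inner ℂ (θ (k + 1)) (wop (X (k + 1)) (θ (k + 1)))
  have hc : ∀ k, ‖c k‖ ≤ (1 / 3) ^ (k + 1) := fun k => by
    calc ‖c k‖ ≤ ‖θ (k + 1)‖ * (‖wop (X (k + 1))‖ * ‖θ (k + 1)‖) :=
          (norm_inner_le_norm _ _).trans (mul_le_mul_of_nonneg_left
            (ContinuousLinearMap.le_opNorm _ _) (norm_nonneg _))
      _ = ‖wop (X (k + 1))‖ * s ^ (k + 1) := by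
          rw [← hθ]
          ring
      _ ≤ M ^ (k + 1) * s ^ (k + 1) := mul_le_mul_of_nonneg_right (hXM _ (by omega)) (by positivity)
      _ = (M * s) ^ (k + 1) := (mul_pow _ _ _).symm
      _ ≤ (1 / 3) ^ (k + 1) := pow_le_pow_left₀ (by positivity) ht.le _
  have hgeo : HasSum (fun k : ℕ => (1 / 3 : ℝ) ^ (k + 1)) (1 / 2) := by
    have := (hasSum_geometric_of_lt_one (r := (1 / 3 : ℝ)) (by norm_num) (by norm_num)).mul_left
      (1 / 3)
    simp only [← pow_succ'] at this
    rwa [show (1 / 3 * (1 - 1 / 3)⁻¹ : ℝ) = 1 / 2 by norm_num] at this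
  have hsum : Summable c := Summable.of_norm_bounded hgeo.summable hc
  refine ⟨⟨(∑' k, c k) • 1, fun x y => ?_, ?_⟩, fun i j => ?_⟩
  · have h1 := hsum.hasSum.mul_right (inner ℂ x y)
    rw [_root_.smul_apply, one_apply_eq_self, inner_smul_right]
    refine (congrArg (fun f => HasSum f _) (funext fun k => ?_)).mpr h1
    rw [inner_sandwich]
    simp only [star_wordProd_scalarTuple, one_apply_eq_self, inner_smul_left, inner_smul_right, c,
      inner_wop, Finset.sum_mul, θ, smul_eq_mul]
    refine Finset.sum_congr rfl fun α _ => Finset.sum_congr rfl fun β _ => ?_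
    rw [starRingEnd_apply]
    ring
  · refine (norm_smul_le _ _).trans_lt ?_
    have h1 : ‖∑' k, c k‖ ≤ 1 / 2 := tsum_of_norm_bounded hgeo hc
    have h2 : ‖(1 : H →L[ℂ] H)‖ ≤ 1 := ContinuousLinearMap.norm_id_le
    nlinarith [norm_nonneg (1 : H →L[ℂ] H), norm_nonneg (∑' k, c k)]
  · simp only [scalarTuple, smul_mul_smul_comm, mul_one, mul_comm]

variable {d : ℕ} {X : WeightSeq d}
variable {F : Type*} [NormedAddCommGroup F] [InnerProductSpace ℂ F] (E : HomogSystem X F)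

theorem levelOp_scalarTuple (ζ : Fin d → ℂ) (t : ℂ) (k : ℕ) (h : H) :
    levelOp E (scalarTuple H fun i => t * ζ i) k h = t ^ k • ∑ α : Fin k → Fin d,
      (∏ i, ζ (α i)) • htmul F H (E.toFun k (symBasis α)) h := by
  simp only [levelOp_apply, star_wordProd_scalarTuple, Finset.prod_mul_distrib, Finset.prod_const,
    Finset.card_univ, Fintype.card_fin, map_smul, mul_smul, Finset.smul_sum]

theorem eq_zero_of_inner_htmul_homog {G : Type*} [NormedAddCommGroup G]
    [InnerProductSpace ℂ G] [CompleteSpace F] {x : HTensor F G}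
    (h : ∀ n θ g, inner ℂ x (htmul F G (E.toFun n θ) g) = 0) : x = 0 := by
  refine eq_zero_of_inner_htmul fun ξ g => ?_
  let T : F →L[ℂ] HTensor F G := (htmul F G).flip g
  have h1 : T.adjoint x = 0 := E.dense _ fun n θ => by
    rw [ContinuousLinearMap.adjoint_inner_right, ← inner_conj_symm]
    change starRingEnd ℂ (inner ℂ x (htmul F G (E.toFun n θ) g)) = 0
    rw [h, map_zero]
  change inner ℂ (T ξ) x = 0
  rw [← ContinuousLinearMap.adjoint_inner_right, h1, inner_zero_right]

/-- Along the scalar tuples with parameters $t\zeta_i$ the pairing with $x$ is a power series in $t$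
that vanishes near zero, so each degree vanishes separately. Each degree is a polynomial in $\zeta$
with symmetric coefficients, so these vanish too, and $x$ is orthogonal to all homogeneous
elementary tensors. -/
theorem eq_zero_of_inner_colOp [CompleteSpace F] (hX : Admissible X) {x : HTensor F H}
    (h : ∀ (U : Dc H X) g, inner ℂ x (colOp E hX U g) = 0) : x = 0 := by
  refine eq_zero_of_inner_htmul_homog E fun n θ g => ?_
  have h1 : ∀ (ζ : Fin d → ℂ) k, ∑ α : Fin k → Fin d,
      inner ℂ x (htmul F H (E.toFun k (symBasis α)) g) * ∏ i, ζ (α i) = 0 := fun ζ k => by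
    refine eq_zero_of_hasSum_pow_mul (fun k => ∑ α : Fin k → Fin d,
      inner ℂ x (htmul F H (E.toFun k (symBasis α)) g) * ∏ i, ζ (α i)) ?_ k
    filter_upwards [eventually_scalarTuple_mem (H := H) hX ζ] with t ht
    have h2 := (hasSum_colOp E hX ⟨_, ht⟩ g).mapL (innerSL ℂ x)
    simp only [innerSL_apply_apply, h, levelOp_scalarTuple, inner_smul_right, inner_sum] at h2
    simpa only [mul_comm] using h2
  have h2 : ∀ α : Fin n → Fin d, inner ℂ x (htmul F H (E.toFun n (symBasis α)) g) = 0 :=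
    eq_zero_of_forall_sum_prod_eq_zero _ (fun σ α => by rw [symBasis_comp_perm]) fun ζ => h1 ζ n
  rw [← sum_smul_symBasis θ]
  simp only [map_sum, map_smul, _root_.sum_apply, _root_.smul_apply, inner_sum, inner_smul_right,
    h2, mul_zero, Finset.sum_const_zero]

end

end RKC

namespace RKC

noncomputable section

/-! ### Total families in Hilbert spaces -/

section Hilbert

variable {G G' : Type*} [NormedAddCommGroup G] [InnerProductSpace ℂ G] [CompleteSpace G]
  [NormedAddCommGroup G'] [InnerProductSpace ℂ G'] [CompleteSpace G'] {ι : Type*}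

theorem dense_span_of_total (e : ι → G) (he : ∀ x, (∀ i, inner ℂ (e i) x = 0) → x = 0) :
    (Submodule.span ℂ (Set.range e)).topologicalClosure = ⊤ := by
  rw [Submodule.topologicalClosure_eq_top_iff, Submodule.eq_bot_iff]
  exact fun x hx => he x fun i =>
    Submodule.inner_right_of_mem_orthogonal (Submodule.subset_span (Set.mem_range_self i)) hx

theorem denseRange_linearCombination_of_total (e : ι → G)
    (he : ∀ x, (∀ i, inner ℂ (e i) x = 0) → x = 0) :
    DenseRange (Finsupp.linearCombination ℂ e) := fun x => by
  have hx : x ∈ (Submodule.span ℂ (Set.range e)).topologicalClosure := by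
    rw [dense_span_of_total e he]
    trivial
  rw [← Finsupp.range_linearCombination] at hx
  exact hx

theorem exists_linearIsometryEquiv_of_inner_eq (e : ι → G) (f : ι → G')
    (h : ∀ i j, inner ℂ (e i) (e j) = inner ℂ (f i) (f j))
    (he : ∀ x, (∀ i, inner ℂ (e i) x = 0) → x = 0)
    (hf : ∀ x, (∀ i, inner ℂ (f i) x = 0) → x = 0) :
    ∃ U : G ≃ₗᵢ[ℂ] G', ∀ i, U (e i) = f i := by
  let eL := Finsupp.linearCombination ℂ e
  let fL := Finsupp.linearCombination ℂ f
  have hed : DenseRange eL := denseRange_linearCombination_of_total e he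
  have hfd : DenseRange fL := denseRange_linearCombination_of_total f hf
  have hn : ∀ v, ‖fL v‖ = ‖eL v‖ := fun v => by
    have h1 : inner ℂ (fL v) (fL v) = inner ℂ (eL v) (eL v) := by
      simp only [eL, fL, Finsupp.linearCombination_apply, Finsupp.sum, sum_inner, inner_sum,
        inner_smul_left, inner_smul_right, h]
    rw [inner_self_eq_ofReal, inner_self_eq_ofReal, Complex.ofReal_inj] at h1
    exact (sq_eq_sq₀ (norm_nonneg _) (norm_nonneg _)).1 h1
  let M := fL.extendOfNorm eL
  have hM : ∀ v, M (eL v) = fL v := fun v =>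
    LinearMap.extendOfNorm_eq hed ⟨1, fun v => by rw [hn, one_mul]⟩ v
  have hMn : ∀ x, ‖M x‖ = ‖x‖ := fun x =>
    hed.induction_on x (isClosed_eq (by fun_prop) (by fun_prop)) fun v => by rw [hM, hn]
  let I : G →ₗᵢ[ℂ] G' := ⟨M.toLinearMap, hMn⟩
  -- The range of an isometry of complete spaces is closed; totality of $f$ makes it dense.
  have hsurj : Function.Surjective I := by
    have h1 : IsClosed (Set.range I) := I.isometry.isClosedEmbedding.isClosed_range
    have h2 : DenseRange I := fun y => closure_mono (by
      rintro _ ⟨v, rfl⟩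
      exact ⟨eL v, hM v⟩) (hfd y)
    intro y
    have := h2 y
    rwa [h1.closure_eq] at this
  refine ⟨LinearIsometryEquiv.ofSurjective I hsurj, fun i => ?_⟩
  have := hM (Finsupp.single i 1)
  simpa [eL, fL, I] using this

/-- Uniformly bounded partial sums let convergence on a total family extend to its closed span. The
bound is required for all finite sets, since `HasSum` is unconditional. -/
theorem hasSum_clm_of_total (φ : ℕ → G →L[ℂ] ℂ) (ψ : G →L[ℂ] ℂ) {C : ℝ}
    (hC : ∀ S : Finset ℕ, ‖∑ k ∈ S, φ k‖ ≤ C) (e : ι → G)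
    (he : ∀ x, (∀ i, inner ℂ (e i) x = 0) → x = 0)
    (h : ∀ i, HasSum (fun k => φ k (e i)) (ψ (e i))) (x : G) :
    HasSum (fun k => φ k x) (ψ x) := by
  have hC0 : 0 ≤ C := (norm_nonneg _).trans (hC ∅)
  let N : Submodule ℂ G :=
    { carrier := {x | HasSum (fun k => φ k x) (ψ x)}
      add_mem' := fun {x y} hx hy => by
        simp only [Set.mem_ofPred_eq, map_add] at hx hy ⊢
        exact hx.add hy
      zero_mem' := by
        simp only [Set.mem_ofPred_eq, map_zero]
        exact hasSum_zero
      smul_mem' := fun c x hx => by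
        simp only [Set.mem_ofPred_eq, map_smul] at hx ⊢
        exact hx.const_smul c }
  have hN : Submodule.span ℂ (Set.range e) ≤ N := by
    rw [Submodule.span_le]
    rintro _ ⟨i, rfl⟩
    exact h i
  have hx : x ∈ (Submodule.span ℂ (Set.range e)).topologicalClosure := by
    rw [dense_span_of_total e he]
    trivial
  rw [← SetLike.mem_coe, Submodule.topologicalClosure_coe, Metric.mem_closure_iff] at hx
  rw [HasSum, SummationFilter.unconditional_filter, Metric.tendsto_nhds]
  intro ε hε
  -- Replacing $x$ by $y$ costs at most $(C+\|\psi\|)\|x-y\|<\varepsilon/2$; the extra $1$ keeps the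
  -- denominator positive.
  obtain ⟨y, hy, hxy⟩ := hx (ε / (2 * (C + ‖ψ‖ + 1))) (by positivity)
  have hys : HasSum (fun k => φ k y) (ψ y) := hN hy
  rw [HasSum, SummationFilter.unconditional_filter, Metric.tendsto_nhds] at hys
  filter_upwards [hys (ε / 2) (by positivity)] with S hS
  rw [dist_eq_norm] at hS hxy ⊢
  have h1 : ∑ k ∈ S, φ k x - ψ x = (∑ k ∈ S, φ k y - ψ y) +
      ((∑ k ∈ S, φ k) (x - y) - ψ (x - y)) := by
    simp only [_root_.sum_apply, map_sub]
    ring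
  have h2 : ‖(∑ k ∈ S, φ k) (x - y)‖ ≤ C * ‖x - y‖ :=
    ContinuousLinearMap.le_of_opNorm_le _ (hC S) _
  have h3 : ‖ψ (x - y)‖ ≤ ‖ψ‖ * ‖x - y‖ := ψ.le_opNorm _
  rw [lt_div_iff₀ (by positivity)] at hxy
  rw [h1]
  have h4 := norm_add_le (∑ k ∈ S, φ k y - ψ y) ((∑ k ∈ S, φ k) (x - y) - ψ (x - y))
  have h5 := norm_sub_le ((∑ k ∈ S, φ k) (x - y)) (ψ (x - y))
  nlinarith [norm_nonneg (x - y)]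

/-- The scalar case is applied first in the right variable and then, through adjoints and
conjugation, in the left one. -/
theorem hasSum_inner_of_total (B : ℕ → G →L[ℂ] G) (P : G →L[ℂ] G) {C : ℝ}
    (hC : ∀ S : Finset ℕ, ‖∑ k ∈ S, B k‖ ≤ C) (e : ι → G)
    (he : ∀ x, (∀ i, inner ℂ (e i) x = 0) → x = 0)
    (h : ∀ i j, HasSum (fun k => inner ℂ (e i) (B k (e j))) (inner ℂ (e i) (P (e j))))
    (x y : G) : HasSum (fun k => inner ℂ x (B k y)) (inner ℂ x (P y)) := by
  have hC0 : 0 ≤ C := (norm_nonneg _).trans (hC ∅)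
  have h1 : ∀ i y, HasSum (fun k => inner ℂ (e i) (B k y)) (inner ℂ (e i) (P y)) := fun i y => by
    refine hasSum_clm_of_total (fun k => innerSL ℂ (e i) ∘L B k) (innerSL ℂ (e i) ∘L P)
      (C := ‖e i‖ * C) (fun S => ?_) e he (h i) y
    rw [← ContinuousLinearMap.comp_finsetSum]
    refine (ContinuousLinearMap.opNorm_comp_le _ _).trans ?_
    rw [innerSL_apply_norm]
    exact mul_le_mul_of_nonneg_left (hC S) (norm_nonneg _)
  have h2 := hasSum_clm_of_total (fun k => innerSL ℂ y ∘L (B k).adjoint)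
    (innerSL ℂ y ∘L P.adjoint) (C := ‖y‖ * C) (fun S => by
      rw [← ContinuousLinearMap.comp_finsetSum, ← map_sum]
      refine (ContinuousLinearMap.opNorm_comp_le _ _).trans ?_
      rw [innerSL_apply_norm, LinearIsometryEquiv.norm_map]
      exact mul_le_mul_of_nonneg_left (hC S) (norm_nonneg _)) e he (fun i => by
      have := (h1 i y).mapL (Complex.conjCLE : ℂ →L[ℝ] ℂ)
      simpa [ContinuousLinearMap.adjoint_inner_right] using this) x
  have h3 := h2.mapL (Complex.conjCLE : ℂ →L[ℝ] ℂ)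
  simpa [ContinuousLinearMap.adjoint_inner_right] using h3

/-- Conjugation `A ↦ U* A U` of operators by a unitary. -/
def conj (U : G ≃ₗᵢ[ℂ] G') : (G' →L[ℂ] G') →ₐ[ℂ] (G →L[ℂ] G) :=
  (U.symm.conjStarAlgEquiv : (G' →L[ℂ] G') ≃⋆ₐ[ℂ] (G →L[ℂ] G)).toStarAlgHom.toAlgHom

theorem conj_apply (U : G ≃ₗᵢ[ℂ] G') (A : G' →L[ℂ] G') (x : G) :
    conj U A x = U.symm (A (U x)) := rfl

theorem inner_conj (U : G ≃ₗᵢ[ℂ] G') (A : G' →L[ℂ] G') (x y : G) :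
    inner ℂ x (conj U A y) = inner ℂ (U x) (A (U y)) := by
  rw [conj_apply, ← U.inner_map_map, U.apply_symm_apply]

theorem star_conj (U : G ≃ₗᵢ[ℂ] G') (A : G' →L[ℂ] G') : star (conj U A) = conj U (star A) :=
  (map_star (U.symm.conjStarAlgEquiv : (G' →L[ℂ] G') ≃⋆ₐ[ℂ] (G →L[ℂ] G)) A).symm

end Hilbert

/-! ### Operators on `E_K` induced by operators on the reproducing kernel Hilbert space -/

section Corr

variable {S H : Type*} [NormedAddCommGroup H] [InnerProductSpace ℂ H] [CompleteSpace H]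
  (K : CPKernel S H)

/-- The operator on `E_K` given by the left multiplication with an operator on `G`. -/
def corrOp (B : K.Space →L[ℂ] K.Space) : K.Corr →ₗ[ℂ] K.Corr where
  toFun f := K.toOp.symm (B ∘L K.toOp f)
  map_add' f g := by rw [map_add, ContinuousLinearMap.comp_add, map_add]
  map_smul' c f := by
    rw [map_smul, ContinuousLinearMap.comp_smul, map_smul, RingHom.id_apply]

theorem toOp_corrOp (B : K.Space →L[ℂ] K.Space) (f : K.Corr) :
    K.toOp (corrOp K B f) = B ∘L K.toOp f := K.toOp.apply_symm_apply _

theorem corr_ext {f g : K.Corr} (h : K.toOp f = K.toOp g) : f = g := K.toOp.injective h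

/-- Adjointable operators on `E_K` from operators on `G`. -/
def adjOp : (K.Space →L[ℂ] K.Space) →* K.AdjOp where
  toFun B := ⟨corrOp K B, corrOp K (star B), fun f g => by
    rw [CPKernel.corrInner, CPKernel.corrInner, toOp_corrOp, toOp_corrOp,
      ContinuousLinearMap.adjoint_comp, ContinuousLinearMap.star_eq_adjoint,
      ContinuousLinearMap.comp_assoc]⟩
  map_one' := by
    have h1 : corrOp K 1 = LinearMap.id := LinearMap.ext fun f => corr_ext K (by
      rw [toOp_corrOp]
      rfl)
    simp only [star_one, h1]
    rfl
  map_mul' A B := by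
    have h1 : ∀ A B, corrOp K (A * B) = corrOp K A ∘ₗ corrOp K B := fun A B =>
      LinearMap.ext fun f => corr_ext K (by
        rw [LinearMap.comp_apply, toOp_corrOp, toOp_corrOp, toOp_corrOp]
        rfl)
    simp only [star_mul, h1]
    rfl

theorem adjOp_toLM (B : K.Space →L[ℂ] K.Space) : (adjOp K B).toLM = corrOp K B := rfl

theorem adjOp_adj (B : K.Space →L[ℂ] K.Space) : (adjOp K B).adj = corrOp K (star B) := rfl

theorem CPKernel.AdjOp.star_toLM {K : CPKernel S H} (A : K.AdjOp) : (star A).toLM = A.adj := rfl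

theorem CPKernel.AdjOp.star_adj {K : CPKernel S H} (A : K.AdjOp) : (star A).adj = A.toLM := rfl

theorem CPKernel.AdjOp.ext' {K : CPKernel S H} {A B : K.AdjOp} (h : A.toLM = B.toLM)
    (h' : A.adj = B.adj) : A = B := by
  cases A
  cases B
  cases h
  cases h'
  rfl

theorem star_adjOp (B : K.Space →L[ℂ] K.Space) : star (adjOp K B) = adjOp K (star B) := by
  refine CPKernel.AdjOp.ext' ?_ ?_
  · rw [CPKernel.AdjOp.star_toLM, adjOp_adj, adjOp_toLM]
  · rw [CPKernel.AdjOp.star_adj, adjOp_adj, adjOp_toLM, star_star]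

theorem inner_corrInner_corrOp (B : K.Space →L[ℂ] K.Space) (f g : K.Corr) (h h' : H) :
    inner ℂ h (K.corrInner f (corrOp K B g) h') = inner ℂ (K.toOp f h) (B (K.toOp g h')) := by
  rw [CPKernel.corrInner, toOp_corrOp, ContinuousLinearMap.comp_apply,
    ContinuousLinearMap.adjoint_inner_right]
  rfl

theorem corrOp_apply_apply (B : K.Space →L[ℂ] K.Space) (f : K.Corr) (z : S) (b : H →L[ℂ] H) :
    (corrOp K B f).1 z b = (RKHS.kerFun K.Space (z, b)).adjoint ∘L B ∘L K.toOp f := by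
  rw [← K.evalLM_toOp, toOp_corrOp]
  rfl

theorem corr_apply_apply (f : K.Corr) (z : S) (b : H →L[ℂ] H) :
    f.1 z b = (RKHS.kerFun K.Space (z, b)).adjoint ∘L K.toOp f := by
  rw [← K.evalLM_toOp]
  rfl

/-- A multiplier is recognized by its adjoint on kernel functions: taking adjoints in
$B^*k_{(b,z)}=k_{(b,z)}\varphi(z)^*$ and applying them to $f$ gives multiplication by $\varphi$. -/
theorem corrOp_apply_of_mul {B : K.Space →L[ℂ] K.Space} {φ : S → H →L[ℂ] H}
    (h : ∀ z b, star B ∘L RKHS.kerFun K.Space (z, b) = RKHS.kerFun K.Space (z, b) ∘L star (φ z))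
    (f : K.Corr) : (corrOp K B f).1 = fun z b => φ z * f.1 z b := by
  funext z b
  have h1 := congrArg ContinuousLinearMap.adjoint (h z b)
  rw [ContinuousLinearMap.adjoint_comp, ContinuousLinearMap.adjoint_comp,
    ContinuousLinearMap.star_eq_adjoint, ContinuousLinearMap.star_eq_adjoint,
    ContinuousLinearMap.adjoint_adjoint, ContinuousLinearMap.adjoint_adjoint] at h1
  rw [corrOp_apply_apply, corr_apply_apply, ← ContinuousLinearMap.comp_assoc, h1]
  rfl

theorem isMultiplier_of_mul {B : K.Space →L[ℂ] K.Space} {φ : S → H →L[ℂ] H}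
    (h : ∀ z b, star B ∘L RKHS.kerFun K.Space (z, b) = RKHS.kerFun K.Space (z, b) ∘L star (φ z)) :
    K.IsMultiplier φ := fun f hf => by
  rw [← corrOp_apply_of_mul K h ⟨f, hf⟩]
  exact (corrOp K B ⟨f, hf⟩).2

theorem multOp_eq_corrOp {B : K.Space →L[ℂ] K.Space} {φ : S → H →L[ℂ] H}
    (h : ∀ z b, star B ∘L RKHS.kerFun K.Space (z, b) = RKHS.kerFun K.Space (z, b) ∘L star (φ z))
    (hφ : K.IsMultiplier φ) : K.multOp hφ = corrOp K B :=
  LinearMap.ext fun f => Subtype.ext (corrOp_apply_of_mul K h f).symm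

theorem leftMul_eq_corrOp {B : K.Space →L[ℂ] K.Space} {b : H →L[ℂ] H}
    (h : ∀ z c, star B ∘L RKHS.kerFun K.Space (z, c) = RKHS.kerFun K.Space (z, c * b)) :
    K.leftMul b = corrOp K B := by
  refine LinearMap.ext fun f => Subtype.ext ?_
  funext z c
  have h1 := congrArg ContinuousLinearMap.adjoint (h z c)
  rw [ContinuousLinearMap.adjoint_comp, ContinuousLinearMap.star_eq_adjoint,
    ContinuousLinearMap.adjoint_adjoint] at h1
  change f.1 z (c * b) = _
  rw [corrOp_apply_apply, corr_apply_apply, ← ContinuousLinearMap.comp_assoc, h1]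

theorem space_total (x : K.Space)
    (h : ∀ p : (S × (H →L[ℂ] H)) × H, inner ℂ (RKHS.kerFun K.Space p.1 p.2) x = 0) : x = 0 := by
  refine RKHS.ext fun p => ?_
  rw [RKHS.coe_zero, Pi.zero_apply]
  refine ext_inner_left ℂ fun u => ?_
  rw [← RKHS.kerFun_inner, inner_zero_right]
  exact h (p, u)

/-- Elements of $E_K$ are operators $H\to G$, so evaluation $f\otimes h\mapsto fh$ preserves inner
products. It is onto because the kernel functions are among the $f$. -/
theorem exists_interior_equiv : ∃ J : K.Interior ≃ₗᵢ[ℂ] K.Space,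
    ∀ f h, J (K.tmul f h) = K.toOp f h := by
  obtain ⟨J, hJ⟩ := exists_linearIsometryEquiv_of_inner_eq
    (fun p : K.Corr × H => K.tmul p.1 p.2) (fun p => K.toOp p.1 p.2) (fun p q => by
      rw [K.inner_tmul, CPKernel.corrInner, ContinuousLinearMap.comp_apply,
        ContinuousLinearMap.adjoint_inner_right]) (fun x hx => by
      refine RKHS.ext fun f => ?_
      rw [RKHS.coe_zero, Pi.zero_apply]
      refine ext_inner_left ℂ fun u => ?_
      rw [← RKHS.kerFun_inner, inner_zero_right]
      exact hx (f, u)) (fun x hx => space_total K x fun p => by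
      rw [← K.toOp_kerElt]
      exact hx (K.kerElt p.1.2 p.1.1, p.2))
  exact ⟨J, fun f h => hJ (f, h)⟩

theorem isAmplification_corrOp {J : K.Interior ≃ₗᵢ[ℂ] K.Space}
    (hJ : ∀ f h, J (K.tmul f h) = K.toOp f h) (B : K.Space →L[ℂ] K.Space) :
    K.IsAmplification (corrOp K B) (conj J B) := fun f h => by
  rw [conj_apply, hJ, J.symm_apply_eq, hJ, toOp_corrOp]
  rfl

end Corr

end

end RKC

namespace RKC

noncomputable section

variable {F H : Type*} [NormedAddCommGroup F] [InnerProductSpace ℂ F] [CompleteSpace F]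
  [NormedAddCommGroup H] [InnerProductSpace ℂ H] [CompleteSpace H]
variable {d : ℕ} {X : WeightSeq d}

/-! ### The unitary from the reproducing kernel Hilbert space to `F(R) ⊗ H` -/

/-- The two families have the same Gram matrix, since $(I\otimes b^*)^*(I\otimes a^*)=I\otimes ba^*$
sits between $L_z^*$ and $L_w$. For totality of the target family the vectors with $b=1$ already
suffice. -/
theorem exists_space_equiv (E : HomogSystem X F) (hX : Admissible X) (K : CPKernel (Dc H X) H)
    (hK : ∀ V U a x y, inner ℂ x (K.toFun V U a y) =
      inner ℂ (colOp E hX V x) (hmap 1 a (colOp E hX U y))) :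
    ∃ U : K.Space ≃ₗᵢ[ℂ] HTensor F H, ∀ z b h,
      U (RKHS.kerFun K.Space (z, b) h) = hmap 1 (star b) (colOp E hX z h) := by
  obtain ⟨U, hU⟩ := exists_linearIsometryEquiv_of_inner_eq
    (fun p : (Dc H X × (H →L[ℂ] H)) × H => RKHS.kerFun K.Space p.1 p.2)
    (fun p => hmap 1 (star p.1.2) (colOp E hX p.1.1 p.2)) (fun p q => by
      rw [← ContinuousLinearMap.adjoint_inner_right, ← ContinuousLinearMap.comp_apply,
        K.kerFun_adjoint_comp, hK, ← ContinuousLinearMap.adjoint_inner_right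
        (hmap 1 (star p.1.2)), ← ContinuousLinearMap.star_eq_adjoint, star_hmap, star_star,
        star_one, ← mul_apply_eq_comp, hmap_mul, one_mul])
    (space_total K) (fun x hx => eq_zero_of_inner_colOp E hX fun V g => by
      have := hx ((V, 1), g)
      rw [star_one, hmap_one, one_apply_eq_self] at this
      rw [← inner_conj_symm, this, map_zero])
  exact ⟨U, fun z b h => hU ((z, b), h)⟩

/-! ### Shift tuples -/

/-- The tuple `w` acts on the homogeneous system `E` as the tuple of weighted shifts does: the
adjoint of `w i` removes the letter `i`. -/
structure HomogSystem.IsShiftTuple (E : HomogSystem X F) (w : Fin d → F →L[ℂ] F) : Prop where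
  star_succ : ∀ i n (θ : symTens d (n + 1)), star (w i) (E.toFun (n + 1) θ) =
    E.toFun n ⟨annihilate n [i] θ, annihilate_singleton_mem i θ.2⟩
  star_zero : ∀ i (θ : symTens d 0), star (w i) (E.toFun 0 θ) = 0

variable (E : HomogSystem X F) {w : Fin d → F →L[ℂ] F}

theorem wordProd_cons {A : Type*} [Monoid A] {k : ℕ} (T : Fin d → A) (i : Fin d)
    (γ : Fin k → Fin d) : wordProd T (Fin.cons i γ : Fin (k + 1) → Fin d) = T i * wordProd T γ := by
  simp [wordProd, List.ofFn_succ]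

/-- In coordinates, removing a leading $i$ replaces $U_\gamma^*$ by
$(U_iU_\gamma)^*=U_\gamma^*U_i^*$, so $U_i^*$ is applied to $h$ first. -/
theorem hmap_star_levelOp_succ (hw : E.IsShiftTuple w) {U : Fin d → H →L[ℂ] H}
    (hU : ∀ i j, U i * U j = U j * U i) (i : Fin d) (k : ℕ) (h : H) :
    hmap (star (w i)) 1 (levelOp E U (k + 1) h) = levelOp E U k (star (U i) h) := by
  rw [← sub_eq_zero]
  refine eq_zero_of_inner_htmul fun ξ g => ?_
  rw [inner_sub_right, sub_eq_zero, ← ContinuousLinearMap.adjoint_inner_left,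
    ← ContinuousLinearMap.star_eq_adjoint, star_hmap, star_star, hmap_htmul,
    inner_htmul_levelOp E hU, inner_htmul_levelOp E hU,
    ← ContinuousLinearMap.adjoint_inner_right, ← ContinuousLinearMap.star_eq_adjoint,
    hw.star_succ, star_one, one_apply_eq_self]
  congr 3
  ext γ
  change annihilate k [i] (WithLp.toLp 2 _) γ = _
  rw [annihilate_singleton_apply]
  change inner ℂ g (star (wordProd U (Fin.cons i γ : Fin (k + 1) → Fin d)) h) = _
  rw [wordProd_cons, star_mul]
  rfl

theorem hmap_star_levelOp_zero (hw : E.IsShiftTuple w) {U : Fin d → H →L[ℂ] H}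
    (i : Fin d) (h : H) : hmap (star (w i)) 1 (levelOp E U 0 h) = 0 := by
  simp only [levelOp_apply, map_sum, hmap_htmul, hw.star_zero, map_zero,
    _root_.zero_apply, Finset.sum_const_zero]

theorem hmap_star_colOp (hX : Admissible X) (hw : E.IsShiftTuple w) (U : Dc H X) (i : Fin d)
    (h : H) : hmap (star (w i)) 1 (colOp E hX U h) = colOp E hX U (star (U.1 i) h) := by
  have h1 := (hasSum_colOp E hX U h).mapL (hmap (star (w i)) (1 : H →L[ℂ] H))
  -- Degree zero is split off, as the adjoint shift kills it; the other degrees move down by one.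
  rw [hasSum_nat_add_iff' 1 |>.symm] at h1
  simp only [hmap_star_levelOp_succ E hw U.2.2, Finset.sum_range_one,
    hmap_star_levelOp_zero E hw, sub_zero] at h1
  exact h1.unique (hasSum_colOp E hX U _)


/-- The operators $w_i^*\otimes I$ and $I\otimes b^*$ commute, so the relation for the columns
extends to the kernel functions at every $b$. -/
theorem star_conj_comp_kerFun_shift (hw : E.IsShiftTuple w) {K : CPKernel (Dc H X) H}
    {hX : Admissible X} {U : K.Space ≃ₗᵢ[ℂ] HTensor F H}
    (hU : ∀ z b h, U (RKHS.kerFun K.Space (z, b) h) = hmap 1 (star b) (colOp E hX z h))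
    (i : Fin d) (z : Dc H X) (b : H →L[ℂ] H) :
    star (conj U (hmap (w i) 1)) ∘L RKHS.kerFun K.Space (z, b) =
      RKHS.kerFun K.Space (z, b) ∘L star (coord X i z) := by
  refine ContinuousLinearMap.ext fun h => ?_
  rw [star_conj, star_hmap, star_one]
  change U.symm (hmap (star (w i)) 1 (U (RKHS.kerFun K.Space (z, b) h))) =
    RKHS.kerFun K.Space (z, b) (star (z.1 i) h)
  rw [U.symm_apply_eq, hU, hU, ← hmap_star_colOp E hX hw, ← mul_apply_eq_comp,
    ← mul_apply_eq_comp, hmap_mul, hmap_mul, one_mul, mul_one, one_mul, mul_one]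

theorem star_conj_comp_kerFun_one {K : CPKernel (Dc H X) H}
    {hX : Admissible X} {U : K.Space ≃ₗᵢ[ℂ] HTensor F H}
    (hU : ∀ z b h, U (RKHS.kerFun K.Space (z, b) h) = hmap 1 (star b) (colOp E hX z h))
    (b : H →L[ℂ] H) (z : Dc H X) (c : H →L[ℂ] H) :
    star (conj U (hmap 1 b)) ∘L RKHS.kerFun K.Space (z, c) =
      RKHS.kerFun K.Space (z, c * b) := by
  refine ContinuousLinearMap.ext fun h => ?_
  rw [star_conj, star_hmap, star_one]
  change U.symm (hmap 1 (star b) (U (RKHS.kerFun K.Space (z, c) h))) = _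
  rw [U.symm_apply_eq, hU, hU, ← mul_apply_eq_comp, hmap_mul, one_mul, star_mul]

end

end RKC

namespace RKC

noncomputable section

variable {F H : Type*} [NormedAddCommGroup F] [InnerProductSpace ℂ F] [CompleteSpace F]
  [NormedAddCommGroup H] [InnerProductSpace ℂ H] [CompleteSpace H]
variable {d : ℕ} {X : WeightSeq d} (E : HomogSystem X F) {w : Fin d → F →L[ℂ] F}

/-! ### Contractivity of the weighted shifts -/

theorem annihilate_nil {n : ℕ} (θ : Tens d n) : annihilate n [] θ = θ := by
  ext γ
  rw [annihilate_apply, List.nil_append, coeff_ofFn]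

theorem star_listProd_apply (hw : E.IsShiftTuple w) (l : List (Fin d)) {m n : ℕ}
    (h : l.length + m = n) (θ : symTens d n) : star (l.map w).prod (E.toFun n θ) =
      E.toFun m ⟨annihilate m l θ, annihilate_mem l h θ.2⟩ := by
  induction l generalizing n with
  | nil =>
    obtain rfl : m = n := by simpa using h
    simp [annihilate_nil]
  | cons i l ih =>
    obtain rfl : n = (l.length + m) + 1 := by rw [← h, List.length_cons]; ring
    rw [List.map_cons, List.prod_cons, star_mul, mul_apply_eq_comp, hw.star_succ, ih rfl]
    congr 2
    exact annihilate_annihilate [i] l (by rw [List.length_singleton]; ring) _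

theorem star_listProd_apply_of_lt (hw : E.IsShiftTuple w) (l : List (Fin d)) {n : ℕ}
    (h : n < l.length) (θ : symTens d n) : star (l.map w).prod (E.toFun n θ) = 0 := by
  induction l generalizing n with
  | nil => simp at h
  | cons i l ih =>
    rw [List.map_cons, List.prod_cons, star_mul, mul_apply_eq_comp]
    cases n with
    | zero => rw [hw.star_zero, map_zero]
    | succ n =>
      rw [hw.star_succ]
      exact ih (by simpa using h) _

variable (X w) in
/-- The operator `w^{(k+1)} (X_{k+1} ⊗ I) w^{(k+1)*}`. -/
def rowOp (k : ℕ) : F →L[ℂ] F :=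
  ∑ α, ∑ β, X (k + 1) α β • (wordProd w α * star (wordProd w β))

theorem inner_rowOp (k : ℕ) (x y : F) : inner ℂ x (rowOp X w k y) =
    ∑ α, ∑ β, X (k + 1) α β * inner ℂ (star (wordProd w α) x) (star (wordProd w β) y) := by
  simp only [rowOp, _root_.sum_apply, inner_sum, _root_.smul_apply, inner_smul_right,
    mul_apply_eq_comp]
  simp only [ContinuousLinearMap.star_eq_adjoint, ContinuousLinearMap.adjoint_inner_left]

theorem rowOp_nonneg (hX : Admissible X) (k : ℕ) : 0 ≤ rowOp X w k := by
  rw [clm_nonneg_iff]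
  intro x
  rw [inner_rowOp]
  exact sum_mul_inner_nonneg (hX.posSemidef _ (by omega)) _

theorem inner_rowOp_of_lt (hw : E.IsShiftTuple w) {k n : ℕ} (h : n ≤ k) (θ : symTens d n) (x : F) :
    inner ℂ x (rowOp X w k (E.toFun n θ)) = 0 := by
  rw [inner_rowOp]
  refine Finset.sum_eq_zero fun α _ => Finset.sum_eq_zero fun β _ => ?_
  rw [wordProd_eq w β, star_listProd_apply_of_lt E hw _ (by simpa using Nat.lt_succ_of_le h),
    inner_zero_right, mul_zero]

/-- Both arguments lose $k+1$ letters, so vectors of different degrees stay in different degrees or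
are killed. -/
theorem inner_rowOp_of_ne (hw : E.IsShiftTuple w) (k : ℕ) {n m : ℕ} (h : n ≠ m)
    (θ : symTens d n) (θ' : symTens d m) :
    inner ℂ (E.toFun n θ) (rowOp X w k (E.toFun m θ')) = 0 := by
  rw [inner_rowOp]
  refine Finset.sum_eq_zero fun α _ => Finset.sum_eq_zero fun β _ => ?_
  rw [wordProd_eq w β, wordProd_eq w α]
  rcases lt_or_ge n (k + 1) with hn | hn
  · rw [star_listProd_apply_of_lt E hw (List.ofFn α) (by simpa using hn), inner_zero_left, mul_zero]
  rcases lt_or_ge m (k + 1) with hm | hm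
  · rw [star_listProd_apply_of_lt E hw (List.ofFn β) (by simpa using hm), inner_zero_right,
      mul_zero]
  rw [star_listProd_apply E hw (List.ofFn α) (m := n - (k + 1)) (by simp; omega),
    star_listProd_apply E hw (List.ofFn β) (m := m - (k + 1)) (by simp; omega),
    E.inner_of_ne (by omega), mul_zero]

theorem inner_rowOp_self (hw : E.IsShiftTuple w) (k j n : ℕ) (h : k + 1 + j = n)
    (θ θ' : symTens d n) : inner ℂ (E.toFun n θ) (rowOp X w k (E.toFun n θ')) =
      ∑ α, ∑ β, X (k + 1) α β * inner ℂ (R X j (annihilate j (List.ofFn α) (θ : Tens d n)))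
        (R X j (annihilate j (List.ofFn β) (θ' : Tens d n))) := by
  rw [inner_rowOp]
  refine Finset.sum_congr rfl fun α _ => Finset.sum_congr rfl fun β _ => ?_
  rw [wordProd_eq w β, wordProd_eq w α, star_listProd_apply E hw (List.ofFn α) (by simpa using h),
    star_listProd_apply E hw (List.ofFn β) (by simpa using h), E.inner_self]

/-! ### The defect $I-P_0$ of the shift tuple -/

/-- The vacuum vector. -/
def vacuum : F := E.toFun 0 (symBasis Fin.elim0)

/-- The projection onto the vacuum vector. -/
def vacuumProj : F →L[ℂ] F := (innerSL ℂ (vacuum E)).smulRight (vacuum E)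

theorem inner_vacuumProj (x y : F) :
    inner ℂ x (vacuumProj E y) = inner ℂ (vacuum E) y * inner ℂ x (vacuum E) := by
  simp [vacuumProj]

theorem toFun_zero_eq (θ : symTens d 0) :
    E.toFun 0 θ = (θ : Tens d 0) Fin.elim0 • vacuum E := by
  conv_lhs => rw [← sum_smul_symBasis θ]
  rw [Fintype.sum_unique, map_smul]
  congr 1

theorem inner_vacuum_self (hX : Admissible X) : inner ℂ (vacuum E) (vacuum E) = 1 := by
  rw [vacuum, E.inner_self, inner_R hX, Rsq_zero]
  have h1 : wop (1 : Matrix (Fin 0 → Fin d) (Fin 0 → Fin d) ℂ) = 1 := map_one _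
  rw [h1, one_apply_eq_self, coe_symBasis]
  simp

/-- In degree $N+1$ this is exactly the recursion for $R_{N+1}^2$, so the sum acts as the identity.
In degree zero every term vanishes, and what is missing is the vacuum projection. -/
theorem hasSum_inner_rowOp (hX : Admissible X) (hw : E.IsShiftTuple w) (n m : ℕ)
    (θ : symTens d n) (θ' : symTens d m) :
    HasSum (fun k => inner ℂ (E.toFun n θ) (rowOp X w k (E.toFun m θ')))
      (inner ℂ (E.toFun n θ) ((1 - vacuumProj E) (E.toFun m θ'))) := by
  rw [_root_.sub_apply, one_apply_eq_self, inner_sub_right, inner_vacuumProj]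
  rcases eq_or_ne n m with rfl | hnm
  · cases n with
    | zero =>
      simp only [inner_rowOp_of_lt E hw (Nat.zero_le _)]
      convert hasSum_zero using 1
      rw [toFun_zero_eq, toFun_zero_eq]
      simp only [inner_smul_left, inner_smul_right, inner_vacuum_self E hX]
      ring
    | succ N =>
      have h0 : inner ℂ (vacuum E) (E.toFun (N + 1) θ') = 0 := E.inner_of_ne (by omega) _ _
      rw [h0, zero_mul, sub_zero, E.inner_self, inner_R_succ hX,
        Finset.Nat.sum_antidiagonal_eq_sum_range_succ_mk]
      -- Only $k\le N$ contributes, because the $k$-th operator removes $k+1$ letters.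
      convert hasSum_sum_of_ne_finset_zero (s := Finset.range N.succ)
        (L := SummationFilter.unconditional ℕ) ?_ using 1
      · refine Finset.sum_congr rfl fun k hk => ?_
        rw [inner_rowOp_self E hw k (N - k) (N + 1) (by
          have := Finset.mem_range.1 hk
          omega)]
      · intro k hk
        exact inner_rowOp_of_lt E hw (by simpa using hk) _ _
  · simp only [inner_rowOp_of_ne E hw _ hnm]
    convert hasSum_zero using 1
    rw [E.inner_of_ne hnm, zero_sub, neg_eq_zero, mul_eq_zero]
    rcases Nat.eq_zero_or_pos m with rfl | hm
    · exact Or.inr (E.inner_of_ne hnm _ _)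
    · exact Or.inl (E.inner_of_ne (by omega) _ _)

/-- Degrees decouple, so the form on a partial sum of homogeneous vectors is a sum of diagonal
terms; continuity handles the limit. -/
theorem HomogSystem.clm_nonneg {D : F →L[ℂ] F}
    (h : ∀ {n m : ℕ}, n ≠ m → ∀ (θ : symTens d n) (θ' : symTens d m),
      inner ℂ (E.toFun n θ) (D (E.toFun m θ')) = 0)
    (h' : ∀ n (θ : symTens d n), 0 ≤ inner ℂ (E.toFun n θ) (D (E.toFun n θ))) : 0 ≤ D := by
  rw [clm_nonneg_iff]
  intro x
  obtain ⟨θ, hθ⟩ := E.exists_hasSum x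
  have h1 := hθ.tendsto_sum_nat
  have h2 := h1.inner (𝕜 := ℂ) ((D.continuous.tendsto x).comp h1)
  refine ge_of_tendsto' h2 fun N => ?_
  simp only [Function.comp_apply, map_sum, sum_inner, inner_sum]
  refine Finset.sum_nonneg fun i hi => ?_
  rw [Finset.sum_eq_single i (fun j _ hj => h hj _ _) (fun hi' => absurd hi hi')]
  exact h' _ _

theorem vacuumProj_nonneg : 0 ≤ vacuumProj E := by
  rw [clm_nonneg_iff]
  intro x
  rw [inner_vacuumProj, ← inner_conj_symm x (vacuum E)]
  exact mul_star_self_nonneg _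

/-- In each degree a finite sum of nonnegative terms is dominated by the full sum, which is at most
the identity. This uniform bound allows passage from homogeneous vectors to all of $F\otimes H$. -/
theorem norm_sum_rowOp_le (hX : Admissible X) (hw : E.IsShiftTuple w) (S : Finset ℕ) :
    ‖∑ k ∈ S, rowOp X w k‖ ≤ 1 := by
  have h0 : 0 ≤ ∑ k ∈ S, rowOp X w k := Finset.sum_nonneg fun k _ => rowOp_nonneg hX k
  rw [CStarAlgebra.norm_le_one_iff_of_nonneg _ h0, ← sub_nonneg]
  refine E.clm_nonneg (fun hnm θ θ' => ?_) fun n θ => ?_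
  · rw [_root_.sub_apply, one_apply_eq_self, inner_sub_right, E.inner_of_ne hnm,
      _root_.sum_apply, inner_sum]
    simp [inner_rowOp_of_ne E hw _ hnm]
  · rw [_root_.sub_apply, one_apply_eq_self, inner_sub_right, _root_.sum_apply, inner_sum,
      sub_nonneg]
    refine (sum_le_hasSum S (fun k _ => (clm_nonneg_iff _).1 (rowOp_nonneg hX k) _)
      (hasSum_inner_rowOp E hX hw n n θ θ)).trans ?_
    rw [_root_.sub_apply, one_apply_eq_self, inner_sub_right]
    exact sub_le_self _ ((clm_nonneg_iff _).1 (vacuumProj_nonneg E) _)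

theorem hasSum_inner_hmap_rowOp (hX : Admissible X) (hw : E.IsShiftTuple w) (x y : HTensor F H) :
    HasSum (fun k => inner ℂ x (hmap (rowOp X w k) 1 y))
      (inner ℂ x (hmap (1 - vacuumProj E) 1 y)) := by
  refine hasSum_inner_of_total (fun k => ampl F H (rowOp X w k)) (ampl F H (1 - vacuumProj E))
    (C := ‖(1 : H →L[ℂ] H)‖) (fun S => ?_)
    (fun p : (Σ n, symTens d n) × H => htmul F H (E.toFun p.1.1 p.1.2) p.2)
    (fun x hx => eq_zero_of_inner_htmul_homog E fun n θ g => ?_) (fun p q => ?_) x y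
  · rw [← map_sum]
    refine (norm_hmap_le _ _).trans ?_
    exact mul_le_of_le_one_left (norm_nonneg _) (norm_sum_rowOp_le E hX hw S)
  · rw [← inner_conj_symm, hx (⟨n, θ⟩, g), map_zero]
  · have h1 := (hasSum_inner_rowOp E hX hw p.1.1 q.1.1 p.1.2 q.1.2).mul_right (inner ℂ p.2 q.2)
    have h2 : ∀ A, ampl F H A (htmul F H (E.toFun q.1.1 q.1.2) q.2) =
      htmul F H (A (E.toFun q.1.1 q.1.2)) q.2 := fun A => hmap_htmul _ _ _ _
    simpa only [h2, inner_htmul] using h1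

theorem hmap_vacuumProj_nonneg : 0 ≤ hmap (vacuumProj E) (1 : H →L[ℂ] H) := by
  obtain ⟨c, hc⟩ := CStarAlgebra.nonneg_iff_eq_star_mul_self.1 (vacuumProj_nonneg E)
  rw [hc, ← one_mul (1 : H →L[ℂ] H), ← hmap_mul, ← star_one (H →L[ℂ] H), ← star_hmap, clm_nonneg_iff]
  intro x
  rw [mul_apply_eq_comp, ContinuousLinearMap.star_eq_adjoint,
    ContinuousLinearMap.adjoint_inner_right, star_one, inner_self_eq_ofReal]
  exact Complex.zero_le_real.2 (by positivity)

theorem map_wordProd {A B : Type*} [Monoid A] [Monoid B] {k : ℕ} (f : A →* B) (T : Fin d → A)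
    (α : Fin k → Fin d) : f (wordProd T α) = wordProd (fun i => f (T i)) α := by
  rw [wordProd, wordProd, map_list_prod, List.map_ofFn]
  rfl

/-- Operators on $G$ act on $E_K=B(H,G)$ by composition on the left, with matrix coefficients those
of the operator at $f h$ and $g h'$. So the series is transported from $F\otimes H$, where its sum
is $(I-P_0)\otimes I$. -/
theorem isXHContractive_of_isShiftTuple (hw : E.IsShiftTuple w) {K : CPKernel (Dc H X) H}
    {hX : Admissible X} {U : K.Space ≃ₗᵢ[ℂ] HTensor F H}
    (hU : ∀ z b h, U (RKHS.kerFun K.Space (z, b) h) = hmap 1 (star b) (colOp E hX z h)) :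
    IsXHContractive X K := by
  let π : (F →L[ℂ] F) →ₐ[ℂ] (K.Space →L[ℂ] K.Space) := (conj U).comp (ampl F H)
  have hπ : ∀ A x y, inner ℂ x (π A y) = inner ℂ (U x) (hmap A 1 (U y)) := fun A x y =>
    inner_conj U (hmap A 1) x y
  have hπs : ∀ A, star (π A) = π (star A) := fun A => by
    change star (conj U (hmap A 1)) = conj U (hmap (star A) 1)
    rw [star_conj, star_hmap, star_one]
  have hker := star_conj_comp_kerFun_shift E hw hU
  refine ⟨fun i => isMultiplier_of_mul K (hker i), fun i => adjOp K (π (w i)),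
    fun i => (multOp_eq_corrOp K (hker i) _).symm, adjOp K (π (1 - vacuumProj E)), ?_, ?_⟩
  · intro f g h h'
    have h1 : ∀ {k : ℕ} (α β : Fin k → Fin d), wordProd (fun i => adjOp K (π (w i))) α *
        star (wordProd (fun i => adjOp K (π (w i))) β) =
          adjOp K (π (wordProd w α * star (wordProd w β))) := fun {k} α β => by
      have h2 := fun α : Fin k → Fin d => map_wordProd ((adjOp K).comp (π : _ →* _)) w α
      simp only [MonoidHom.comp_apply, MonoidHom.coe_coe] at h2
      rw [← h2, ← h2, star_adjOp, hπs, ← map_mul, ← map_mul]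
    simp only [h1, adjOp_toLM, inner_corrInner_corrOp]
    rw [hπ]
    convert hasSum_inner_hmap_rowOp E hX hw (U (K.toOp f h)) (U (K.toOp g h')) using 2 with k
    rw [← hπ, rowOp]
    simp only [map_sum, map_smul, _root_.sum_apply, inner_sum, _root_.smul_apply,
      inner_smul_right]
  · intro f
    rw [← sub_nonneg, clm_nonneg_iff]
    intro h
    rw [_root_.sub_apply, inner_sub_right, adjOp_toLM, inner_corrInner_corrOp, hπ,
      CPKernel.corrInner, ContinuousLinearMap.comp_apply,
      ContinuousLinearMap.adjoint_inner_right, ← U.inner_map_map]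
    have h1 : hmap (1 - vacuumProj E) (1 : H →L[ℂ] H) = 1 - hmap (vacuumProj E) 1 := by
      change ampl F H _ = 1 - ampl F H _
      rw [map_sub, map_one]
    rw [h1, _root_.sub_apply, inner_sub_right, one_apply_eq_self, sub_sub_cancel]
    exact (clm_nonneg_iff _).1 (hmap_vacuumProj_nonneg E) _

end

end RKC

namespace RKC

noncomputable section

/-! ### The weighted Drury-Arveson space -/

variable {d : ℕ} (X : WeightSeq d)

/-- The homogeneous elements of `F(R)`. -/
def homogSystem : HomogSystem X (FR X) where
  toFun := homog X
  inner_of_ne := inner_homog_homog_of_ne X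
  inner_self := inner_homog_homog X
  exists_hasSum ξ := by
    choose θ hθ using exists_homog_eq ξ
    exact ⟨θ, hasSum_homog ξ θ hθ⟩

theorem inner_coe_W (i : Fin d) (η ψ : FR X) :
    inner ℂ η (W X i ψ) = inner ℂ (η : Fock d) (shift X i ψ) :=
  (FR X).inner_orthogonalProjectionOnto_eq_of_mem_left η _

/-- Testing against vectors of $F(R)$ makes the compression invisible, and the adjoint action of the
full shift on $R_{n+1}\theta$ stays inside $F(R)$ since removing a letter preserves symmetry. -/
theorem isShiftTuple_W (hX : Admissible X) : (homogSystem X).IsShiftTuple (W X) where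
  star_succ i n θ := by
    refine ext_inner_right ℂ fun ψ => ?_
    rw [ContinuousLinearMap.star_eq_adjoint, ContinuousLinearMap.adjoint_inner_left, inner_coe_W]
    change inner ℂ (lp.single 2 (n + 1) (R X (n + 1) θ) : Fock d) _ = inner ℂ (homog X n _) ψ
    rw [lp.inner_single_left, ((isShift_shift hX i) ψ).2, inner_homog_left,
      ← inner_conj_symm, inner_weightZ_creation hX, inner_conj_symm]
  star_zero i θ := by
    refine ext_inner_right ℂ fun ψ => ?_
    rw [ContinuousLinearMap.star_eq_adjoint, ContinuousLinearMap.adjoint_inner_left, inner_coe_W]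
    change inner ℂ (lp.single 2 0 (R X 0 θ) : Fock d) _ = _
    rw [lp.inner_single_left, ((isShift_shift hX i) ψ).1, inner_zero_right, inner_zero_left]

/-! ### Assembly of the unitary and the kernel for a shift tuple -/

theorem exists_unitary_of_isShiftTuple {F H : Type*} [NormedAddCommGroup F]
    [InnerProductSpace ℂ F] [CompleteSpace F] [NormedAddCommGroup H] [InnerProductSpace ℂ H]
    [CompleteSpace H] {X : WeightSeq d} {E : HomogSystem X F} {w : Fin d → F →L[ℂ] F}
    (hw : E.IsShiftTuple w) {K : CPKernel (Dc H X) H} {hX : Admissible X}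
    {U : K.Space ≃ₗᵢ[ℂ] HTensor F H}
    (hU : ∀ z b h, U (RKHS.kerFun K.Space (z, b) h) = hmap 1 (star b) (colOp E hX z h))
    (hS : ∀ i, K.IsMultiplier (coord X i)) :
    ∃ Λ : K.Interior ≃ₗᵢ[ℂ] HTensor F H,
      (∀ i, ∃ A : K.Interior →L[ℂ] K.Interior, K.IsAmplification (K.multOp (hS i)) A ∧
        ∀ ξ, Λ.symm (hmap (w i) (1 : H →L[ℂ] H) (Λ ξ)) = A ξ) ∧
      (∀ b : H →L[ℂ] H, ∃ A : K.Interior →L[ℂ] K.Interior, K.IsAmplification (K.leftMul b) A ∧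
        ∀ ξ, Λ (A ξ) = hmap (1 : F →L[ℂ] F) b (Λ ξ)) := by
  obtain ⟨J, hJ⟩ := exists_interior_equiv K
  refine ⟨J.trans U, fun i => ⟨conj J (conj U (hmap (w i) 1)), ?_, fun ξ => rfl⟩,
    fun b => ⟨conj J (conj U (hmap 1 b)), ?_, fun ξ => ?_⟩⟩
  · rw [multOp_eq_corrOp K (star_conj_comp_kerFun_shift E hw hU i) (hS i)]
    exact isAmplification_corrOp K hJ _
  · rw [leftMul_eq_corrOp K (star_conj_comp_kerFun_one E hU b)]
    exact isAmplification_corrOp K hJ _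
  · rw [conj_apply, conj_apply, LinearIsometryEquiv.trans_apply, J.apply_symm_apply,
      U.apply_symm_apply]
    rfl

theorem exists_kernel_of_isShiftTuple {F H : Type*} [NormedAddCommGroup F]
    [InnerProductSpace ℂ F] [CompleteSpace F] [NormedAddCommGroup H] [InnerProductSpace ℂ H]
    [CompleteSpace H] {X : WeightSeq d} (hX : Admissible X) {E : HomogSystem X F}
    {w : Fin d → F →L[ℂ] F} (hw : E.IsShiftTuple w) :
    ∃ K : CPKernel (Dc H X) H, IsKRc X K ∧ ∃ hS : ∀ i, K.IsMultiplier (coord X i),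
      (∃ Λ : K.Interior ≃ₗᵢ[ℂ] HTensor F H,
        (∀ i, ∃ A : K.Interior →L[ℂ] K.Interior, K.IsAmplification (K.multOp (hS i)) A ∧
          ∀ ξ, Λ.symm (hmap (w i) (1 : H →L[ℂ] H) (Λ ξ)) = A ξ) ∧
        (∀ b : H →L[ℂ] H, ∃ A : K.Interior →L[ℂ] K.Interior, K.IsAmplification (K.leftMul b) A ∧
          ∀ ξ, Λ (A ξ) = hmap (1 : F →L[ℂ] F) b (Λ ξ))) ∧
      IsXHContractive X K := by
  obtain ⟨U, hU⟩ := exists_space_equiv (H := H) E hX (kerKRc E hX) (inner_kerMap E hX)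
  exact ⟨kerKRc E hX, isKRc_kerKRc E hX,
    fun i => isMultiplier_of_mul _ (star_conj_comp_kerFun_shift E hw hU i),
    exists_unitary_of_isShiftTuple hw hU _, isXHContractive_of_isShiftTuple E hw hU⟩

end

end RKC

open RKC

theorem proposition5p4 {d : ℕ} (hd : 0 < d) (X : WeightSeq d) (hX : Admissible X)
    (H : Type*) [NormedAddCommGroup H] [InnerProductSpace ℂ H] [CompleteSpace H] :
    -- the weighted shifts on the full Fock space are well defined bounded operators
    (∀ i, IsShift X i (shift X i)) ∧
    -- the kernel `K^R_c` is well defined and completely positive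
    ∃ K : CPKernel (Dc H X) H, IsKRc X K ∧
    -- (1) the coordinate functions are multipliers
    ∃ hS : ∀ i, K.IsMultiplier (coord X i),
    -- (2) the unitary `Λ`
    (∃ Λ : K.Interior ≃ₗᵢ[ℂ] HTensor (FR X) H,
      (∀ i, ∃ A : K.Interior →L[ℂ] K.Interior, K.IsAmplification (K.multOp (hS i)) A ∧
        ∀ ξ, Λ.symm (hmap (W X i) (1 : H →L[ℂ] H) (Λ ξ)) = A ξ) ∧
      (∀ b : H →L[ℂ] H, ∃ A : K.Interior →L[ℂ] K.Interior, K.IsAmplification (K.leftMul b) A ∧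
        ∀ ξ, Λ (A ξ) = hmap (1 : FR X →L[ℂ] FR X) b (Λ ξ))) ∧
    -- (3) contractivity
    IsXHContractive X K := by
  exact ⟨isShift_shift hX, exists_kernel_of_isShiftTuple hX (isShiftTuple_W X hX)⟩
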